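/- **Theorem 4.4 (finite-type invariants are stratified by braid index for closed 3-braids).** *Conventions.* Knots are oriented knots in $S^3$; singular knots may have finitely many transverse double points. A knot invariant $v$ with values in an abelian group $A$ is extended to singular knots by $v(K_p)=v(K_{p_+})-v(K_{p_-})$, where $K_{p_+}$ and $K_{p_-}$ are obtained by resolving the double point $p$ to a positive, respectively negative, crossing. It is of finite type of order $\le n$ if it vanishes on all singular knots with more than $n$ double points. A chord diagram is an oriented circle with finitely many chords, given by the cyclic sequence of the labels of the chord endpoints, up to relabelling. A word $W$ in symbols $A(i,j)$ ($1\le i<j\le m$), each a horizontal chord joining strands $i$ and $j$ of the trivial $m$-braid, has as its closure the chord diagram obtained by closing $W$ with the braid $x_m=\sigma_{m-1}^{-1}\cdots\sigma_2^{-1}\sigma_1^{-1}$, so that the strands are traversed in the order $1,2,\dots,m$. Then $W$ is called a braiding of that diagram on $m\ge 1$ strands, and the braid index $b(D)$ of a chord diagram $D$ is the least number of strands of a braiding of $D$. The standard singular knot $K_W$ of $W$ is the closure of the singular $m$-braid obtained from $W$ by replacing each $A(i,j)$ by the pure braid $A_{ij}=(\sigma_{j-1}^{-1}\cdots\sigma_{i+1}^{-1})\,\sigma_i^2\,(\sigma_{i+1}\cdots\sigma_{j-1})$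 with the first crossing of the full twist $\sigma_i^2$ made into a double point, followed by $x_m$. *Statement.* For every chord diagram $D$ with $b(D)\le 3$ choose any braiding $W_D$ of $D$ on at most $3$ strands, and let $K_D=K_{W_D}$. Let $n\ge 0$ and let $\beta$ be a (nonsingular) 3-braid whose closure $\hat\beta$ is a knot. Then there are integers $c_D$, almost all zero, nonzero only for chord diagrams $D$ with at most $n$ chords and $b(D)\le 3$, and depending only on $\beta$, $n$ and the chosen braidings, such that: 1. (The computation uses only crossing changes on closed braids with at most 3 strands.) In the free abelian group on singular knot diagrams, $\hat\beta-\sum_D c_D K_D$ lies in the subgroup generated by * the skein relations $K_p-K_{p_+}+K_{p_-}$ for crossing changes in closed singular braids on at most 3 strands that are singular knots, * the differences $K-K'$ of isotopic singular knots that are both given as closed braids on at most 3 strands, * the singular knots with more than $n$ double points that are given as closed braids on at most 3 strands. 2. For every abelian group $A$ and every $A$-valued knot invariant $v$ of finite type of order $\le n$, $$v(\hat\beta)=\sum_D c_D\, v(K_D).$$ Thus $v(\hat\beta)$ is computed from the entries of the completed actuality table for $v$ that belong to chord diagrams of braid index at most $3$. -/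

import Mathlib

/-! ### Oriented singular knot diagrams

A diagram is put in general position with respect to a height function and is read from top to
bottom as a word of elementary slices (maxima, minima, crossings, double points). -/

/-- The three kinds of crossings. `over`: the strand running from upper left to lower right passes
over the other one; `under`: it passes under it; `sing`: a transverse double point. -/
inductive CrossKind where
  | over
  | under
  | sing
  deriving DecidableEq

/-- Exchange over and under. -/
def CrossKind.flip : CrossKind → CrossKind
  | .over => .under
  | .under => .over
  | .sing => .sing

/-- Elementary slices. `cup d` is a local maximum, creating two new adjacent strands; its left
strand points down if `d = true` and up if `d = false`. `cap` is a local minimum, joining two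
adjacent strands. `cross k` is a crossing (or double point) of two adjacent strands. -/
inductive SliceKind where
  | cup (d : Bool)
  | cap
  | cross (k : CrossKind)
  deriving DecidableEq

/-- Number of strands entering the slice from above. -/
def SliceKind.ins : SliceKind → ℕ
  | .cup _ => 0
  | .cap => 2
  | .cross _ => 2

/-- Number of strands leaving the slice below. -/
def SliceKind.outs : SliceKind → ℕ
  | .cup _ => 2
  | .cap => 0
  | .cross _ => 2

/-- A slice with `pos` strands passing to the left of it. -/
structure Slice where
  kind : SliceKind
  pos : ℕ
  deriving DecidableEq

/-- Words of slices, read from top to bottom. -/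
abbrev SliceWord := List Slice

namespace SliceWord

/-- The directions (`true` = down) of the strands at a level, from left to right, are changed by a
slice; `none` if the slice does not fit. -/
def dirStep (s : List Bool) (l : Slice) : Option (List Bool) :=
  match l.kind with
  | .cup d => if l.pos ≤ s.length then some (s.take l.pos ++ d :: (!d) :: s.drop l.pos) else none
  | .cap =>
    match s.drop l.pos with
    | a :: b :: r => if a = b then none else some (s.take l.pos ++ r)
    | _ => none
  | .cross _ =>
    match s.drop l.pos with
    | a :: b :: r => some (s.take l.pos ++ b :: a :: r)
    | _ => none

/-- Directions of the strands at the bottom of a word that starts with no strands. -/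
def dirs (D : SliceWord) : Option (List Bool) := D.foldlM dirStep []

/-- The word is an oriented closed (link) diagram. -/
def IsClosed (D : SliceWord) : Prop := D.dirs = some []

/-- Bookkeeping for counting components while sweeping down a diagram: the name of the piece to
which each strand belongs, the next unused name, and the number of components already closed. -/
structure Sweep where
  names : List ℕ
  fresh : ℕ
  done : ℕ

/-- A maximum starts a new piece; a minimum joins two different pieces into one, or closes up a
component if it joins the two ends of one piece; strands go straight through crossings and double
points. -/
def sweepStep (s : Sweep) (l : Slice) : Sweep :=
  match l.kind with
  | .cup _ =>
    ⟨s.names.take l.pos ++ s.fresh :: s.fresh :: s.names.drop l.pos, s.fresh + 1, s.done⟩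
  | .cap =>
    match s.names.drop l.pos with
    | a :: b :: r =>
      if a = b then ⟨s.names.take l.pos ++ r, s.fresh, s.done + 1⟩
      else ⟨(s.names.take l.pos ++ r).map (fun x => if x = b then a else x), s.fresh, s.done⟩
    | _ => s
  | .cross _ =>
    match s.names.drop l.pos with
    | a :: b :: r => ⟨s.names.take l.pos ++ b :: a :: r, s.fresh, s.done⟩
    | _ => s

/-- Number of components of a closed diagram. -/
def components (D : SliceWord) : ℕ := (D.foldl sweepStep ⟨[], 0, 0⟩).done

/-- The word is a diagram of an oriented singular knot: closed, with exactly one component. -/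
def IsKnot (D : SliceWord) : Prop := D.IsClosed ∧ D.components = 1

/-- Number of double points. -/
def numSing (D : SliceWord) : ℕ := D.countP (fun l => l.kind = .cross .sing)

/-- The local moves for diagrams of oriented singular links read with respect to a height function:
exchange of the heights of distant slices, cancellation of a maximum against a minimum, sliding a
strand across a maximum or a minimum, the three Reidemeister moves, moving a strand over or under
a double point, and twisting at a double point. -/
inductive LocalMove : SliceWord → SliceWord → Prop
  | exchange (A B : SliceKind) (i j : ℕ) (h : i ≤ j) :
      LocalMove [⟨A, i⟩, ⟨B, j + A.outs⟩] [⟨B, j + A.ins⟩, ⟨A, i⟩]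
  | zigzagLeft (d : Bool) (i : ℕ) : LocalMove [⟨.cup d, i⟩, ⟨.cap, i + 1⟩] []
  | zigzagRight (d : Bool) (i : ℕ) : LocalMove [⟨.cup d, i + 1⟩, ⟨.cap, i⟩] []
  | slideCup (d : Bool) (k : CrossKind) (i : ℕ) :
      LocalMove [⟨.cup d, i⟩, ⟨.cross k, i + 1⟩] [⟨.cup d, i + 1⟩, ⟨.cross k.flip, i⟩]
  | slideCap (k : CrossKind) (i : ℕ) :
      LocalMove [⟨.cross k, i + 1⟩, ⟨.cap, i⟩] [⟨.cross k.flip, i⟩, ⟨.cap, i + 1⟩]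
  | reidemeisterOneCup (d : Bool) (k : CrossKind) (hk : k ≠ .sing) (i : ℕ) :
      LocalMove [⟨.cup d, i⟩, ⟨.cross k, i⟩] [⟨.cup (!d), i⟩]
  | reidemeisterOneCap (k : CrossKind) (hk : k ≠ .sing) (i : ℕ) :
      LocalMove [⟨.cross k, i⟩, ⟨.cap, i⟩] [⟨.cap, i⟩]
  | reidemeisterTwo (k : CrossKind) (hk : k ≠ .sing) (i : ℕ) :
      LocalMove [⟨.cross k, i⟩, ⟨.cross k.flip, i⟩] []
  | slideStrandRight (k t : CrossKind) (ht : t ≠ .sing) (i : ℕ) :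
      LocalMove [⟨.cross k, i⟩, ⟨.cross t, i + 1⟩, ⟨.cross t, i⟩]
        [⟨.cross t, i + 1⟩, ⟨.cross t, i⟩, ⟨.cross k, i + 1⟩]
  | slideStrandLeft (k t : CrossKind) (ht : t ≠ .sing) (i : ℕ) :
      LocalMove [⟨.cross k, i + 1⟩, ⟨.cross t, i⟩, ⟨.cross t, i + 1⟩]
        [⟨.cross t, i⟩, ⟨.cross t, i + 1⟩, ⟨.cross k, i⟩]
  | twist (t : CrossKind) (ht : t ≠ .sing) (i : ℕ) :
      LocalMove [⟨.cross .sing, i⟩, ⟨.cross t, i⟩] [⟨.cross t, i⟩, ⟨.cross .sing, i⟩]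

/-- A local move performed inside a closed diagram. -/
def Move (D E : SliceWord) : Prop :=
  D.IsClosed ∧ E.IsClosed ∧ ∃ p q l r : SliceWord,
    LocalMove l r ∧ D = p ++ l ++ q ∧ E = p ++ r ++ q

/-- Isotopy of oriented singular links, in terms of diagrams. -/
def Isotopic : SliceWord → SliceWord → Prop := Relation.EqvGen Move

/-- The kind of a positive crossing of the strands `i` and `i + 1` at the bottom of `p`: two
strands with the same vertical direction, or two with opposite ones. -/
def posKind (p : SliceWord) (i : ℕ) : CrossKind :=
  match p.dirs with
  | some s => if s[i]? = s[i + 1]? then .under else .over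
  | none => .under

end SliceWord

/-! ### Finite-type invariants -/

section Invariants

variable {A : Type*} [AddCommGroup A]

/-- `v` is an invariant of oriented knots: it takes the same value on isotopic diagrams of
(nonsingular) knots. Values on other words are irrelevant. -/
def IsKnotInvariant (v : SliceWord → A) : Prop :=
  ∀ D E : SliceWord, D.IsKnot → E.IsKnot → D.numSing = 0 → E.numSing = 0 →
    D.Isotopic E → v D = v E

/-- Resolve the double points of `q` in the diagram `p ++ q`, where `p` has been resolved
already. -/
def resolveFrom (v : SliceWord → A) (p : SliceWord) : SliceWord → A
  | [] => v p
  | ⟨.cross .sing, i⟩ :: q =>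
      resolveFrom v (p ++ [⟨.cross (p.posKind i), i⟩]) q -
        resolveFrom v (p ++ [⟨.cross (p.posKind i).flip, i⟩]) q
  | l :: q => resolveFrom v (p ++ [l]) q

/-- The extension of `v` to singular knots by `v (K_p) = v (K_{p+}) - v (K_{p-})`. -/
def extendSing (v : SliceWord → A) (D : SliceWord) : A := resolveFrom v [] D

/-- `v` vanishes on all singular knots with more than `n` double points. -/
def IsFiniteType (n : ℕ) (v : SliceWord → A) : Prop :=
  ∀ D : SliceWord, D.IsKnot → n < D.numSing → extendSing v D = 0

end Invariants

/-! ### Singular braids and their closures -/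

/-- A letter of a singular braid word on `m` strands: the crossing or double point of the strands
in the positions `idx` and `idx + 1` (counted from `0`). -/
structure BraidLetter (m : ℕ) where
  kind : CrossKind
  idx : ℕ
  lt : idx + 1 < m

/-- Singular braid words on `m` strands, read from top to bottom. All strands point down, so that
the positive generators are the crossings of kind `under`. -/
abbrev SingularBraid (m : ℕ) := List (BraidLetter m)

namespace SingularBraid

/-- The word contains no double point. -/
def IsNonsingular {m : ℕ} (w : SingularBraid m) : Prop := ∀ l ∈ w, l.kind ≠ .sing

/-- The closure: `m` nested maxima, the braid on the `m` strands that point down, and `m` nested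
minima. -/
def closure {m : ℕ} (w : SingularBraid m) : SliceWord :=
  (List.range m).map (fun i => ⟨.cup true, i⟩) ++ w.map (fun l => ⟨.cross l.kind, l.idx⟩) ++
    (List.range m).reverse.map (fun i => ⟨.cap, i⟩)

end SingularBraid

/-- The generators `σ_k` (or their inverses, or double points) for `i < k < j`, in increasing
order of `k`. -/
def lettersBetween {m : ℕ} (kind : CrossKind) (i j : Fin m) : SingularBraid m :=
  (List.finRange m).filterMap fun k =>
    if h : i < k ∧ k < j then
      some ⟨kind, k, Nat.lt_of_le_of_lt (Nat.succ_le_of_lt h.2) j.isLt⟩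
    else none

/-- The standard braid `σ_{m-1}⁻¹ ⋯ σ_2⁻¹ σ_1⁻¹`, whose closure is the unknot. -/
def standardUnknotBraid (m : ℕ) : SingularBraid m :=
  ((List.finRange m).filterMap fun k =>
    if h : (k : ℕ) + 1 < m then some ⟨.over, k, h⟩ else none).reverse

/-! ### Chord diagrams and their braidings -/

/-- A name of a chord diagram: the labels of the chords in the order in which their endpoints are
met along the oriented circle. -/
abbrev ChordName := {N : List ℕ // ∀ a ∈ N, N.count a = 2}

/-- Two names describe the same diagram if they agree up to the starting point and the labels. -/
instance chordNameSetoid : Setoid ChordName where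
  r N N' := ∃ (k : ℕ) (f : Equiv.Perm ℕ), N'.1 = (N.1.rotate k).map f
  iseqv :=
    { refl := fun N => ⟨0, 1, by simp⟩
      symm := by
        rintro ⟨N, hN⟩ ⟨N', hN'⟩ ⟨k, f, h⟩
        refine ⟨N.length - k % N.length, f⁻¹, ?_⟩
        have h' : N' = (N.rotate k).map f := h
        change N = (N'.rotate _).map _
        subst h'
        rw [← List.map_rotate, List.map_map, ← List.rotate_mod N k, List.rotate_rotate]
        rcases Nat.eq_zero_or_pos N.length with h0 | h0
        · rw [List.length_eq_zero_iff] at h0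
          subst h0; simp
        · rw [Nat.add_sub_cancel' (Nat.mod_lt _ h0).le, List.rotate_length]
          have : (⇑f⁻¹ ∘ ⇑f) = id := by ext x; simp
          simp
      trans := by
        rintro ⟨N, hN⟩ ⟨N', hN'⟩ ⟨N'', hN''⟩ ⟨k, f, h⟩ ⟨l, g, h'⟩
        refine ⟨k + l, f.trans g, ?_⟩
        have h1 : N' = (N.rotate k).map f := h
        have h2 : N'' = (N'.rotate l).map g := h'
        change N'' = (N.rotate (k + l)).map _
        rw [h2, h1, ← List.map_rotate, List.map_map, List.rotate_rotate]
        rfl }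

/-- Chord diagrams: an oriented circle with finitely many chords. -/
abbrev ChordDiagram := Quotient chordNameSetoid

/-- Number of chords. -/
def ChordDiagram.numChords (D : ChordDiagram) : ℕ :=
  Quotient.liftOn D (fun N => N.1.length / 2) (by
    rintro N N' ⟨k, f, h⟩
    rw [h]; simp)

/-- The generator `A(i,j)`: a horizontal chord joining the strands `i < j`. -/
structure ChordGen (m : ℕ) where
  left : Fin m
  right : Fin m
  lt : left < right

/-- The chord has an endpoint on the strand `s`. -/
def ChordGen.meets {m : ℕ} (g : ChordGen m) (s : Fin m) : Bool := g.left = s || g.right = s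

/-- Words in the chord monoid. -/
abbrev ChordWord (m : ℕ) := List (ChordGen m)

/-- The labels met along the strand `s` when the chords are numbered in the order of the word. -/
def ChordWord.readStrand {m : ℕ} (W : ChordWord m) (s : Fin m) : List ℕ :=
  (List.range W.length).filter fun k => W[k]?.any fun g => g.meets s

/-- The labels met along the circle. In the closure with the standard unknot braid the
strands are traversed in the order `1, 2, …, m`. -/
def ChordWord.readName {m : ℕ} (W : ChordWord m) : List ℕ :=
  (List.finRange m).flatMap W.readStrand

theorem ChordWord.count_readName {m : ℕ} (W : ChordWord m) (a : ℕ) (ha : a ∈ W.readName) :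
    W.readName.count a = 2 := by
  have hlt : a < W.length := by
    simp only [ChordWord.readName, ChordWord.readStrand, List.mem_flatMap, List.mem_filter,
      List.mem_range] at ha
    obtain ⟨s, -, h, -⟩ := ha
    exact h
  have key : ∀ s : Fin m, (W.readStrand s).count a =
      (if W[a].left = s then 1 else 0) + (if W[a].right = s then 1 else 0) := by
    intro s
    have hne := ne_of_lt W[a].lt
    have hd : (W.readStrand s).Nodup := List.nodup_range.filter _
    rw [hd.count]
    have hm : a ∈ W.readStrand s ↔ (W[a].left = s ∨ W[a].right = s) := by
      simp [ChordWord.readStrand, ChordGen.meets, hlt]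
    simp only [hm]
    by_cases h1 : W[a].left = s <;> by_cases h2 : W[a].right = s <;> simp_all
  rw [ChordWord.readName, List.count_flatMap]
  have : (List.map (List.count a ∘ W.readStrand) (List.finRange m)).sum =
      ∑ s : Fin m, ((if W[a].left = s then 1 else 0) + (if W[a].right = s then 1 else 0)) := by
    rw [← List.sum_ofFn, List.ofFn_eq_map]
    congr 1
    apply List.map_congr_left
    intro s _
    exact key s
  rw [this, Finset.sum_add_distrib]
  simp

/-- The chord diagram represented by the closure of a word in the chord monoid. -/
def ChordWord.diagram {m : ℕ} (W : ChordWord m) : ChordDiagram :=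
  Quotient.mk chordNameSetoid ⟨W.readName, W.count_readName⟩

/-- The generator `A_ij = (σ_{j-1}⁻¹ ⋯ σ_{i+1}⁻¹) σ_i² (σ_{i+1} ⋯ σ_{j-1})` of the pure braid
group with one crossing of its full twist replaced by a double point. -/
def ChordGen.singularBraid {m : ℕ} (g : ChordGen m) : SingularBraid m :=
  have h : (g.left : ℕ) + 1 < m :=
    Nat.lt_of_le_of_lt (Nat.succ_le_of_lt g.lt) g.right.isLt
  (lettersBetween .over g.left g.right).reverse ++
    [⟨.sing, g.left, h⟩, ⟨.under, g.left, h⟩] ++ lettersBetween .under g.left g.right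

/-- The standard singular knot respecting the closure of a word in the chord monoid, as a closed
singular braid. -/
def ChordWord.standardKnot {m : ℕ} (W : ChordWord m) : SliceWord :=
  SingularBraid.closure (W.flatMap ChordGen.singularBraid ++ standardUnknotBraid m)

/-- A braided chord diagram: a number of strands and a word in the chord monoid. -/
structure Braiding where
  strands : ℕ
  pos : 1 ≤ strands
  word : ChordWord strands

/-- The braid index of a chord diagram: the least number of strands of its braidings. -/
noncomputable def ChordDiagram.braidIndex (D : ChordDiagram) : ℕ∞ :=
  ⨅ (B : Braiding) (_ : B.word.diagram = D), (B.strands : ℕ∞)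

/-! ### Computing with crossing changes of bounded braid index -/

/-- Closures of singular braids on at most `b` strands that are singular knots. -/
def closedBraidKnots (b : ℕ) : Set SliceWord :=
  {D | D.IsKnot ∧ ∃ m ≤ b, ∃ w : SingularBraid m, D = w.closure}

/-- The skein relations `K_p - K_{p+} + K_{p-}` of crossing changes in closed braids on at most `b`
strands. -/
def skeinRelations (b : ℕ) : Set (SliceWord →₀ ℤ) :=
  {x | ∃ m ≤ b, ∃ (u w : SingularBraid m) (i : ℕ) (h : i + 1 < m),
    SliceWord.IsKnot (SingularBraid.closure (u ++ ⟨.sing, i, h⟩ :: w)) ∧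
    x = Finsupp.single (SingularBraid.closure (u ++ ⟨.sing, i, h⟩ :: w)) 1 -
      Finsupp.single (SingularBraid.closure (u ++ ⟨.under, i, h⟩ :: w)) 1 +
      Finsupp.single (SingularBraid.closure (u ++ ⟨.over, i, h⟩ :: w)) 1}

/-- Differences of isotopic singular knots that are closed braids on at most `b` strands. -/
def isotopyRelations (b : ℕ) : Set (SliceWord →₀ ℤ) :=
  {x | ∃ D ∈ closedBraidKnots b, ∃ E ∈ closedBraidKnots b, D.Isotopic E ∧
    x = Finsupp.single D 1 - Finsupp.single E 1}

/-- Closed braids on at most `b` strands with more than `n` double points. -/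
def highOrderKnots (b n : ℕ) : Set (SliceWord →₀ ℤ) :=
  {x | ∃ D ∈ closedBraidKnots b, n < D.numSing ∧ x = Finsupp.single D 1}

/-- The formal combinations of singular knots that are reduced to `0` by crossing changes and
isotopies between closed braids on at most `b` strands, when all singular knots with more than `n`
double points are dropped. -/
noncomputable def braidReductions (b n : ℕ) : AddSubgroup (SliceWord →₀ ℤ) :=
  AddSubgroup.closure (skeinRelations b ∪ isotopyRelations b ∪ highOrderKnots b n)

/-! The proof is a descending induction on the number `k` of double points, in the quotient of the
free abelian group by `braidReductions 3 n`. Classes of knots with more than `n` double points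
vanish. Suppose that the classes of closed 3-braid knots with `k + 1` double points are combinations
of classes of chosen standard knots. Modulo these combinations the skein relation allows the
crossings of closed 3-braid knots with `k` double points to be changed freely
(`isFlatInvariant_mkQ`). It remains to see that such a knot then equals the standard knot of a chord
diagram with `k` chords and braid index at most 3, whichever braiding is chosen.

Without signs, singular 3-braids are words in crossings s_i with s_i² = 1 and double points t_i,
subject to `FlatBraidRelations`. The elements t_i s_i and their conjugates are the three chords, t_i
= (t_i s_i) s_i, and a crossing passes a chord by permuting the strands of the chord. So every word
is a word in chords times one of six permutation braids (`FlatBraidRelations.exists_chords`). When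
the closure is a knot, the permutation is a 3-cycle, and conjugation turns it into the standard
unknot braid (`FlatBraidRelations.exists_apply_eq`).

Independence of the braiding is the combinatorial core: two words on three strands with the same
closed diagram are related by rotations around the closure and by flypes
(`LabelledWord.apply_eq_of_name_isRotated`). Rotate both so that they begin with the same chord x,
joining the first two strands. It cuts the circle into two arcs, one of which is the first strand.
If the words put opposite arcs there, no chord joins the last two strands, and comparing labels
shows that the words are A12^a A13^b A12^c A13^d and A12^a A13^c A12^b A13^d; their closures are
related by a flype (`SliceWord.isoFrom_flype`). If they put the same arc there and still differ, the
other arc is divided between the last two strands at different places. A chord with an end between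
the two places joins strands 1, 3 in one word and 1, 2 in the other, and rotating to that chord
leads to the opposite case. Conjugations and flypes are isotopies between closed 3-braids, and
braidings on fewer strands are stabilized (`ChordWord.exists_three`).

The formula for invariants follows because the extension of an invariant of order at most `n` kills
all generators of `braidReductions`. The substantial point is its invariance under isotopy of
singular knots, checked move by move in `LocalMove.resolveFrom_eq`. -/

namespace SliceWord

/-! ### Strand directions and isotopy of tangle diagrams -/

/-- Directions of the strands below `w` if those above it are `s`. -/
def run (s : List Bool) (w : SliceWord) : Option (List Bool) := w.foldlM dirStep s

@[simp] theorem run_nil (s : List Bool) : run s [] = some s := rfl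

@[simp] theorem run_cons (s : List Bool) (x : Slice) (w : SliceWord) :
    run s (x :: w) = (dirStep s x).bind (run · w) := rfl

theorem run_append (s : List Bool) (v w : SliceWord) :
    run s (v ++ w) = (run s v).bind (run · w) := by
  induction v generalizing s with
  | nil => rfl
  | cons x v ih =>
    simp only [List.cons_append, run_cons]
    cases dirStep s x <;> simp [ih]

theorem dirStep_shift (a s : List Bool) (k : SliceKind) (p : ℕ) :
    dirStep (a ++ s) ⟨k, a.length + p⟩ = (dirStep s ⟨k, p⟩).map (a ++ ·) := by
  have h1 : (a ++ s).take (a.length + p) = a ++ s.take p := by simp [List.take_append]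
  have h2 : (a ++ s).drop (a.length + p) = s.drop p := by simp [List.drop_append]
  cases k with
  | cup d =>
    by_cases h : p ≤ s.length <;> simp [dirStep, h1, h2, h]
  | cap =>
    simp only [dirStep, h1, h2]
    rcases s.drop p with _ | ⟨x, _ | ⟨y, r⟩⟩ <;> simp
    split_ifs <;> simp
  | cross k =>
    simp only [dirStep, h1, h2]
    rcases s.drop p with _ | ⟨x, _ | ⟨y, r⟩⟩ <;> simp

theorem run_shift (a s : List Bool) (w : SliceWord) :
    run (a ++ s) (w.map fun x => ⟨x.kind, a.length + x.pos⟩) = (run s w).map (a ++ ·) := by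
  induction w generalizing s with
  | nil => simp
  | cons x w ih =>
    simp only [List.map_cons, run_cons, dirStep_shift]
    cases dirStep s x <;> simp [ih]

theorem dirStep_eq_none {s : List Bool} {x : Slice} (h : s.length < x.pos) :
    dirStep s x = none := by
  obtain ⟨k, p⟩ := x
  have h2 : s.drop p = [] := List.drop_eq_nil_of_le (le_of_lt h)
  cases k <;> simp [dirStep, h2, h]

/-- A slice at the left end only depends on the strands that enter it. -/
theorem dirStep_local {s t : List Bool} {k : SliceKind} (h : dirStep s ⟨k, 0⟩ = some t) :
    ∃ x y r, s = x ++ r ∧ t = y ++ r ∧ x.length = k.ins ∧ y.length = k.outs ∧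
      ∀ r', dirStep (x ++ r') ⟨k, 0⟩ = some (y ++ r') := by
  cases k with
  | cup d =>
    refine ⟨[], [d, !d], s, ?_⟩
    simp_all [dirStep, SliceKind.ins, SliceKind.outs]
  | cap =>
    rcases s with _ | ⟨x, _ | ⟨y, r⟩⟩ <;> simp [dirStep] at h
    exact ⟨[x, y], [], r, by simp [dirStep, SliceKind.ins, SliceKind.outs, h]⟩
  | cross k =>
    rcases s with _ | ⟨x, _ | ⟨y, r⟩⟩ <;> simp [dirStep] at h
    exact ⟨[x, y], [y, x], r, by simp [dirStep, SliceKind.ins, SliceKind.outs, h]⟩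

/-- A move at position `i` is a move at position 0 with `i` untouched strands on its left, so only
position 0 has to be checked. If there are fewer than `i` strands, the first slice of `l` does not
fit; this is why `l'` must be nonempty. -/
theorem run_of_shift {l r : SliceWord} {i : ℕ} {s t : List Bool} {l' r' : SliceWord}
    (hl : l = l'.map fun x => ⟨x.kind, i + x.pos⟩) (hr : r = r'.map fun x => ⟨x.kind, i + x.pos⟩)
    (hne : l' ≠ []) (h : ∀ s t, run s l' = some t → run s r' = some t) (h0 : run s l = some t) :
    run s r = some t := by
  subst hl hr
  by_cases hi : i ≤ s.length
  · have hs : s = s.take i ++ s.drop i := by simp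
    have hlen : (s.take i).length = i := by simp [hi]
    have e := run_shift (s.take i) (s.drop i)
    rw [hlen, ← hs] at e
    rw [e] at h0 ⊢
    rcases h1 : run (s.drop i) l' with _ | u
    · simp [h1] at h0
    · rw [h _ _ h1, ← h1]; exact h0
  · rcases l' with _ | ⟨x, l'⟩
    · exact absurd rfl hne
    · rw [List.map_cons, run_cons, dirStep_eq_none (by simp; omega)] at h0
      simp at h0

/-- Local moves preserve the directions of the strands. -/
theorem LocalMove.run_eq {l r : SliceWord} (m : LocalMove l r) {s t : List Bool}
    (h : run s l = some t) : run s r = some t := by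
  cases m with
  | exchange A B i j hij =>
    obtain ⟨j, rfl⟩ := Nat.exists_eq_add_of_le hij
    refine run_of_shift (i := i) (l' := [⟨A, 0⟩, ⟨B, j + A.outs⟩])
      (r' := [⟨B, j + A.ins⟩, ⟨A, 0⟩]) (by simp [add_assoc]) (by simp [add_assoc]) (by simp) ?_ h
    intro s t h
    simp only [run_cons, run_nil] at h ⊢
    rcases hA : dirStep s ⟨A, 0⟩ with _ | u
    · simp [hA] at h
    obtain ⟨x, y, r, rfl, rfl, hx, hy, hr⟩ := dirStep_local hA
    rw [hA, Option.bind_some, ← hy, add_comm, dirStep_shift] at h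
    rw [← hx, add_comm j, dirStep_shift]
    rcases hB : dirStep r ⟨B, j⟩ with _ | u
    · simp [hB] at h
    · simp only [hB, Option.map_some, Option.bind_some] at h ⊢
      rw [hr]; exact h
  | zigzagLeft d i =>
    refine run_of_shift (i := i) (l' := [⟨.cup d, 0⟩, ⟨.cap, 1⟩]) (r' := []) (by simp) (by simp)
      (by simp) ?_ h
    intro s t h
    rcases s with _ | ⟨x, r⟩ <;> cases d <;> simp_all [dirStep]
  | zigzagRight d i =>
    refine run_of_shift (i := i) (l' := [⟨.cup d, 1⟩, ⟨.cap, 0⟩]) (r' := []) (by simp) (by simp)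
      (by simp) ?_ h
    intro s t h
    rcases s with _ | ⟨x, r⟩ <;> cases d <;> simp_all [dirStep]
  | slideCup d k i =>
    refine run_of_shift (i := i) (l' := [⟨.cup d, 0⟩, ⟨.cross k, 1⟩])
      (r' := [⟨.cup d, 1⟩, ⟨.cross k.flip, 0⟩]) (by simp) (by simp) (by simp) ?_ h
    intro s t h
    rcases s with _ | ⟨x, r⟩ <;> simp_all [dirStep]
  | slideCap k i =>
    refine run_of_shift (i := i) (l' := [⟨.cross k, 1⟩, ⟨.cap, 0⟩])
      (r' := [⟨.cross k.flip, 0⟩, ⟨.cap, 1⟩]) (by simp) (by simp) (by simp) ?_ h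
    intro s t h
    rcases s with _ | ⟨x, _ | ⟨y, _ | ⟨z, r⟩⟩⟩ <;> simp [dirStep] at h ⊢ <;> exact h
  | reidemeisterOneCup d k hk i =>
    refine run_of_shift (i := i) (l' := [⟨.cup d, 0⟩, ⟨.cross k, 0⟩])
      (r' := [⟨.cup (!d), 0⟩]) (by simp) (by simp) (by simp) ?_ h
    intro s t h
    simp_all [dirStep]
  | reidemeisterOneCap k hk i =>
    refine run_of_shift (i := i) (l' := [⟨.cross k, 0⟩, ⟨.cap, 0⟩])
      (r' := [⟨.cap, 0⟩]) (by simp) (by simp) (by simp) ?_ h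
    intro s t h
    rcases s with _ | ⟨_ | _, _ | ⟨_ | _, r⟩⟩ <;> simp [dirStep] at h ⊢ <;> exact h
  | reidemeisterTwo k hk i =>
    refine run_of_shift (i := i) (l' := [⟨.cross k, 0⟩, ⟨.cross k.flip, 0⟩])
      (r' := []) (by simp) (by simp) (by simp) ?_ h
    intro s t h
    rcases s with _ | ⟨x, _ | ⟨y, r⟩⟩ <;> simp [dirStep] at h ⊢ <;> exact h
  | slideStrandRight k t' ht i =>
    refine run_of_shift (i := i) (l' := [⟨.cross k, 0⟩, ⟨.cross t', 1⟩, ⟨.cross t', 0⟩])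
      (r' := [⟨.cross t', 1⟩, ⟨.cross t', 0⟩, ⟨.cross k, 1⟩]) (by simp) (by simp) (by simp) ?_ h
    intro s t h
    rcases s with _ | ⟨x, _ | ⟨y, _ | ⟨z, r⟩⟩⟩ <;> simp [dirStep] at h ⊢ <;> exact h
  | slideStrandLeft k t' ht i =>
    refine run_of_shift (i := i) (l' := [⟨.cross k, 1⟩, ⟨.cross t', 0⟩, ⟨.cross t', 1⟩])
      (r' := [⟨.cross t', 0⟩, ⟨.cross t', 1⟩, ⟨.cross k, 0⟩]) (by simp) (by simp) (by simp) ?_ h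
    intro s t h
    rcases s with _ | ⟨x, _ | ⟨y, _ | ⟨z, r⟩⟩⟩ <;> simp [dirStep] at h ⊢ <;> exact h
  | twist t' ht i =>
    refine run_of_shift (i := i) (l' := [⟨.cross .sing, 0⟩, ⟨.cross t', 0⟩])
      (r' := [⟨.cross t', 0⟩, ⟨.cross .sing, 0⟩]) (by simp) (by simp) (by simp) ?_ h
    intro s t h
    rcases s with _ | ⟨x, _ | ⟨y, r⟩⟩ <;> simp [dirStep] at h ⊢ <;> exact h

/-- Isotopy of tangle diagrams whose strands have the directions `s` at the top. -/
def IsoFrom (s : List Bool) : SliceWord → SliceWord → Prop :=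
  Relation.EqvGen fun a b => (run s a).isSome ∧
    ∃ p q l r : SliceWord, LocalMove l r ∧ a = p ++ l ++ q ∧ b = p ++ r ++ q

theorem IsoFrom.refl (s : List Bool) (a : SliceWord) : IsoFrom s a a :=
  Relation.EqvGen.refl a

theorem IsoFrom.symm {s : List Bool} {a b : SliceWord} (h : IsoFrom s a b) : IsoFrom s b a :=
  Relation.EqvGen.symm _ _ h

theorem IsoFrom.trans {s : List Bool} {a b c : SliceWord} (h : IsoFrom s a b)
    (h' : IsoFrom s b c) : IsoFrom s a c :=
  Relation.EqvGen.trans _ _ _ h h'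

theorem IsoFrom.of_move {s : List Bool} {l r : SliceWord} (m : LocalMove l r)
    (h : (run s l).isSome) : IsoFrom s l r :=
  .rel _ _ ⟨h, [], [], l, r, m, by simp, by simp⟩

theorem LocalMove.run_context {s t : List Bool} {p q l r : SliceWord} (m : LocalMove l r)
    (h : run s (p ++ l ++ q) = some t) : run s (p ++ r ++ q) = some t := by
  rw [run_append, run_append] at h ⊢
  rcases h1 : run s p with _ | u
  · simp [h1] at h
  rw [h1, Option.bind_some] at h
  rw [Option.bind_some]
  rcases h2 : run u l with _ | u'
  · simp [h2] at h
  rw [m.run_eq h2, ← h2]; exact h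

/-- A single move preserves directions only from left to right: the empty side of a cancellation
fits in places where the other side does not. Since `IsoFrom` demands that the left side fits,
equality holds in both directions. -/
theorem IsoFrom.run_eq {s : List Bool} {a b : SliceWord} (h : IsoFrom s a b) :
    run s a = run s b := by
  induction h with
  | rel a b h =>
    obtain ⟨h, p, q, l, r, m, rfl, rfl⟩ := h
    obtain ⟨t, ht⟩ := Option.isSome_iff_exists.mp h
    rw [ht, m.run_context ht]
  | refl a => rfl
  | symm a b _ ih => exact ih.symm
  | trans a b c _ _ ih ih' => exact ih.trans ih'

theorem IsoFrom.context {s s' : List Bool} {p q a b : SliceWord} (h : IsoFrom s' a b)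
    (hp : run s p = some s') (hq : (run s (p ++ a ++ q)).isSome) :
    IsoFrom s (p ++ a ++ q) (p ++ b ++ q) := by
  have key : ∀ a b, IsoFrom s' a b → run s (p ++ a ++ q) = run s (p ++ b ++ q) := by
    intro a b h
    rw [run_append, run_append, run_append, run_append, hp, Option.bind_some, Option.bind_some,
      h.run_eq]
  induction h with
  | rel a b h =>
    obtain ⟨h, p', q', l, r, m, rfl, rfl⟩ := h
    exact .rel _ _ ⟨hq, p ++ p', q' ++ q, l, r, m, by simp, by simp⟩
  | refl a => exact IsoFrom.refl _ _
  | symm a b h ih => exact (ih (by rwa [key _ _ h])).symm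
  | trans a b c h h' ih ih' => exact (ih hq).trans (ih' (by rwa [← key _ _ h]))

/-- Closedness is a property of `run []`, which is constant along the chain, so every intermediate
diagram is closed. -/
theorem IsoFrom.isotopic {a b : SliceWord} (h : IsoFrom [] a b) (ha : a.IsClosed) :
    a.Isotopic b := by
  have key : ∀ a b, IsoFrom [] a b → (a.IsClosed ↔ b.IsClosed) := by
    intro a b h
    have := h.run_eq
    simp only [IsClosed, dirs, run] at this ⊢
    rw [this]
  induction h with
  | rel a b h =>
    have hb := (key a b (.rel _ _ h)).mp ha
    obtain ⟨h, p, q, l, r, m, ea, eb⟩ := h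
    exact .rel _ _ ⟨ha, hb, p, q, l, r, m, ea, eb⟩
  | refl a => exact .refl _
  | symm a b h ih => exact .symm _ _ (ih ((key _ _ h).mpr ha))
  | trans a b c h h' ih ih' => exact .trans _ _ _ (ih ha) (ih' ((key _ _ h).mp ha))

/-- Crossings of the given kinds at one position. -/
def twists (i : ℕ) (w : List CrossKind) : SliceWord := w.map fun k => ⟨.cross k, i⟩

theorem run_twists {s : List Bool} {i : ℕ} (h : dirStep s ⟨.cross .over, i⟩ = some s)
    (w : List CrossKind) : run s (twists i w) = some s := by
  induction w with
  | nil => rfl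
  | cons k w ih =>
    have h' : dirStep s ⟨.cross k, i⟩ = some s := h
    simp only [twists, List.map_cons, run_cons, h', Option.bind_some] at ih ⊢
    exact ih

/-- If single crossings slide through `x`, then so do rows of crossings. -/
theorem IsoFrom.twists_comm {s t : List Bool} {x : SliceWord} {i j : ℕ}
    (hs : dirStep s ⟨.cross .over, i⟩ = some s) (ht : dirStep t ⟨.cross .over, j⟩ = some t)
    (hx : run s x = some t)
    (h : ∀ k, IsoFrom s (⟨.cross k, i⟩ :: x) (x ++ [⟨.cross k, j⟩])) (w : List CrossKind) :
    IsoFrom s (twists i w ++ x) (x ++ twists j w) := by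
  induction w with
  | nil => simpa [twists] using IsoFrom.refl s x
  | cons k w ih =>
    have hk' : dirStep s ⟨.cross k, i⟩ = some s := hs
    have hk : run s [⟨.cross k, i⟩] = some s := by simp [hk']
    have h1 := ih.context (p := [⟨.cross k, i⟩]) (q := []) hk
      (by simp [run_append, run_twists hs, hk', hx])
    have h2 := (h k).context (p := []) (q := twists j w) rfl (by
      simp only [List.nil_append, run_append, (h k).run_eq]
      have : dirStep t ⟨.cross k, j⟩ = some t := ht
      simp [hx, run_twists ht, this])
    simp only [twists, List.map_cons, List.append_assoc, List.cons_append, List.nil_append,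
      List.append_nil] at h1 h2 ⊢
    exact h1.trans h2

end SliceWord

/-! ### Calculus of moves and the flype of closed 3-braids -/

set_option linter.unusedSimpArgs false
namespace SliceWord

@[simp] theorem flip_flip (k : CrossKind) : k.flip.flip = k := by cases k <;> rfl

theorem flip_ne_sing {k : CrossKind} (h : k ≠ .sing) : k.flip ≠ .sing := by
  cases k <;> simp_all [CrossKind.flip]

/-- One link of a long chain of rewritings. Only the first word `w` has to be shown to fit; this
transfers to the current word `x` because isotopies preserve directions. -/
theorem IsoFrom.next {s s' : List Bool} {p q a b w x y : SliceWord} (h : IsoFrom s w x)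
    (hv : (run s w).isSome) (hab : IsoFrom s' a b) (hp : run s p = some s')
    (hx : x = p ++ a ++ q) (hy : y = p ++ b ++ q) : IsoFrom s w y := by
  rw [h.run_eq] at hv
  subst hx hy; exact h.trans (hab.context hp hv)

/-- Distant slices can be exchanged. -/
theorem IsoFrom.exchange {s : List Bool} (A B : SliceKind) {i j i' j' : ℕ} (h : i ≤ j)
    (hi : i' = j + A.outs) (hj : j' = j + A.ins)
    (hv : (run s [⟨A, i⟩, ⟨B, i'⟩]).isSome) : IsoFrom s [⟨A, i⟩, ⟨B, i'⟩] [⟨B, j'⟩, ⟨A, i⟩] := by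
  subst hi hj; exact .of_move (.exchange A B i j h) hv

/-- A row of crossings commutes with a slice to its left. -/
theorem IsoFrom.twists_exchange_left {s t : List Bool} (A : SliceKind) {i i' j j' : ℕ}
    (h : i ≤ j) (hi : i' = j + A.outs) (hj : j' = j + A.ins)
    (hs : dirStep s ⟨.cross .over, j'⟩ = some s) (hx : dirStep s ⟨A, i⟩ = some t)
    (ht : dirStep t ⟨.cross .over, i'⟩ = some t) (w : List CrossKind) :
    IsoFrom s (twists j' w ++ [⟨A, i⟩]) ([⟨A, i⟩] ++ twists i' w) := by
  refine IsoFrom.twists_comm hs ht (by simp [hx]) (fun k => ?_) w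
  have ht' : dirStep t ⟨.cross k, i'⟩ = some t := ht
  exact (IsoFrom.exchange A (.cross k) h hi hj (by simp [hx, ht'])).symm

/-- A row of crossings commutes with a slice to its right. -/
theorem IsoFrom.twists_exchange_right {s t : List Bool} (B : SliceKind) {i j : ℕ} (h : i + 2 ≤ j)
    (hs : dirStep s ⟨.cross .over, i⟩ = some s) (hx : dirStep s ⟨B, j⟩ = some t)
    (ht : dirStep t ⟨.cross .over, i⟩ = some t) (w : List CrossKind) :
    IsoFrom s (twists i w ++ [⟨B, j⟩]) ([⟨B, j⟩] ++ twists i w) := by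
  obtain ⟨j, rfl⟩ := Nat.exists_eq_add_of_le' h
  refine IsoFrom.twists_comm hs ht (by simp [hx]) (fun k => ?_) w
  have hs' : dirStep s ⟨.cross k, i⟩ = some s := hs
  exact IsoFrom.exchange (.cross k) B (j := j + i) (by omega) (by simp [SliceKind.outs, add_assoc])
    (by simp [SliceKind.ins, add_assoc]) (by simp [hx, hs'])

/-- Crossings at the same position commute. -/
theorem IsoFrom.twist {s : List Bool} {i : ℕ} (k : CrossKind) {t : CrossKind} (ht : t ≠ .sing)
    (hs : (run s [⟨.cross k, i⟩, ⟨.cross t, i⟩]).isSome) :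
    IsoFrom s [⟨.cross k, i⟩, ⟨.cross t, i⟩] [⟨.cross t, i⟩, ⟨.cross k, i⟩] := by
  have h2 := hs
  cases k
  case sing => exact .of_move (.twist t ht i) hs
  all_goals
    cases t
    case sing => exact absurd rfl ht
    all_goals
      first
      | exact IsoFrom.refl _ _
      -- Two nonsingular crossings of different kinds cancel in either order.
      | exact (IsoFrom.of_move (.reidemeisterTwo _ (by simp) i) hs).trans
          (IsoFrom.of_move (.reidemeisterTwo _ (by simp) i) (by simpa [dirStep] using h2)).symm

theorem IsoFrom.twists_twist {s : List Bool} {i : ℕ} (w : List CrossKind) {t : CrossKind}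
    (ht : t ≠ .sing) (hs : dirStep s ⟨.cross .over, i⟩ = some s) :
    IsoFrom s (twists i w ++ [⟨.cross t, i⟩]) ([⟨.cross t, i⟩] ++ twists i w) := by
  have hs' : ∀ k, dirStep s ⟨.cross k, i⟩ = some s := fun k => hs
  refine IsoFrom.twists_comm hs hs (by simp [hs' t]) (fun k => ?_) w
  exact IsoFrom.twist k ht (by simp [hs'])

theorem IsoFrom.cancel {s : List Bool} {i : ℕ} {t : CrossKind} (ht : t ≠ .sing)
    (hs : (run s [⟨.cross t, i⟩]).isSome) :
    IsoFrom s [] [⟨.cross t, i⟩, ⟨.cross t.flip, i⟩] := by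
  refine (IsoFrom.of_move (.reidemeisterTwo t ht i) ?_).symm
  rcases h : s.drop i with _ | ⟨x, _ | ⟨y, r⟩⟩
  · simp [dirStep, h] at hs
  · simp [dirStep, h] at hs
  have hl : i ≤ s.length := by
    by_contra hl
    rw [List.drop_eq_nil_of_le (by omega)] at h
    simp at h
  simp [dirStep, h, hl]

theorem IsoFrom.twists_exchange {s : List Bool} {i j : ℕ} (h : i + 2 ≤ j)
    (hi : dirStep s ⟨.cross .over, i⟩ = some s) (hj : dirStep s ⟨.cross .over, j⟩ = some s)
    (v w : List CrossKind) :
    IsoFrom s (twists j v ++ twists i w) (twists i w ++ twists j v) :=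
  IsoFrom.twists_comm hj hj (run_twists hi w)
    (fun k => (IsoFrom.twists_exchange_right (.cross k) h hi hj hi w).symm) v

theorem IsoFrom.cancel_flip {s : List Bool} {i : ℕ} {t : CrossKind} (ht : t ≠ .sing)
    (hs : (run s [⟨.cross t.flip, i⟩, ⟨.cross t, i⟩]).isSome) :
    IsoFrom s [⟨.cross t.flip, i⟩, ⟨.cross t, i⟩] [] := by
  simpa only [flip_flip] using
    IsoFrom.of_move (.reidemeisterTwo t.flip (flip_ne_sing ht) i) (by simpa only [flip_flip] using hs)

theorem IsoFrom.slideCup {s : List Bool} {i : ℕ} (d : Bool) {k k' : CrossKind} (hk : k' = k.flip)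
    (hs : (run s [⟨.cup d, i⟩, ⟨.cross k, i + 1⟩]).isSome) :
    IsoFrom s [⟨.cup d, i⟩, ⟨.cross k, i + 1⟩] [⟨.cup d, i + 1⟩, ⟨.cross k', i⟩] := by
  subst hk; exact .of_move (.slideCup d k i) hs

theorem IsoFrom.slideCap {s : List Bool} {i : ℕ} {k k' : CrossKind} (hk : k' = k.flip)
    (hs : (run s [⟨.cross k, i + 1⟩, ⟨.cap, i⟩]).isSome) :
    IsoFrom s [⟨.cross k, i + 1⟩, ⟨.cap, i⟩] [⟨.cross k', i⟩, ⟨.cap, i + 1⟩] := by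
  subst hk; exact .of_move (.slideCap k i) hs

/-- A crossing of the strand that runs over a maximum, below a row of twists of that strand with
another one, is pulled across the row of twists. -/
theorem isoFrom_pull (w : List CrossKind) {t : CrossKind} (ht : t ≠ .sing) :
    IsoFrom [true, true, false, false]
      ([⟨.cup true, 2⟩] ++ twists 1 w ++ [⟨.cross t, 2⟩])
      ([⟨.cup true, 2⟩, ⟨.cross t.flip, 1⟩, ⟨.cup false, 2⟩] ++ twists 3 w ++ [⟨.cap, 4⟩]) := by
  have r1 : ∀ x y r, run (x :: y :: y :: r) (twists 1 w) = some (x :: y :: y :: r) :=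
    fun _ _ _ => run_twists (by simp [dirStep]) w
  have r2 : ∀ x₀ x y r, run (x₀ :: x :: y :: y :: r) (twists 2 w) =
      some (x₀ :: x :: y :: y :: r) := fun _ _ _ _ => run_twists (by simp [dirStep]) w
  have r3 : ∀ x₀ x₁ x y r, run (x₀ :: x₁ :: x :: y :: y :: r) (twists 3 w) =
      some (x₀ :: x₁ :: x :: y :: y :: r) := fun _ _ _ _ _ => run_twists (by simp [dirStep]) w
  have r4 : ∀ x₀ x₁ x₂ x y r, run (x₀ :: x₁ :: x₂ :: x :: y :: y :: r) (twists 4 w) =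
      some (x₀ :: x₁ :: x₂ :: x :: y :: y :: r) :=
    fun _ _ _ _ _ _ => run_twists (by simp [dirStep]) w
  have ht' := flip_ne_sing ht
  have hv : (run [true, true, false, false] ([⟨.cup true, 2⟩] ++ twists 1 w ++ [⟨.cross t, 2⟩])).isSome := by
    simp [run_append, dirStep, r1, r2, r3, r4]
  have h := IsoFrom.refl [true, true, false, false] ([⟨.cup true, 2⟩] ++ twists 1 w ++ [⟨.cross t, 2⟩])
  -- The inserted pair completes `t` to a strand passing both twisted strands, so that the row can
  -- slide through by the third Reidemeister move, double points included.
  have h := h.next (s' := [true, true, false, true, false, false]) hv (p := [⟨.cup true, 2⟩] ++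
    twists 1 w ++ [⟨.cross t, 2⟩]) (a := []) (b := [⟨.cross t, 1⟩, ⟨.cross t.flip, 1⟩]) (q := [])
    (y := [⟨.cup true, 2⟩] ++ twists 1 w ++ [⟨.cross t, 2⟩, ⟨.cross t, 1⟩, ⟨.cross t.flip, 1⟩])
    (IsoFrom.cancel ht (by rfl)) (by simp [run_append, dirStep, r1, r2, r3, r4]) (by simp) (by
    simp)
  have h := h.next (s' := [true, true, true, false, false, false]) hv (p := [⟨.cup true, 2⟩]) (a
    := twists 1 w ++ [⟨.cross t, 2⟩, ⟨.cross t, 1⟩]) (b := [⟨.cross t, 2⟩, ⟨.cross t, 1⟩] ++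
    twists 2 w) (q := [⟨.cross t.flip, 1⟩]) (y := [⟨.cup true, 2⟩, ⟨.cross t, 2⟩, ⟨.cross t, 1⟩]
    ++ twists 2 w ++ [⟨.cross t.flip, 1⟩]) (IsoFrom.twists_comm rfl rfl rfl (fun k => .of_move
    (.slideStrandRight k t ht 1) rfl) w) (by simp [run_append, dirStep, r1, r2, r3, r4]) (by
    simp) (by simp)
  -- Moved above the row, `t` is a kink on the maximum and disappears.
  have h := h.next (s' := [true, true, false, false]) hv (p := []) (a := [⟨.cup true, 2⟩, ⟨.cross
    t, 2⟩]) (b := [⟨.cup false, 2⟩]) (q := [⟨.cross t, 1⟩] ++ twists 2 w ++ [⟨.cross t.flip, 1⟩])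
    (y := [⟨.cup false, 2⟩, ⟨.cross t, 1⟩] ++ twists 2 w ++ [⟨.cross t.flip, 1⟩])
    (IsoFrom.of_move (.reidemeisterOneCup _ _ ht _) (by rfl)) (by simp [run_append, dirStep, r1,
    r2, r3, r4]) (by simp) (by simp)
  have h := h.next (s' := [true, true, false, false]) hv (p := []) (a := [⟨.cup false, 2⟩,
    ⟨.cross t, 1⟩]) (b := [⟨.cup false, 1⟩, ⟨.cross t.flip, 2⟩]) (q := twists 2 w ++ [⟨.cross
    t.flip, 1⟩]) (y := [⟨.cup false, 1⟩, ⟨.cross t.flip, 2⟩] ++ twists 2 w ++ [⟨.cross t.flip,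
    1⟩]) ((IsoFrom.slideCup _ (by simp) (by rfl)).symm) (by simp [run_append, dirStep, r1, r2,
    r3, r4]) (by simp) (by simp)
  have h := h.next (s' := [true, false, true, true, false, false]) hv (p := [⟨.cup false, 1⟩]) (a
    := [⟨.cross t.flip, 2⟩] ++ twists 2 w) (b := twists 2 w ++ [⟨.cross t.flip, 2⟩]) (q :=
    [⟨.cross t.flip, 1⟩]) (y := [⟨.cup false, 1⟩] ++ twists 2 w ++ [⟨.cross t.flip, 2⟩, ⟨.cross
    t.flip, 1⟩]) ((IsoFrom.twists_twist w ht' rfl).symm) (by simp [run_append, dirStep, r1, r2,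
    r3, r4]) (by simp) (by simp)
  -- A zigzag is created at the bottom. Its maximum is then lifted past the row, which thereby
  -- shifts two positions to the right.
  have h := h.next (s' := [true, true, false, true, false, false]) hv (p := [⟨.cup false, 1⟩] ++
    twists 2 w ++ [⟨.cross t.flip, 2⟩, ⟨.cross t.flip, 1⟩]) (a := []) (b := [⟨.cup true, 1⟩,
    ⟨.cap, 2⟩]) (q := []) (y := [⟨.cup false, 1⟩] ++ twists 2 w ++ [⟨.cross t.flip, 2⟩, ⟨.cross
    t.flip, 1⟩, ⟨.cup true, 1⟩, ⟨.cap, 2⟩]) ((IsoFrom.of_move (.zigzagLeft true 1) rfl).symm) (by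
    simp [run_append, dirStep, r1, r2, r3, r4]) (by simp) (by simp)
  have h := h.next (s' := [true, false, true, true, false, false]) hv (p := [⟨.cup false, 1⟩] ++
    twists 2 w ++ [⟨.cross t.flip, 2⟩]) (a := [⟨.cross t.flip, 1⟩, ⟨.cup true, 1⟩]) (b := [⟨.cup
    true, 1⟩, ⟨.cross t.flip, 3⟩]) (q := [⟨.cap, 2⟩]) (y := [⟨.cup false, 1⟩] ++ twists 2 w ++
    [⟨.cross t.flip, 2⟩, ⟨.cup true, 1⟩, ⟨.cross t.flip, 3⟩, ⟨.cap, 2⟩]) ((IsoFrom.exchange (.cup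
    true) (.cross t.flip) (i := 1) (j := 1) (by decide) rfl rfl (by rfl)).symm) (by simp
    [run_append, dirStep, r1, r2, r3, r4]) (by simp) (by simp)
  have h := h.next (s' := [true, false, true, true, false, false]) hv (p := [⟨.cup false, 1⟩] ++
    twists 2 w) (a := [⟨.cross t.flip, 2⟩, ⟨.cup true, 1⟩]) (b := [⟨.cup true, 1⟩, ⟨.cross
    t.flip, 4⟩]) (q := [⟨.cross t.flip, 3⟩, ⟨.cap, 2⟩]) (y := [⟨.cup false, 1⟩] ++ twists 2 w ++
    [⟨.cup true, 1⟩, ⟨.cross t.flip, 4⟩, ⟨.cross t.flip, 3⟩, ⟨.cap, 2⟩]) ((IsoFrom.exchange (.cup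
    true) (.cross t.flip) (i := 1) (j := 2) (by decide) rfl rfl (by rfl)).symm) (by simp
    [run_append, dirStep, r1, r2, r3, r4]) (by simp) (by simp)
  have h := h.next (s' := [true, false, true, true, false, false]) hv (p := [⟨.cup false, 1⟩]) (a
    := twists 2 w ++ [⟨.cup true, 1⟩]) (b := [⟨.cup true, 1⟩] ++ twists 4 w) (q := [⟨.cross
    t.flip, 4⟩, ⟨.cross t.flip, 3⟩, ⟨.cap, 2⟩]) (y := [⟨.cup false, 1⟩, ⟨.cup true, 1⟩] ++ twists
    4 w ++ [⟨.cross t.flip, 4⟩, ⟨.cross t.flip, 3⟩, ⟨.cap, 2⟩]) (IsoFrom.twists_exchange_left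
    (.cup true) (i := 1) (j := 2) (by decide) rfl rfl rfl rfl rfl _) (by simp [run_append,
    dirStep, r1, r2, r3, r4]) (by simp) (by simp)
  have h := h.next (s' := [true, true, false, false]) hv (p := []) (a := [⟨.cup false, 1⟩, ⟨.cup
    true, 1⟩]) (b := [⟨.cup true, 1⟩, ⟨.cup false, 3⟩]) (q := twists 4 w ++ [⟨.cross t.flip, 4⟩,
    ⟨.cross t.flip, 3⟩, ⟨.cap, 2⟩]) (y := [⟨.cup true, 1⟩, ⟨.cup false, 3⟩] ++ twists 4 w ++
    [⟨.cross t.flip, 4⟩, ⟨.cross t.flip, 3⟩, ⟨.cap, 2⟩]) ((IsoFrom.exchange (.cup true) (.cup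
    false) (i := 1) (j := 1) (by decide) rfl rfl (by rfl)).symm) (by simp [run_append, dirStep,
    r1, r2, r3, r4]) (by simp) (by simp)
  have h := h.next (s' := [true, true, false, false, true, true, false, false]) hv (p := [⟨.cup
    true, 1⟩, ⟨.cup false, 3⟩] ++ twists 4 w ++ [⟨.cross t.flip, 4⟩]) (a := [⟨.cross t.flip, 3⟩,
    ⟨.cap, 2⟩]) (b := [⟨.cross t, 2⟩, ⟨.cap, 3⟩]) (q := []) (y := [⟨.cup true, 1⟩, ⟨.cup false,
    3⟩] ++ twists 4 w ++ [⟨.cross t.flip, 4⟩, ⟨.cross t, 2⟩, ⟨.cap, 3⟩]) (IsoFrom.slideCap (by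
    simp) (by rfl)) (by simp [run_append, dirStep, r1, r2, r3, r4]) (by simp) (by simp)
  have h := h.next (s' := [true, true, false, false, true, true, false, false]) hv (p := [⟨.cup
    true, 1⟩, ⟨.cup false, 3⟩] ++ twists 4 w) (a := [⟨.cross t.flip, 4⟩, ⟨.cross t, 2⟩]) (b :=
    [⟨.cross t, 2⟩, ⟨.cross t.flip, 4⟩]) (q := [⟨.cap, 3⟩]) (y := [⟨.cup true, 1⟩, ⟨.cup false,
    3⟩] ++ twists 4 w ++ [⟨.cross t, 2⟩, ⟨.cross t.flip, 4⟩, ⟨.cap, 3⟩]) ((IsoFrom.exchange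
    (.cross t) (.cross t.flip) (i := 2) (j := 2) (by decide) rfl rfl (by rfl)).symm) (by simp
    [run_append, dirStep, r1, r2, r3, r4]) (by simp) (by simp)
  have h := h.next (s' := [true, true, false, false, true, true, false, false]) hv (p := [⟨.cup
    true, 1⟩, ⟨.cup false, 3⟩] ++ twists 4 w ++ [⟨.cross t, 2⟩]) (a := [⟨.cross t.flip, 4⟩,
    ⟨.cap, 3⟩]) (b := [⟨.cross t, 3⟩, ⟨.cap, 4⟩]) (q := []) (y := [⟨.cup true, 1⟩, ⟨.cup false,
    3⟩] ++ twists 4 w ++ [⟨.cross t, 2⟩, ⟨.cross t, 3⟩, ⟨.cap, 4⟩]) (IsoFrom.slideCap (by simp)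
    (by rfl)) (by simp [run_append, dirStep, r1, r2, r3, r4]) (by simp) (by simp)
  have h := h.next (s' := [true, true, false, false, true, true, false, false]) hv (p := [⟨.cup
    true, 1⟩, ⟨.cup false, 3⟩]) (a := twists 4 w ++ [⟨.cross t, 2⟩]) (b := [⟨.cross t, 2⟩] ++
    twists 4 w) (q := [⟨.cross t, 3⟩, ⟨.cap, 4⟩]) (y := [⟨.cup true, 1⟩, ⟨.cup false, 3⟩, ⟨.cross
    t, 2⟩] ++ twists 4 w ++ [⟨.cross t, 3⟩, ⟨.cap, 4⟩]) (IsoFrom.twists_exchange_left (.cross t)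
    (i := 2) (j := 2) (by decide) rfl rfl rfl rfl rfl _) (by simp [run_append, dirStep, r1, r2,
    r3, r4]) (by simp) (by simp)
  have h := h.next (s' := [true, true, false, true, false, false]) hv (p := [⟨.cup true, 1⟩]) (a
    := [⟨.cup false, 3⟩, ⟨.cross t, 2⟩]) (b := [⟨.cup false, 2⟩, ⟨.cross t.flip, 3⟩]) (q :=
    twists 4 w ++ [⟨.cross t, 3⟩, ⟨.cap, 4⟩]) (y := [⟨.cup true, 1⟩, ⟨.cup false, 2⟩, ⟨.cross
    t.flip, 3⟩] ++ twists 4 w ++ [⟨.cross t, 3⟩, ⟨.cap, 4⟩]) ((IsoFrom.slideCup _ (by simp) (by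
    rfl)).symm) (by simp [run_append, dirStep, r1, r2, r3, r4]) (by simp) (by simp)
  -- The device of the first step again, now at the bottom: the row slides through the completed
  -- strand, and the leftover crossing is a kink on the minimum.
  have h := h.next (s' := [true, true, false, true, false, true, false, false]) hv (p := [⟨.cup
    true, 1⟩, ⟨.cup false, 2⟩, ⟨.cross t.flip, 3⟩] ++ twists 4 w ++ [⟨.cross t, 3⟩]) (a := []) (b
    := [⟨.cross t, 4⟩, ⟨.cross t.flip, 4⟩]) (q := [⟨.cap, 4⟩]) (y := [⟨.cup true, 1⟩, ⟨.cup
    false, 2⟩, ⟨.cross t.flip, 3⟩] ++ twists 4 w ++ [⟨.cross t, 3⟩, ⟨.cross t, 4⟩, ⟨.cross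
    t.flip, 4⟩, ⟨.cap, 4⟩]) (IsoFrom.cancel ht (by rfl)) (by simp [run_append, dirStep, r1, r2,
    r3, r4]) (by simp) (by simp)
  have h := h.next (s' := [true, true, false, false, true, true, false, false]) hv (p := [⟨.cup
    true, 1⟩, ⟨.cup false, 2⟩, ⟨.cross t.flip, 3⟩]) (a := twists 4 w ++ [⟨.cross t, 3⟩, ⟨.cross
    t, 4⟩]) (b := [⟨.cross t, 3⟩, ⟨.cross t, 4⟩] ++ twists 3 w) (q := [⟨.cross t.flip, 4⟩, ⟨.cap,
    4⟩]) (y := [⟨.cup true, 1⟩, ⟨.cup false, 2⟩, ⟨.cross t.flip, 3⟩, ⟨.cross t, 3⟩, ⟨.cross t,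
    4⟩] ++ twists 3 w ++ [⟨.cross t.flip, 4⟩, ⟨.cap, 4⟩]) (IsoFrom.twists_comm rfl rfl rfl (fun k
    => .of_move (.slideStrandLeft k t ht 3) rfl) w) (by simp [run_append, dirStep, r1, r2, r3,
    r4]) (by simp) (by simp)
  have h := h.next (s' := [true, true, false, true, false, true, false, false]) hv (p := [⟨.cup
    true, 1⟩, ⟨.cup false, 2⟩]) (a := [⟨.cross t.flip, 3⟩, ⟨.cross t, 3⟩]) (b := []) (q :=
    [⟨.cross t, 4⟩] ++ twists 3 w ++ [⟨.cross t.flip, 4⟩, ⟨.cap, 4⟩]) (y := [⟨.cup true, 1⟩,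
    ⟨.cup false, 2⟩, ⟨.cross t, 4⟩] ++ twists 3 w ++ [⟨.cross t.flip, 4⟩, ⟨.cap, 4⟩])
    (IsoFrom.cancel_flip ht (by rfl)) (by simp [run_append, dirStep, r1, r2, r3, r4]) (by simp)
    (by simp)
  have h := h.next (s' := [true, true, false, true, true, false, false, false]) hv (p := [⟨.cup
    true, 1⟩, ⟨.cup false, 2⟩, ⟨.cross t, 4⟩] ++ twists 3 w) (a := [⟨.cross t.flip, 4⟩, ⟨.cap,
    4⟩]) (b := [⟨.cap, 4⟩]) (q := []) (y := [⟨.cup true, 1⟩, ⟨.cup false, 2⟩, ⟨.cross t, 4⟩] ++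
    twists 3 w ++ [⟨.cap, 4⟩]) (IsoFrom.of_move (.reidemeisterOneCap _ ht' _) (by rfl)) (by simp
    [run_append, dirStep, r1, r2, r3, r4]) (by simp) (by simp)
  have h := h.next (s' := [true, true, false, true, false, false]) hv (p := [⟨.cup true, 1⟩]) (a
    := [⟨.cup false, 2⟩, ⟨.cross t, 4⟩]) (b := [⟨.cross t, 2⟩, ⟨.cup false, 2⟩]) (q := twists 3 w
    ++ [⟨.cap, 4⟩]) (y := [⟨.cup true, 1⟩, ⟨.cross t, 2⟩, ⟨.cup false, 2⟩] ++ twists 3 w ++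
    [⟨.cap, 4⟩]) (IsoFrom.exchange (.cup false) (.cross t) (i := 2) (j := 2) (by decide) rfl rfl
    (by rfl)) (by simp [run_append, dirStep, r1, r2, r3, r4]) (by simp) (by simp)
  have h := h.next (s' := [true, true, false, false]) hv (p := []) (a := [⟨.cup true, 1⟩, ⟨.cross
    t, 2⟩]) (b := [⟨.cup true, 2⟩, ⟨.cross t.flip, 1⟩]) (q := [⟨.cup false, 2⟩] ++ twists 3 w ++
    [⟨.cap, 4⟩]) (y := [⟨.cup true, 2⟩, ⟨.cross t.flip, 1⟩, ⟨.cup false, 2⟩] ++ twists 3 w ++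
    [⟨.cap, 4⟩]) (IsoFrom.slideCup _ (by simp) (by rfl)) (by simp [run_append, dirStep, r1, r2,
    r3, r4]) (by simp) (by simp)
  exact h

/-- The flype of closed 3-braids. -/
theorem isoFrom_flype (u v w : List CrossKind) {t : CrossKind} (ht : t ≠ .sing) :
    IsoFrom []
      ([⟨.cup true, 0⟩, ⟨.cup true, 1⟩, ⟨.cup true, 2⟩] ++ twists 0 u ++ twists 1 v ++ twists 0 w ++
        [⟨.cross t.flip, 1⟩, ⟨.cap, 2⟩, ⟨.cap, 1⟩, ⟨.cap, 0⟩])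
      ([⟨.cup true, 0⟩, ⟨.cup true, 1⟩, ⟨.cup true, 2⟩] ++ twists 0 u ++ [⟨.cross t.flip, 1⟩] ++
        twists 0 w ++ twists 1 v ++ [⟨.cap, 2⟩, ⟨.cap, 1⟩, ⟨.cap, 0⟩]) := by
  have r0 : ∀ w y r, run (y :: y :: r) (twists 0 w) = some (y :: y :: r) :=
    fun w _ _ => run_twists (by simp [dirStep]) w
  have r1 : ∀ w x y r, run (x :: y :: y :: r) (twists 1 w) = some (x :: y :: y :: r) :=
    fun w _ _ _ => run_twists (by simp [dirStep]) w
  have r3 : ∀ w x₀ x₁ x y r, run (x₀ :: x₁ :: x :: y :: y :: r) (twists 3 w) =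
      some (x₀ :: x₁ :: x :: y :: y :: r) := fun w _ _ _ _ _ => run_twists (by simp [dirStep]) w
  have hv : (run [] ([⟨.cup true, 0⟩, ⟨.cup true, 1⟩, ⟨.cup true, 2⟩] ++ twists 0 u ++ twists 1 v ++
    twists 0 w ++ [⟨.cross t.flip, 1⟩, ⟨.cap, 2⟩, ⟨.cap, 1⟩, ⟨.cap, 0⟩])).isSome := by
    simp [run_append, dirStep, r0, r1, r3]
  have h := IsoFrom.refl [] ([⟨.cup true, 0⟩, ⟨.cup true, 1⟩, ⟨.cup true, 2⟩] ++ twists 0 u ++ twists 1 v ++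
    twists 0 w ++ [⟨.cross t.flip, 1⟩, ⟨.cap, 2⟩, ⟨.cap, 1⟩, ⟨.cap, 0⟩])
  have h := h.next (s' := [true, true, false, false]) hv (p := [⟨.cup true, 0⟩, ⟨.cup true, 1⟩])
    (a := [⟨.cup true, 2⟩] ++ twists 0 u) (b := twists 0 u ++ [⟨.cup true, 2⟩]) (q := twists 1 v
    ++ twists 0 w ++ [⟨.cross t.flip, 1⟩, ⟨.cap, 2⟩, ⟨.cap, 1⟩, ⟨.cap, 0⟩]) (y := [⟨.cup true,
    0⟩, ⟨.cup true, 1⟩] ++ twists 0 u ++ [⟨.cup true, 2⟩] ++ twists 1 v ++ twists 0 w ++ [⟨.cross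
    t.flip, 1⟩, ⟨.cap, 2⟩, ⟨.cap, 1⟩, ⟨.cap, 0⟩]) ((IsoFrom.twists_exchange_right (.cup true) (i
    := 0) (j := 2) (by decide) rfl rfl rfl _).symm) (by simp [run_append, dirStep, r0, r1, r3])
    (by simp) (by simp)
  -- Slid around the innermost minimum, the last crossing sits at position 2, where it is disjoint
  -- from the row `w` at position 0.
  have h := h.next (s' := [true, true, true, false, false, false]) hv (p := [⟨.cup true, 0⟩,
    ⟨.cup true, 1⟩] ++ twists 0 u ++ [⟨.cup true, 2⟩] ++ twists 1 v ++ twists 0 w) (a := [⟨.cross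
    t.flip, 1⟩, ⟨.cap, 2⟩]) (b := [⟨.cross t, 2⟩, ⟨.cap, 1⟩]) (q := [⟨.cap, 1⟩, ⟨.cap, 0⟩]) (y :=
    [⟨.cup true, 0⟩, ⟨.cup true, 1⟩] ++ twists 0 u ++ [⟨.cup true, 2⟩] ++ twists 1 v ++ twists 0
    w ++ [⟨.cross t, 2⟩, ⟨.cap, 1⟩, ⟨.cap, 1⟩, ⟨.cap, 0⟩]) ((IsoFrom.slideCap (by simp) (by
    rfl)).symm) (by simp [run_append, dirStep, r0, r1, r3]) (by simp) (by simp)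
  have h := h.next (s' := [true, true, true, false, false, false]) hv (p := [⟨.cup true, 0⟩,
    ⟨.cup true, 1⟩] ++ twists 0 u ++ [⟨.cup true, 2⟩] ++ twists 1 v) (a := twists 0 w ++ [⟨.cross
    t, 2⟩]) (b := [⟨.cross t, 2⟩] ++ twists 0 w) (q := [⟨.cap, 1⟩, ⟨.cap, 1⟩, ⟨.cap, 0⟩]) (y :=
    [⟨.cup true, 0⟩, ⟨.cup true, 1⟩] ++ twists 0 u ++ [⟨.cup true, 2⟩] ++ twists 1 v ++ [⟨.cross
    t, 2⟩] ++ twists 0 w ++ [⟨.cap, 1⟩, ⟨.cap, 1⟩, ⟨.cap, 0⟩]) (IsoFrom.twists_exchange_right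
    (.cross t) (i := 0) (j := 2) (by decide) rfl rfl rfl _) (by simp [run_append, dirStep, r0,
    r1, r3]) (by simp) (by simp)
  -- Now the crossing is pulled above the row `v`, which lands at position 3 and can be exchanged
  -- with `w`.
  have h := h.next (s' := [true, true, false, false]) hv (p := [⟨.cup true, 0⟩, ⟨.cup true, 1⟩]
    ++ twists 0 u) (a := [⟨.cup true, 2⟩] ++ twists 1 v ++ [⟨.cross t, 2⟩]) (b := [⟨.cup true,
    2⟩, ⟨.cross t.flip, 1⟩, ⟨.cup false, 2⟩] ++ twists 3 v ++ [⟨.cap, 4⟩]) (q := twists 0 w ++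
    [⟨.cap, 1⟩, ⟨.cap, 1⟩, ⟨.cap, 0⟩]) (y := [⟨.cup true, 0⟩, ⟨.cup true, 1⟩] ++ twists 0 u ++
    [⟨.cup true, 2⟩, ⟨.cross t.flip, 1⟩, ⟨.cup false, 2⟩] ++ twists 3 v ++ [⟨.cap, 4⟩] ++ twists
    0 w ++ [⟨.cap, 1⟩, ⟨.cap, 1⟩, ⟨.cap, 0⟩]) (isoFrom_pull v ht) (by simp [run_append, dirStep,
    r0, r1, r3]) (by simp) (by simp)
  have h := h.next (s' := [true, true, false, true, true, false, false, false]) hv (p := [⟨.cup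
    true, 0⟩, ⟨.cup true, 1⟩] ++ twists 0 u ++ [⟨.cup true, 2⟩, ⟨.cross t.flip, 1⟩, ⟨.cup false,
    2⟩] ++ twists 3 v) (a := [⟨.cap, 4⟩] ++ twists 0 w) (b := twists 0 w ++ [⟨.cap, 4⟩]) (q :=
    [⟨.cap, 1⟩, ⟨.cap, 1⟩, ⟨.cap, 0⟩]) (y := [⟨.cup true, 0⟩, ⟨.cup true, 1⟩] ++ twists 0 u ++
    [⟨.cup true, 2⟩, ⟨.cross t.flip, 1⟩, ⟨.cup false, 2⟩] ++ twists 3 v ++ twists 0 w ++ [⟨.cap,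
    4⟩, ⟨.cap, 1⟩, ⟨.cap, 1⟩, ⟨.cap, 0⟩]) ((IsoFrom.twists_exchange_right .cap (i := 0) (j := 4)
    (by decide) rfl rfl rfl _).symm) (by simp [run_append, dirStep, r0, r1, r3]) (by simp) (by
    simp)
  have h := h.next (s' := [true, true, false, true, true, false, false, false]) hv (p := [⟨.cup
    true, 0⟩, ⟨.cup true, 1⟩] ++ twists 0 u ++ [⟨.cup true, 2⟩, ⟨.cross t.flip, 1⟩, ⟨.cup false,
    2⟩]) (a := twists 3 v ++ twists 0 w) (b := twists 0 w ++ twists 3 v) (q := [⟨.cap, 4⟩, ⟨.cap,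
    1⟩, ⟨.cap, 1⟩, ⟨.cap, 0⟩]) (y := [⟨.cup true, 0⟩, ⟨.cup true, 1⟩] ++ twists 0 u ++ [⟨.cup
    true, 2⟩, ⟨.cross t.flip, 1⟩, ⟨.cup false, 2⟩] ++ twists 0 w ++ twists 3 v ++ [⟨.cap, 4⟩,
    ⟨.cap, 1⟩, ⟨.cap, 1⟩, ⟨.cap, 0⟩]) (IsoFrom.twists_exchange (i := 0) (j := 3) (by decide) rfl
    rfl _ _) (by simp [run_append, dirStep, r0, r1, r3]) (by simp) (by simp)
  have h := h.next (s' := [true, true, true, false, false, false]) hv (p := [⟨.cup true, 0⟩,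
    ⟨.cup true, 1⟩] ++ twists 0 u ++ [⟨.cup true, 2⟩, ⟨.cross t.flip, 1⟩]) (a := [⟨.cup false,
    2⟩] ++ twists 0 w) (b := twists 0 w ++ [⟨.cup false, 2⟩]) (q := twists 3 v ++ [⟨.cap, 4⟩,
    ⟨.cap, 1⟩, ⟨.cap, 1⟩, ⟨.cap, 0⟩]) (y := [⟨.cup true, 0⟩, ⟨.cup true, 1⟩] ++ twists 0 u ++
    [⟨.cup true, 2⟩, ⟨.cross t.flip, 1⟩] ++ twists 0 w ++ [⟨.cup false, 2⟩] ++ twists 3 v ++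
    [⟨.cap, 4⟩, ⟨.cap, 1⟩, ⟨.cap, 1⟩, ⟨.cap, 0⟩]) ((IsoFrom.twists_exchange_right (.cup false) (i
    := 0) (j := 2) (by decide) rfl rfl rfl _).symm) (by simp [run_append, dirStep, r0, r1, r3])
    (by simp) (by simp)
  have h := h.next (s' := [true, true, false, true, true, false, false, false]) hv (p := [⟨.cup
    true, 0⟩, ⟨.cup true, 1⟩] ++ twists 0 u ++ [⟨.cup true, 2⟩, ⟨.cross t.flip, 1⟩] ++ twists 0 w
    ++ [⟨.cup false, 2⟩] ++ twists 3 v) (a := [⟨.cap, 4⟩, ⟨.cap, 1⟩]) (b := [⟨.cap, 1⟩, ⟨.cap,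
    2⟩]) (q := [⟨.cap, 1⟩, ⟨.cap, 0⟩]) (y := [⟨.cup true, 0⟩, ⟨.cup true, 1⟩] ++ twists 0 u ++
    [⟨.cup true, 2⟩, ⟨.cross t.flip, 1⟩] ++ twists 0 w ++ [⟨.cup false, 2⟩] ++ twists 3 v ++
    [⟨.cap, 1⟩, ⟨.cap, 2⟩, ⟨.cap, 1⟩, ⟨.cap, 0⟩]) ((IsoFrom.exchange .cap .cap (i := 1) (j := 2)
    (by decide) rfl rfl (by rfl)).symm) (by simp [run_append, dirStep, r0, r1, r3]) (by simp) (by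
    simp)
  -- Lifting a minimum above the row brings the row back from position 3 to position 1; what remains
  -- is a zigzag to be straightened.
  have h := h.next (s' := [true, true, false, true, true, false, false, false]) hv (p := [⟨.cup
    true, 0⟩, ⟨.cup true, 1⟩] ++ twists 0 u ++ [⟨.cup true, 2⟩, ⟨.cross t.flip, 1⟩] ++ twists 0 w
    ++ [⟨.cup false, 2⟩]) (a := twists 3 v ++ [⟨.cap, 1⟩]) (b := [⟨.cap, 1⟩] ++ twists 1 v) (q :=
    [⟨.cap, 2⟩, ⟨.cap, 1⟩, ⟨.cap, 0⟩]) (y := [⟨.cup true, 0⟩, ⟨.cup true, 1⟩] ++ twists 0 u ++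
    [⟨.cup true, 2⟩, ⟨.cross t.flip, 1⟩] ++ twists 0 w ++ [⟨.cup false, 2⟩, ⟨.cap, 1⟩] ++ twists
    1 v ++ [⟨.cap, 2⟩, ⟨.cap, 1⟩, ⟨.cap, 0⟩]) (IsoFrom.twists_exchange_left .cap (i := 1) (j :=
    1) (by decide) rfl rfl rfl rfl rfl _) (by simp [run_append, dirStep, r0, r1, r3]) (by simp)
    (by simp)
  have h := h.next (s' := [true, true, true, false, false, false]) hv (p := [⟨.cup true, 0⟩,
    ⟨.cup true, 1⟩] ++ twists 0 u ++ [⟨.cup true, 2⟩, ⟨.cross t.flip, 1⟩] ++ twists 0 w) (a :=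
    [⟨.cup false, 2⟩, ⟨.cap, 1⟩]) (b := []) (q := twists 1 v ++ [⟨.cap, 2⟩, ⟨.cap, 1⟩, ⟨.cap,
    0⟩]) (y := [⟨.cup true, 0⟩, ⟨.cup true, 1⟩] ++ twists 0 u ++ [⟨.cup true, 2⟩, ⟨.cross t.flip,
    1⟩] ++ twists 0 w ++ twists 1 v ++ [⟨.cap, 2⟩, ⟨.cap, 1⟩, ⟨.cap, 0⟩]) (IsoFrom.of_move
    (.zigzagRight false 1) rfl) (by simp [run_append, dirStep, r0, r1, r3]) (by simp) (by simp)
  have h := h.next (s' := [true, true, false, false]) hv (p := [⟨.cup true, 0⟩, ⟨.cup true, 1⟩])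
    (a := twists 0 u ++ [⟨.cup true, 2⟩]) (b := [⟨.cup true, 2⟩] ++ twists 0 u) (q := [⟨.cross
    t.flip, 1⟩] ++ twists 0 w ++ twists 1 v ++ [⟨.cap, 2⟩, ⟨.cap, 1⟩, ⟨.cap, 0⟩]) (y := [⟨.cup
    true, 0⟩, ⟨.cup true, 1⟩, ⟨.cup true, 2⟩] ++ twists 0 u ++ [⟨.cross t.flip, 1⟩] ++ twists 0 w
    ++ twists 1 v ++ [⟨.cap, 2⟩, ⟨.cap, 1⟩, ⟨.cap, 0⟩]) (IsoFrom.twists_exchange_right (.cup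
    true) (i := 0) (j := 2) (by decide) rfl rfl rfl _) (by simp [run_append, dirStep, r0, r1,
    r3]) (by simp) (by simp)
  exact h

end SliceWord

/-! ### Conjugation and destabilization of closed braids -/

set_option linter.unusedSimpArgs false
namespace SliceWord

/-- Under the nested maxima, strand `j` and strand `5 - j` are the two ends of one arc. Hence a
crossing at position 1 slides over the top to position 3, and one at position 0 to position 4; the
two flips of its kind cancel. -/
theorem isoFrom_conj_cup_right (k : CrossKind) :
    IsoFrom [] [⟨.cup true, 0⟩, ⟨.cup true, 1⟩, ⟨.cup true, 2⟩, ⟨.cross k, 1⟩]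
      [⟨.cup true, 0⟩, ⟨.cup true, 1⟩, ⟨.cup true, 2⟩, ⟨.cross k, 3⟩] := by
  have hv : (run [] ([⟨.cup true, 0⟩, ⟨.cup true, 1⟩, ⟨.cup true, 2⟩, ⟨.cross k, 1⟩])).isSome :=
    by simp [run_append, dirStep]
  have h := IsoFrom.refl [] ([⟨.cup true, 0⟩, ⟨.cup true, 1⟩, ⟨.cup true, 2⟩, ⟨.cross k, 1⟩])
  have h := h.next (s' := [true, true, false, false]) hv (p := [⟨.cup true, 0⟩, ⟨.cup true, 1⟩])
    (a := [⟨.cup true, 2⟩, ⟨.cross k, 1⟩]) (b := [⟨.cup true, 1⟩, ⟨.cross k.flip, 2⟩]) (q := [])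
    (y := [⟨.cup true, 0⟩, ⟨.cup true, 1⟩, ⟨.cup true, 1⟩, ⟨.cross k.flip, 2⟩])
    ((IsoFrom.slideCup _ (by simp) (by rfl)).symm) (by simp [run_append, dirStep]) (by simp) (by
    simp)
  have h := h.next (s' := [true, false]) hv (p := [⟨.cup true, 0⟩]) (a := [⟨.cup true, 1⟩, ⟨.cup
    true, 1⟩]) (b := [⟨.cup true, 1⟩, ⟨.cup true, 3⟩]) (q := [⟨.cross k.flip, 2⟩]) (y := [⟨.cup
    true, 0⟩, ⟨.cup true, 1⟩, ⟨.cup true, 3⟩, ⟨.cross k.flip, 2⟩]) ((IsoFrom.exchange (.cup true)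
    (.cup true) (i := 1) (j := 1) (by decide) rfl rfl (by rfl)).symm) (by simp [run_append,
    dirStep]) (by simp) (by simp)
  have h := h.next (s' := [true, true, false, false]) hv (p := [⟨.cup true, 0⟩, ⟨.cup true, 1⟩])
    (a := [⟨.cup true, 3⟩, ⟨.cross k.flip, 2⟩]) (b := [⟨.cup true, 2⟩, ⟨.cross k, 3⟩]) (q := [])
    (y := [⟨.cup true, 0⟩, ⟨.cup true, 1⟩, ⟨.cup true, 2⟩, ⟨.cross k, 3⟩]) ((IsoFrom.slideCup _
    (by simp) (by rfl)).symm) (by simp [run_append, dirStep]) (by simp) (by simp)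
  exact h

theorem isoFrom_conj_cup_left (k : CrossKind) :
    IsoFrom [] [⟨.cup true, 0⟩, ⟨.cup true, 1⟩, ⟨.cup true, 2⟩, ⟨.cross k, 0⟩]
      [⟨.cup true, 0⟩, ⟨.cup true, 1⟩, ⟨.cup true, 2⟩, ⟨.cross k, 4⟩] := by
  have hv : (run [] ([⟨.cup true, 0⟩, ⟨.cup true, 1⟩, ⟨.cup true, 2⟩, ⟨.cross k, 0⟩])).isSome :=
    by simp [run_append, dirStep]
  have h := IsoFrom.refl [] ([⟨.cup true, 0⟩, ⟨.cup true, 1⟩, ⟨.cup true, 2⟩, ⟨.cross k, 0⟩])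
  have h := h.next (s' := [true, true, false, false]) hv (p := [⟨.cup true, 0⟩, ⟨.cup true, 1⟩])
    (a := [⟨.cup true, 2⟩, ⟨.cross k, 0⟩]) (b := [⟨.cross k, 0⟩, ⟨.cup true, 2⟩]) (q := []) (y :=
    [⟨.cup true, 0⟩, ⟨.cup true, 1⟩, ⟨.cross k, 0⟩, ⟨.cup true, 2⟩]) ((IsoFrom.exchange (.cross
    k) (.cup true) (i := 0) (j := 0) (by decide) rfl rfl (by rfl)).symm) (by simp [run_append,
    dirStep]) (by simp) (by simp)
  have h := h.next (s' := [true, false]) hv (p := [⟨.cup true, 0⟩]) (a := [⟨.cup true, 1⟩,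
    ⟨.cross k, 0⟩]) (b := [⟨.cup true, 0⟩, ⟨.cross k.flip, 1⟩]) (q := [⟨.cup true, 2⟩]) (y :=
    [⟨.cup true, 0⟩, ⟨.cup true, 0⟩, ⟨.cross k.flip, 1⟩, ⟨.cup true, 2⟩]) ((IsoFrom.slideCup _
    (by simp) (by rfl)).symm) (by simp [run_append, dirStep]) (by simp) (by simp)
  have h := h.next (s' := []) hv (p := []) (a := [⟨.cup true, 0⟩, ⟨.cup true, 0⟩]) (b := [⟨.cup
    true, 0⟩, ⟨.cup true, 2⟩]) (q := [⟨.cross k.flip, 1⟩, ⟨.cup true, 2⟩]) (y := [⟨.cup true, 0⟩,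
    ⟨.cup true, 2⟩, ⟨.cross k.flip, 1⟩, ⟨.cup true, 2⟩]) ((IsoFrom.exchange (.cup true) (.cup
    true) (i := 0) (j := 0) (by decide) rfl rfl (by rfl)).symm) (by simp [run_append, dirStep])
    (by simp) (by simp)
  have h := h.next (s' := [true, false]) hv (p := [⟨.cup true, 0⟩]) (a := [⟨.cup true, 2⟩,
    ⟨.cross k.flip, 1⟩]) (b := [⟨.cup true, 1⟩, ⟨.cross k, 2⟩]) (q := [⟨.cup true, 2⟩]) (y :=
    [⟨.cup true, 0⟩, ⟨.cup true, 1⟩, ⟨.cross k, 2⟩, ⟨.cup true, 2⟩]) ((IsoFrom.slideCup _ (by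
    simp) (by rfl)).symm) (by simp [run_append, dirStep]) (by simp) (by simp)
  have h := h.next (s' := [true, true, false, false]) hv (p := [⟨.cup true, 0⟩, ⟨.cup true, 1⟩])
    (a := [⟨.cross k, 2⟩, ⟨.cup true, 2⟩]) (b := [⟨.cup true, 2⟩, ⟨.cross k, 4⟩]) (q := []) (y :=
    [⟨.cup true, 0⟩, ⟨.cup true, 1⟩, ⟨.cup true, 2⟩, ⟨.cross k, 4⟩]) ((IsoFrom.exchange (.cup
    true) (.cross k) (i := 2) (j := 2) (by decide) rfl rfl (by rfl)).symm) (by simp [run_append,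
    dirStep]) (by simp) (by simp)
  exact h

theorem isoFrom_conj_cap_right (k : CrossKind) :
    IsoFrom [true, true, true, false, false, false]
      [⟨.cross k, 3⟩, ⟨.cap, 2⟩, ⟨.cap, 1⟩, ⟨.cap, 0⟩]
      [⟨.cross k, 1⟩, ⟨.cap, 2⟩, ⟨.cap, 1⟩, ⟨.cap, 0⟩] := by
  have hv : (run [true, true, true, false, false, false] ([⟨.cross k, 3⟩, ⟨.cap, 2⟩, ⟨.cap, 1⟩,
    ⟨.cap, 0⟩])).isSome := by simp [run_append, dirStep]
  have h := IsoFrom.refl [true, true, true, false, false, false] ([⟨.cross k, 3⟩, ⟨.cap, 2⟩,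
    ⟨.cap, 1⟩, ⟨.cap, 0⟩])
  have h := h.next (s' := [true, true, true, false, false, false]) hv (p := []) (a := [⟨.cross k,
    3⟩, ⟨.cap, 2⟩]) (b := [⟨.cross k.flip, 2⟩, ⟨.cap, 3⟩]) (q := [⟨.cap, 1⟩, ⟨.cap, 0⟩]) (y :=
    [⟨.cross k.flip, 2⟩, ⟨.cap, 3⟩, ⟨.cap, 1⟩, ⟨.cap, 0⟩]) (IsoFrom.slideCap (by simp) (by rfl))
    (by simp [run_append, dirStep]) (by simp) (by simp)
  have h := h.next (s' := [true, true, false, true, false, false]) hv (p := [⟨.cross k.flip, 2⟩])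
    (a := [⟨.cap, 3⟩, ⟨.cap, 1⟩]) (b := [⟨.cap, 1⟩, ⟨.cap, 1⟩]) (q := [⟨.cap, 0⟩]) (y := [⟨.cross
    k.flip, 2⟩, ⟨.cap, 1⟩, ⟨.cap, 1⟩, ⟨.cap, 0⟩]) ((IsoFrom.exchange .cap .cap (i := 1) (j := 1)
    (by decide) rfl rfl (by rfl)).symm) (by simp [run_append, dirStep]) (by simp) (by simp)
  have h := h.next (s' := [true, true, true, false, false, false]) hv (p := []) (a := [⟨.cross
    k.flip, 2⟩, ⟨.cap, 1⟩]) (b := [⟨.cross k, 1⟩, ⟨.cap, 2⟩]) (q := [⟨.cap, 1⟩, ⟨.cap, 0⟩]) (y :=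
    [⟨.cross k, 1⟩, ⟨.cap, 2⟩, ⟨.cap, 1⟩, ⟨.cap, 0⟩]) (IsoFrom.slideCap (by simp) (by rfl)) (by
    simp [run_append, dirStep]) (by simp) (by simp)
  exact h

theorem isoFrom_conj_cap_left (k : CrossKind) :
    IsoFrom [true, true, true, false, false, false]
      [⟨.cross k, 4⟩, ⟨.cap, 2⟩, ⟨.cap, 1⟩, ⟨.cap, 0⟩]
      [⟨.cross k, 0⟩, ⟨.cap, 2⟩, ⟨.cap, 1⟩, ⟨.cap, 0⟩] := by
  have hv : (run [true, true, true, false, false, false] ([⟨.cross k, 4⟩, ⟨.cap, 2⟩, ⟨.cap, 1⟩,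
    ⟨.cap, 0⟩])).isSome := by simp [run_append, dirStep]
  have h := IsoFrom.refl [true, true, true, false, false, false] ([⟨.cross k, 4⟩, ⟨.cap, 2⟩,
    ⟨.cap, 1⟩, ⟨.cap, 0⟩])
  have h := h.next (s' := [true, true, true, false, false, false]) hv (p := []) (a := [⟨.cross k,
    4⟩, ⟨.cap, 2⟩]) (b := [⟨.cap, 2⟩, ⟨.cross k, 2⟩]) (q := [⟨.cap, 1⟩, ⟨.cap, 0⟩]) (y := [⟨.cap,
    2⟩, ⟨.cross k, 2⟩, ⟨.cap, 1⟩, ⟨.cap, 0⟩]) ((IsoFrom.exchange .cap (.cross k) (i := 2) (j :=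
    2) (by decide) rfl rfl (by rfl)).symm) (by simp [run_append, dirStep]) (by simp) (by simp)
  have h := h.next (s' := [true, true, false, false]) hv (p := [⟨.cap, 2⟩]) (a := [⟨.cross k, 2⟩,
    ⟨.cap, 1⟩]) (b := [⟨.cross k.flip, 1⟩, ⟨.cap, 2⟩]) (q := [⟨.cap, 0⟩]) (y := [⟨.cap, 2⟩,
    ⟨.cross k.flip, 1⟩, ⟨.cap, 2⟩, ⟨.cap, 0⟩]) (IsoFrom.slideCap (by simp) (by rfl)) (by simp
    [run_append, dirStep]) (by simp) (by simp)
  have h := h.next (s' := [true, false, true, false]) hv (p := [⟨.cap, 2⟩, ⟨.cross k.flip, 1⟩])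
    (a := [⟨.cap, 2⟩, ⟨.cap, 0⟩]) (b := [⟨.cap, 0⟩, ⟨.cap, 0⟩]) (q := []) (y := [⟨.cap, 2⟩,
    ⟨.cross k.flip, 1⟩, ⟨.cap, 0⟩, ⟨.cap, 0⟩]) ((IsoFrom.exchange .cap .cap (i := 0) (j := 0) (by
    decide) rfl rfl (by rfl)).symm) (by simp [run_append, dirStep]) (by simp) (by simp)
  have h := h.next (s' := [true, true, false, false]) hv (p := [⟨.cap, 2⟩]) (a := [⟨.cross
    k.flip, 1⟩, ⟨.cap, 0⟩]) (b := [⟨.cross k, 0⟩, ⟨.cap, 1⟩]) (q := [⟨.cap, 0⟩]) (y := [⟨.cap,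
    2⟩, ⟨.cross k, 0⟩, ⟨.cap, 1⟩, ⟨.cap, 0⟩]) (IsoFrom.slideCap (by simp) (by rfl)) (by simp
    [run_append, dirStep]) (by simp) (by simp)
  have h := h.next (s' := [true, true, true, false, false, false]) hv (p := []) (a := [⟨.cap, 2⟩,
    ⟨.cross k, 0⟩]) (b := [⟨.cross k, 0⟩, ⟨.cap, 2⟩]) (q := [⟨.cap, 1⟩, ⟨.cap, 0⟩]) (y :=
    [⟨.cross k, 0⟩, ⟨.cap, 2⟩, ⟨.cap, 1⟩, ⟨.cap, 0⟩]) ((IsoFrom.exchange (.cross k) .cap (i := 0)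
    (j := 0) (by decide) rfl rfl (by rfl)).symm) (by simp [run_append, dirStep]) (by simp) (by
    simp)
  exact h

/-- Destabilization of a closed 3-braid. -/
theorem isoFrom_destabilize_three (u v : List CrossKind) {t : CrossKind} (ht : t ≠ .sing) :
    IsoFrom []
      ([⟨.cup true, 0⟩, ⟨.cup true, 1⟩, ⟨.cup true, 2⟩] ++ twists 0 u ++ [⟨.cross t, 1⟩] ++
        twists 0 v ++ [⟨.cap, 2⟩, ⟨.cap, 1⟩, ⟨.cap, 0⟩])
      ([⟨.cup true, 0⟩, ⟨.cup true, 1⟩] ++ twists 0 u ++ twists 0 v ++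
        [⟨.cap, 1⟩, ⟨.cap, 0⟩]) := by
  have r0 : ∀ w y r, run (y :: y :: r) (twists 0 w) = some (y :: y :: r) :=
    fun w _ _ => run_twists (by simp [dirStep]) w
  have ht' := flip_ne_sing ht
  have hv : (run [] ([⟨.cup true, 0⟩, ⟨.cup true, 1⟩, ⟨.cup true, 2⟩] ++ twists 0 u ++ [⟨.cross
    t, 1⟩] ++ twists 0 v ++ [⟨.cap, 2⟩, ⟨.cap, 1⟩, ⟨.cap, 0⟩])).isSome := by simp [run_append,
    dirStep, r0]
  have h := IsoFrom.refl [] ([⟨.cup true, 0⟩, ⟨.cup true, 1⟩, ⟨.cup true, 2⟩] ++ twists 0 u ++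
    [⟨.cross t, 1⟩] ++ twists 0 v ++ [⟨.cap, 2⟩, ⟨.cap, 1⟩, ⟨.cap, 0⟩])
  have h := h.next (s' := [true, true, false, false]) hv (p := [⟨.cup true, 0⟩, ⟨.cup true, 1⟩])
    (a := [⟨.cup true, 2⟩] ++ twists 0 u) (b := twists 0 u ++ [⟨.cup true, 2⟩]) (q := [⟨.cross t,
    1⟩] ++ twists 0 v ++ [⟨.cap, 2⟩, ⟨.cap, 1⟩, ⟨.cap, 0⟩]) (y := [⟨.cup true, 0⟩, ⟨.cup true,
    1⟩] ++ twists 0 u ++ [⟨.cup true, 2⟩, ⟨.cross t, 1⟩] ++ twists 0 v ++ [⟨.cap, 2⟩, ⟨.cap, 1⟩,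
    ⟨.cap, 0⟩]) ((IsoFrom.twists_exchange_right (.cup true) (i := 0) (j := 2) (by decide) rfl rfl
    rfl _).symm) (by simp [run_append, dirStep, r0]) (by simp) (by simp)
  have h := h.next (s' := [true, true, false, false]) hv (p := [⟨.cup true, 0⟩, ⟨.cup true, 1⟩]
    ++ twists 0 u) (a := [⟨.cup true, 2⟩, ⟨.cross t, 1⟩]) (b := [⟨.cup true, 1⟩, ⟨.cross t.flip,
    2⟩]) (q := twists 0 v ++ [⟨.cap, 2⟩, ⟨.cap, 1⟩, ⟨.cap, 0⟩]) (y := [⟨.cup true, 0⟩, ⟨.cup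
    true, 1⟩] ++ twists 0 u ++ [⟨.cup true, 1⟩, ⟨.cross t.flip, 2⟩] ++ twists 0 v ++ [⟨.cap, 2⟩,
    ⟨.cap, 1⟩, ⟨.cap, 0⟩]) ((IsoFrom.slideCup _ (by simp) (by rfl)).symm) (by simp [run_append,
    dirStep, r0]) (by simp) (by simp)
  have h := h.next (s' := [true, true, true, false, false, false]) hv (p := [⟨.cup true, 0⟩,
    ⟨.cup true, 1⟩] ++ twists 0 u ++ [⟨.cup true, 1⟩, ⟨.cross t.flip, 2⟩]) (a := twists 0 v ++
    [⟨.cap, 2⟩]) (b := [⟨.cap, 2⟩] ++ twists 0 v) (q := [⟨.cap, 1⟩, ⟨.cap, 0⟩]) (y := [⟨.cup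
    true, 0⟩, ⟨.cup true, 1⟩] ++ twists 0 u ++ [⟨.cup true, 1⟩, ⟨.cross t.flip, 2⟩, ⟨.cap, 2⟩] ++
    twists 0 v ++ [⟨.cap, 1⟩, ⟨.cap, 0⟩]) (IsoFrom.twists_exchange_right .cap (i := 0) (j := 2)
    (by decide) rfl rfl rfl _) (by simp [run_append, dirStep, r0]) (by simp) (by simp)
  -- The only crossing of the third strand, slid across its maximum, has become a kink on the
  -- minimum.
  have h := h.next (s' := [true, true, false, true, false, false]) hv (p := [⟨.cup true, 0⟩,
    ⟨.cup true, 1⟩] ++ twists 0 u ++ [⟨.cup true, 1⟩]) (a := [⟨.cross t.flip, 2⟩, ⟨.cap, 2⟩]) (b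
    := [⟨.cap, 2⟩]) (q := twists 0 v ++ [⟨.cap, 1⟩, ⟨.cap, 0⟩]) (y := [⟨.cup true, 0⟩, ⟨.cup
    true, 1⟩] ++ twists 0 u ++ [⟨.cup true, 1⟩, ⟨.cap, 2⟩] ++ twists 0 v ++ [⟨.cap, 1⟩, ⟨.cap,
    0⟩]) (IsoFrom.of_move (.reidemeisterOneCap _ ht' _) (by rfl)) (by simp [run_append, dirStep,
    r0]) (by simp) (by simp)
  have h := h.next (s' := [true, true, false, false]) hv (p := [⟨.cup true, 0⟩, ⟨.cup true, 1⟩]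
    ++ twists 0 u) (a := [⟨.cup true, 1⟩, ⟨.cap, 2⟩]) (b := []) (q := twists 0 v ++ [⟨.cap, 1⟩,
    ⟨.cap, 0⟩]) (y := [⟨.cup true, 0⟩, ⟨.cup true, 1⟩] ++ twists 0 u ++ twists 0 v ++ [⟨.cap, 1⟩,
    ⟨.cap, 0⟩]) (IsoFrom.of_move (.zigzagLeft true 1) rfl) (by simp [run_append, dirStep, r0])
    (by simp) (by simp)
  exact h

/-- Destabilization of the closed 2-braid with one crossing. -/
theorem isoFrom_destabilize_two {t : CrossKind} (ht : t ≠ .sing) :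
    IsoFrom [] [⟨.cup true, 0⟩, ⟨.cup true, 1⟩, ⟨.cross t, 0⟩, ⟨.cap, 1⟩, ⟨.cap, 0⟩]
      [⟨.cup true, 0⟩, ⟨.cap, 0⟩] := by
  have ht' := flip_ne_sing ht
  have hv : (run [] ([⟨.cup true, 0⟩, ⟨.cup true, 1⟩, ⟨.cross t, 0⟩, ⟨.cap, 1⟩, ⟨.cap,
    0⟩])).isSome := by simp [run_append, dirStep]
  have h := IsoFrom.refl [] ([⟨.cup true, 0⟩, ⟨.cup true, 1⟩, ⟨.cross t, 0⟩, ⟨.cap, 1⟩, ⟨.cap,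
    0⟩])
  have h := h.next (s' := [true, false]) hv (p := [⟨.cup true, 0⟩]) (a := [⟨.cup true, 1⟩,
    ⟨.cross t, 0⟩]) (b := [⟨.cup true, 0⟩, ⟨.cross t.flip, 1⟩]) (q := [⟨.cap, 1⟩, ⟨.cap, 0⟩]) (y
    := [⟨.cup true, 0⟩, ⟨.cup true, 0⟩, ⟨.cross t.flip, 1⟩, ⟨.cap, 1⟩, ⟨.cap, 0⟩])
    ((IsoFrom.slideCup _ (by simp) (by rfl)).symm) (by simp [run_append, dirStep]) (by simp) (by
    simp)
  have h := h.next (s' := [true, false, true, false]) hv (p := [⟨.cup true, 0⟩, ⟨.cup true, 0⟩])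
    (a := [⟨.cross t.flip, 1⟩, ⟨.cap, 1⟩]) (b := [⟨.cap, 1⟩]) (q := [⟨.cap, 0⟩]) (y := [⟨.cup
    true, 0⟩, ⟨.cup true, 0⟩, ⟨.cap, 1⟩, ⟨.cap, 0⟩]) (IsoFrom.of_move (.reidemeisterOneCap _ ht'
    _) (by rfl)) (by simp [run_append, dirStep]) (by simp) (by simp)
  have h := h.next (s' := [true, false]) hv (p := [⟨.cup true, 0⟩]) (a := [⟨.cup true, 0⟩, ⟨.cap,
    1⟩]) (b := []) (q := [⟨.cap, 0⟩]) (y := [⟨.cup true, 0⟩, ⟨.cap, 0⟩]) (IsoFrom.of_move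
    (.zigzagLeft true 0) rfl) (by simp [run_append, dirStep]) (by simp) (by simp)
  exact h

end SliceWord

/-! ### Isotopies of closures of 3-braids -/

namespace SingularBraid

open SliceWord

/-- The slices of a braid word. -/
def slices {m : ℕ} (w : SingularBraid m) : SliceWord := w.map fun l => ⟨.cross l.kind, l.idx⟩

theorem slices_append {m : ℕ} (v w : SingularBraid m) : slices (v ++ w) = slices v ++ slices w :=
  List.map_append

theorem closure_three (w : SingularBraid 3) :
    w.closure = [⟨.cup true, 0⟩, ⟨.cup true, 1⟩, ⟨.cup true, 2⟩] ++ w.slices ++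
      [⟨.cap, 2⟩, ⟨.cap, 1⟩, ⟨.cap, 0⟩] := rfl

theorem run_slices_three (w : SingularBraid 3) :
    run [true, true, true, false, false, false] w.slices =
      some [true, true, true, false, false, false] := by
  induction w with
  | nil => rfl
  | cons l w ih =>
    obtain ⟨k, i, h⟩ := l
    have hi : i = 0 ∨ i = 1 := by omega
    simp only [slices, List.map_cons, run_cons] at ih ⊢
    rcases hi with rfl | rfl <;> simpa [dirStep] using ih

theorem isClosed_closure_three (w : SingularBraid 3) : w.closure.IsClosed := by
  change run [] w.closure = some []
  rw [closure_three, run_append, run_append]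
  simp [dirStep, run_slices_three]

/-- Isotopic braid words on three strands have isotopic closures. -/
theorem isotopic_of_isoFrom (p q v w : SingularBraid 3)
    (h : IsoFrom [true, true, true, false, false, false] v.slices w.slices) :
    (closure (p ++ v ++ q)).Isotopic (closure (p ++ w ++ q)) := by
  refine IsoFrom.isotopic ?_ (isClosed_closure_three _)
  have hp : run [] ([⟨.cup true, 0⟩, ⟨.cup true, 1⟩, ⟨.cup true, 2⟩] ++ slices p) =
      some [true, true, true, false, false, false] := by
    rw [run_append]; simp [dirStep, run_slices_three]
  have hc : (run [] (closure (p ++ v ++ q))).isSome := by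
    rw [show run [] (closure (p ++ v ++ q)) = some [] from isClosed_closure_three _]; rfl
  refine IsoFrom.next (IsoFrom.refl _ _) hc h hp
    (q := slices q ++ [⟨.cap, 2⟩, ⟨.cap, 1⟩, ⟨.cap, 0⟩]) ?_ ?_ <;>
  simp [closure_three, slices]

/-- Positions 3 and 4 involve only the upward closing strands, which are disjoint from the braid; so
the crossing travels along the whole closure. -/
theorem isoFrom_slices_comm (w : SingularBraid 3) (k : CrossKind) {i : ℕ} (hi : i = 3 ∨ i = 4) :
    IsoFrom [true, true, true, false, false, false] ([⟨.cross k, i⟩] ++ w.slices)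
      (w.slices ++ [⟨.cross k, i⟩]) := by
  have hk : dirStep [true, true, true, false, false, false] ⟨.cross k, i⟩ =
      some [true, true, true, false, false, false] := by
    rcases hi with rfl | rfl <;> rfl
  induction w with
  | nil => exact IsoFrom.refl _ _
  | cons l w ih =>
    obtain ⟨k', j, h⟩ := l
    have hl : dirStep [true, true, true, false, false, false] ⟨.cross k', j⟩ =
        some [true, true, true, false, false, false] := by
      have hj : j = 0 ∨ j = 1 := by omega
      rcases hj with rfl | rfl <;> rfl
    have hv : (run [true, true, true, false, false, false]
        ([⟨.cross k, i⟩] ++ slices (⟨k', j, h⟩ :: w))).isSome := by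
      have := run_slices_three w
      simp only [slices] at this
      simp [slices, hk, hl, this]
    have h1 := IsoFrom.next (IsoFrom.refl _ _) hv
      (IsoFrom.exchange (s := [true, true, true, false, false, false]) (.cross k') (.cross k)
        (i := j) (j := i - 2) (i' := i) (j' := i) (by omega)
        (by simp [SliceKind.outs]; omega) (by simp [SliceKind.ins]; omega)
        (by simp [hk, hl])).symm (p := []) (q := slices w) rfl (by simp [slices]) rfl
    have h2 := IsoFrom.next h1 hv ih (p := [⟨.cross k', j⟩]) (q := []) (by simp [hl]) (by simp) rfl
    simpa [slices] using h2

/-- Conjugate 3-braids have isotopic closures. -/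
theorem isotopic_rotate (l : BraidLetter 3) (w : SingularBraid 3) :
    (closure (l :: w)).Isotopic (closure (w ++ [l])) := by
  refine IsoFrom.isotopic ?_ (isClosed_closure_three _)
  have hc : (run [] (closure (l :: w))).isSome := by
    rw [show run [] (closure (l :: w)) = some [] from isClosed_closure_three _]; rfl
  obtain ⟨k, i, h⟩ := l
  obtain ⟨j, hj, h1, h2⟩ : ∃ j, (j = 3 ∨ j = 4) ∧
      IsoFrom [] [⟨.cup true, 0⟩, ⟨.cup true, 1⟩, ⟨.cup true, 2⟩, ⟨.cross k, i⟩]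
        [⟨.cup true, 0⟩, ⟨.cup true, 1⟩, ⟨.cup true, 2⟩, ⟨.cross k, j⟩] ∧
      IsoFrom [true, true, true, false, false, false]
        [⟨.cross k, j⟩, ⟨.cap, 2⟩, ⟨.cap, 1⟩, ⟨.cap, 0⟩]
        [⟨.cross k, i⟩, ⟨.cap, 2⟩, ⟨.cap, 1⟩, ⟨.cap, 0⟩] := by
    have hi : i = 0 ∨ i = 1 := by omega
    rcases hi with rfl | rfl
    · exact ⟨4, .inr rfl, isoFrom_conj_cup_left k, isoFrom_conj_cap_left k⟩
    · exact ⟨3, .inl rfl, isoFrom_conj_cup_right k, isoFrom_conj_cap_right k⟩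
  have e1 := IsoFrom.next (IsoFrom.refl _ _) hc h1 (p := [])
    (q := slices w ++ [⟨.cap, 2⟩, ⟨.cap, 1⟩, ⟨.cap, 0⟩]) rfl (by simp [closure_three, slices]) rfl
  have e2 := IsoFrom.next e1 hc (isoFrom_slices_comm w k hj)
    (p := [⟨.cup true, 0⟩, ⟨.cup true, 1⟩, ⟨.cup true, 2⟩])
    (q := [⟨.cap, 2⟩, ⟨.cap, 1⟩, ⟨.cap, 0⟩]) rfl (by simp) rfl
  have e3 := IsoFrom.next e2 hc h2
    (p := [⟨.cup true, 0⟩, ⟨.cup true, 1⟩, ⟨.cup true, 2⟩] ++ slices w) (q := [])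
    (by rw [run_append]; simp [dirStep, run_slices_three]) (by simp) rfl
  simpa [closure_three, slices] using e3

end SingularBraid

/-! ### Isotopy invariance of the extension to singular knots -/

namespace SliceWord

/-- The kind of a positive crossing between neighbouring strands with the given directions. -/
def kindAt (s : List Bool) (i : ℕ) : CrossKind := if s[i]? = s[i + 1]? then .under else .over

theorem posKind_eq {p : SliceWord} {s : List Bool} (h : run [] p = some s) (i : ℕ) : p.posKind i = kindAt s i := by
  have h' : p.dirs = some s := h
  simp [posKind, h', kindAt]

theorem posKind_ne_sing (p : SliceWord) (i : ℕ) : p.posKind i ≠ .sing := by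
  unfold posKind
  split
  · split_ifs <;> simp
  · simp

theorem kindAt_append (a s : List Bool) (i : ℕ) : kindAt (a ++ s) (a.length + i) = kindAt s i := by
  simp [kindAt, add_assoc, List.getElem?_append_right]

theorem kindAt_append_left (a s s' : List Bool) (i : ℕ) (h : i + 1 < a.length) :
    kindAt (a ++ s) i = kindAt (a ++ s') i := by
  simp [kindAt, List.getElem?_append_left h, List.getElem?_append_left (show i < a.length by omega)]

theorem exists_append_of_dirStep {s t : List Bool} {k : SliceKind} {i : ℕ}
    (h : dirStep s ⟨k, i⟩ = some t) :
    ∃ a r r', a.length = i ∧ s = a ++ r ∧ t = a ++ r' ∧ dirStep r ⟨k, 0⟩ = some r' := by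
  have hi : i ≤ s.length := by
    by_contra hi
    rw [dirStep_eq_none (by simpa using hi)] at h
    simp at h
  have hl : (s.take i).length = i := by simp [hi]
  have e := dirStep_shift (s.take i) (s.drop i) k 0
  rw [hl, add_zero, List.take_append_drop, h] at e
  rcases h' : dirStep (s.drop i) ⟨k, 0⟩ with _ | r'
  · simp [h'] at e
  · exact ⟨s.take i, s.drop i, r', hl, by simp, by simpa [h'] using e, h'⟩

theorem kindAt_dirStep_right {s t : List Bool} {k : SliceKind} {i j : ℕ} (hij : i ≤ j)
    (h : dirStep s ⟨k, i⟩ = some t) : kindAt t (j + k.outs) = kindAt s (j + k.ins) := by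
  obtain ⟨a, r, r', ha, rfl, rfl, h'⟩ := exists_append_of_dirStep h
  obtain ⟨x, y, r, rfl, rfl, hx, hy, -⟩ := dirStep_local h'
  obtain ⟨j, rfl⟩ := Nat.exists_eq_add_of_le hij
  rw [← List.append_assoc, ← List.append_assoc, show i + j + k.outs = (a ++ y).length + j by
    simp; omega, show i + j + k.ins = (a ++ x).length + j by simp; omega, kindAt_append,
    kindAt_append]

theorem kindAt_dirStep_left {s t : List Bool} {k : SliceKind} {i j : ℕ} (hij : i + 1 < j)
    (h : dirStep s ⟨k, j⟩ = some t) : kindAt t i = kindAt s i := by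
  obtain ⟨a, r, r', ha, rfl, rfl, h⟩ := exists_append_of_dirStep h
  exact kindAt_append_left _ _ _ _ (by omega)

section Resolve

variable {A : Type*} [AddCommGroup A]

/-- Resolving the lower part `q` is absorbed into the function that is evaluated on the upper part.
This isolates a local move from what lies below it. -/
theorem resolveFrom_append (v : SliceWord → A) (p a q : SliceWord) :
    resolveFrom v p (a ++ q) = resolveFrom (fun x => resolveFrom v x q) p a := by
  induction a generalizing p with
  | nil => rfl
  | cons l a ih =>
    obtain ⟨k, i⟩ := l
    rcases k with d | _ | (_ | _ | _) <;> simp only [List.cons_append, resolveFrom, ih]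

theorem resolveFrom_sub (v w : SliceWord → A) (p q : SliceWord) :
    resolveFrom (fun x => v x - w x) p q = resolveFrom v p q - resolveFrom w p q := by
  induction q generalizing p with
  | nil => rfl
  | cons l a ih =>
    obtain ⟨k, i⟩ := l
    rcases k with d | _ | (_ | _ | _) <;> simp only [resolveFrom, ih]
    abel

theorem dirStep_cross (s : List Bool) (k k' : CrossKind) (i : ℕ) :
    dirStep s ⟨.cross k, i⟩ = dirStep s ⟨.cross k', i⟩ := rfl

theorem sweepStep_cross (s : Sweep) (k k' : CrossKind) (i : ℕ) :
    sweepStep s ⟨.cross k, i⟩ = sweepStep s ⟨.cross k', i⟩ := rfl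

/-- Only the values on the resolutions matter. -/
theorem resolveFrom_congr {v w : SliceWord → A} {p q : SliceWord} (hp : p.numSing = 0)
    (h : ∀ x : SliceWord, x.numSing = 0 → run [] x = run [] (p ++ q) →
      x.components = (p ++ q).components → v x = w x) :
    resolveFrom v p q = resolveFrom w p q := by
  induction q generalizing p with
  | nil => exact h p hp (by simp) (by simp)
  | cons l q ih =>
    have key : ∀ l' : Slice, numSing [l'] = 0 → (∀ s, dirStep s l' = dirStep s l) →
        (∀ s, sweepStep s l' = sweepStep s l) →
        resolveFrom v (p ++ [l']) q = resolveFrom w (p ++ [l']) q := by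
      intro l' h1 h2 h3
      refine ih (by simp_all [numSing]) fun x hx hr hc => h x hx ?_ ?_
      · rw [hr]; simp [run_append, h2]
      · rw [hc]; simp [components, h3]
    obtain ⟨k, i⟩ := l
    rcases k with d | _ | (_ | _ | _)
    case cross.sing =>
      have h1 := posKind_ne_sing p i
      have h2 := flip_ne_sing h1
      simp only [resolveFrom]
      rw [key _ (by simpa [numSing] using h1) (fun s => dirStep_cross _ _ _ _)
        (fun s => sweepStep_cross _ _ _ _), key _ (by simpa [numSing] using h2)
        (fun s => dirStep_cross _ _ _ _) (fun s => sweepStep_cross _ _ _ _)]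
    all_goals
      simp only [resolveFrom]
      exact key _ (by simp [numSing]) (fun _ => rfl) (fun _ => rfl)

theorem resolveFrom_sing {v : SliceWord → A} {p q : SliceWord} {s : List Bool} (i : ℕ)
    (h : run [] p = some s) :
    resolveFrom v p (⟨.cross .sing, i⟩ :: q) =
      resolveFrom v (p ++ [⟨.cross (kindAt s i), i⟩]) q -
        resolveFrom v (p ++ [⟨.cross (kindAt s i).flip, i⟩]) q := by
  rw [resolveFrom, posKind_eq h]

theorem resolveFrom_cons {v : SliceWord → A} {p q : SliceWord} {l : Slice}
    (h : l.kind ≠ .cross .sing) : resolveFrom v p (l :: q) = resolveFrom v (p ++ [l]) q := by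
  obtain ⟨k, i⟩ := l
  rcases k with d | _ | (_ | _ | _) <;> first | rfl | exact absurd rfl h

/-- Invariance under isotopy of the tangle above a level. -/
def IsIsotopyInvariant (t : List Bool) (F : SliceWord → A) : Prop :=
  ∀ x y : SliceWord, IsoFrom [] x y → run [] x = some t → F x = F y

/-- The sign of a resolution in `q` depends only on the directions above it, which an isotopy of the
upper tangle does not change; so both diagrams are resolved in the same way. -/
theorem IsIsotopyInvariant.resolveFrom {v : SliceWord → A} {t : List Bool}
    (hv : IsIsotopyInvariant t v) {s : List Bool} (q : SliceWord) (hq : run s q = some t) :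
    IsIsotopyInvariant s fun x => resolveFrom v x q := by
  induction q generalizing s with
  | nil =>
    have : s = t := by simpa using hq
    subst this
    exact hv
  | cons l q ih =>
    intro x y hxy hx
    rw [run_cons] at hq
    rcases hl : dirStep s l with _ | u
    · simp [hl] at hq
    rw [hl, Option.bind_some] at hq
    have key : ∀ l' : Slice, dirStep s l' = some u →
        _root_.resolveFrom v (x ++ [l']) q = _root_.resolveFrom v (y ++ [l']) q := by
      intro l' hl'
      have hx' : run [] (x ++ [l']) = some u := by simp [run_append, hx, hl']
      refine ih hq _ _ ?_ hx'
      exact IsoFrom.next (IsoFrom.refl _ _) (by rw [hx']; rfl) hxy (p := []) (q := [l']) rfl rfl rfl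
    by_cases hk : l.kind = .cross .sing
    · obtain ⟨k, i⟩ := l
      simp only at hk
      subst hk
      have hy : run [] y = some s := by rw [← hxy.run_eq, hx]
      simp only [resolveFrom_sing i hx, resolveFrom_sing i hy]
      rw [key ⟨.cross (kindAt s i), i⟩ hl, key ⟨.cross (kindAt s i).flip, i⟩ hl]
    · simp only [resolveFrom_cons hk]
      exact key l hl

theorem IsIsotopyInvariant.apply {F : SliceWord → A} {s t : List Bool}
    (hF : IsIsotopyInvariant t F) {p l r : SliceWord} (hp : run [] p = some s)
    (hl : run s l = some t) (h : IsoFrom s l r) : F (p ++ l) = F (p ++ r) := by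
  have hx : run [] (p ++ l) = some t := by simp [run_append, hp, hl]
  exact hF _ _ (IsoFrom.next (IsoFrom.refl _ _) (by rw [hx]; rfl) h (p := p) (q := []) hp
    (by simp) (by simp)) hx

theorem exists_of_run_cons {s t : List Bool} {l : Slice} {w : SliceWord}
    (h : run s (l :: w) = some t) : ∃ u, dirStep s l = some u ∧ run u w = some t := by
  rw [run_cons] at h
  rcases hl : dirStep s l with _ | u
  · simp [hl] at h
  · exact ⟨u, rfl, by simpa [hl] using h⟩

/-- The two ends of a maximum point in opposite directions, so sliding across it changes whether the
crossing strands are parallel. This agrees with the flip of the crossing kind in the move. -/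
theorem kindAt_slideCup {s t u u' : List Bool} {d : Bool} {k : CrossKind} {i : ℕ}
    (h : run s [⟨.cup d, i⟩, ⟨.cross k, i + 1⟩] = some t) (hu : dirStep s ⟨.cup d, i⟩ = some u)
    (hu' : dirStep s ⟨.cup d, i + 1⟩ = some u') : kindAt u' i = (kindAt u (i + 1)).flip := by
  obtain ⟨a, r, r', rfl, rfl, rfl, h'⟩ := exists_append_of_dirStep hu
  rw [run_cons, hu, Option.bind_some, run_cons, dirStep_shift] at h
  rw [dirStep_shift] at hu'
  rcases r with _ | ⟨x, r⟩
  · simp_all [dirStep]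
  simp only [dirStep, List.take_zero, List.nil_append, List.drop_zero, zero_le, if_true,
    Option.some.injEq] at h'
  subst h'
  simp only [dirStep, List.length_cons, Nat.le_add_left, if_true, List.take_succ_cons,
    List.take_zero, List.drop_succ_cons, List.drop_zero, Option.map_some, Option.some.injEq] at hu'
  subst hu'
  rw [kindAt_append, show a.length = a.length + 0 by rfl, kindAt_append]
  cases d <;> cases x <;> rfl

/-- The minimum joins the outer two of the three strands, whose directions must therefore differ;
the middle strand is parallel to exactly one of them. -/
theorem kindAt_slideCap {s t : List Bool} {k : CrossKind} {i : ℕ}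
    (h : run s [⟨.cross k, i + 1⟩, ⟨.cap, i⟩] = some t) :
    kindAt s i = (kindAt s (i + 1)).flip := by
  obtain ⟨u, hu, h2⟩ := exists_of_run_cons h
  by_cases hi : i ≤ s.length
  swap
  · rw [dirStep_eq_none (by simp; omega)] at hu
    simp at hu
  obtain ⟨a, r, rfl, rfl⟩ : ∃ a r, s = a ++ r ∧ a.length = i :=
    ⟨s.take i, s.drop i, by simp, by simp [hi]⟩
  rw [dirStep_shift] at hu
  rcases r with _ | ⟨x, _ | ⟨y, _ | ⟨z, r⟩⟩⟩ <;>
    simp only [dirStep, List.drop_succ_cons, List.drop_zero, List.drop_nil, Option.map_none,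
      reduceCtorEq] at hu
  simp only [List.take_succ_cons, List.take_zero, Option.map_some, Option.some.injEq] at hu
  subst hu
  rw [run_cons, show a.length = a.length + 0 by rfl, dirStep_shift] at h2
  rw [kindAt_append, show a.length = a.length + 0 by rfl, kindAt_append]
  cases x <;> cases y <;> cases z <;> first | rfl | simp [dirStep] at h2

/-- The two strands of the double point move one position to the right together and keep their
directions. -/
theorem kindAt_slideStrandRight {s t : List Bool} {k : CrossKind} {i : ℕ}
    (h : run s [⟨.cross k, i + 1⟩, ⟨.cross k, i⟩] = some t) : kindAt t (i + 1) = kindAt s i := by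
  obtain ⟨u, hu, h2⟩ := exists_of_run_cons h
  by_cases hi : i ≤ s.length
  swap
  · rw [dirStep_eq_none (by simp; omega)] at hu
    simp at hu
  obtain ⟨a, r, rfl, rfl⟩ : ∃ a r, s = a ++ r ∧ a.length = i :=
    ⟨s.take i, s.drop i, by simp, by simp [hi]⟩
  rw [dirStep_shift] at hu
  rcases r with _ | ⟨x, _ | ⟨y, _ | ⟨z, r⟩⟩⟩ <;>
    simp only [dirStep, List.drop_succ_cons, List.drop_zero, List.drop_nil, Option.map_none,
      reduceCtorEq] at hu
  simp only [List.take_succ_cons, List.take_zero, Option.map_some, Option.some.injEq] at hu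
  subst hu
  rw [run_cons, show a.length = a.length + 0 by rfl, dirStep_shift] at h2
  simp only [dirStep, List.drop_zero, List.cons_append, List.nil_append, List.take_zero,
    Option.map_some, Option.bind_some, run_nil, Option.some.injEq] at h2
  subst h2
  rw [kindAt_append, show a.length = a.length + 0 by rfl, kindAt_append]
  rfl

theorem kindAt_slideStrandLeft {s t : List Bool} {k : CrossKind} {i : ℕ}
    (h : run s [⟨.cross k, i⟩, ⟨.cross k, i + 1⟩] = some t) : kindAt t i = kindAt s (i + 1) := by
  obtain ⟨u, hu, h2⟩ := exists_of_run_cons h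
  obtain ⟨a, r, r', rfl, rfl, rfl, h'⟩ := exists_append_of_dirStep hu
  rw [run_cons, dirStep_shift] at h2
  rcases r with _ | ⟨x, _ | ⟨y, _ | ⟨z, r⟩⟩⟩ <;>
    simp only [dirStep, List.drop_zero, reduceCtorEq, List.take_zero, List.nil_append,
      Option.some.injEq] at h'
  · subst h'
    simp [dirStep] at h2
  subst h'
  simp only [dirStep, List.drop_succ_cons, List.drop_zero, List.cons_append, List.nil_append,
    List.take_zero, List.take_succ_cons,
    Option.map_some, Option.bind_some, run_nil, Option.some.injEq] at h2
  subst h2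
  rw [kindAt_append, show a.length = a.length + 0 by rfl, kindAt_append]
  rfl

theorem kindAt_cross {s t : List Bool} {k : CrossKind} {i : ℕ}
    (h : dirStep s ⟨.cross k, i⟩ = some t) : kindAt t i = kindAt s i := by
  obtain ⟨a, r, r', rfl, rfl, rfl, h'⟩ := exists_append_of_dirStep h
  rcases r with _ | ⟨x, _ | ⟨y, r⟩⟩ <;>
    simp only [dirStep, List.drop_zero, reduceCtorEq, List.take_zero, List.nil_append,
      Option.some.injEq] at h'
  subst h'
  rw [show a.length = a.length + 0 by rfl, kindAt_append, kindAt_append]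
  simp [kindAt, eq_comm]

theorem resolveFrom_eq_apply (F : SliceWord → A) (p l : SliceWord)
    (h : ∀ x ∈ l, x.kind ≠ .cross .sing) : resolveFrom F p l = F (p ++ l) := by
  induction l generalizing p with
  | nil => simp [resolveFrom]
  | cons x l ih =>
    rw [resolveFrom_cons (h x (by simp)), ih _ fun y hy => h y (by simp [hy])]
    simp

/-- Resolving the double points is compatible with local moves. -/
theorem LocalMove.resolveFrom_eq {F : SliceWord → A} {s t : List Bool} {p l r : SliceWord}
    (m : LocalMove l r) (hF : IsIsotopyInvariant t F) (hp : run [] p = some s)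
    (hl : run s l = some t) : resolveFrom F p l = resolveFrom F p r := by
  have hr := m.run_eq hl
  have hs : (run s l).isSome := by simp [hl]
  -- Without double points the resolution is plain evaluation, and invariance of `F` suffices. The
  -- remaining cases compare positive resolutions with positive ones.
  have plain : (∀ x ∈ l, x.kind ≠ .cross .sing) → (∀ x ∈ r, x.kind ≠ .cross .sing) →
      resolveFrom F p l = resolveFrom F p r := fun h1 h2 => by
    rw [resolveFrom_eq_apply F p l h1, resolveFrom_eq_apply F p r h2]
    exact hF.apply hp hl (.of_move m hs)
  have snoc : ∀ {u x}, dirStep s x = some u → run [] (p ++ [x]) = some u := fun h => by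
    simp [run_append, hp, h]
  cases m with
  | exchange B C i j hij =>
    obtain ⟨u, hu, hu2⟩ := exists_of_run_cons hl
    obtain ⟨u', hu', hu2'⟩ := exists_of_run_cons hr
    have e1 := kindAt_dirStep_right hij hu
    -- If both slices are double points, either order of resolution gives the same four signed
    -- terms, because each sign is unaffected by the other slice.
    by_cases hB : B = .cross .sing <;> by_cases hC : C = .cross .sing
    · subst hB hC
      have e2 : kindAt u' i = kindAt s i :=
        kindAt_dirStep_left (show i + 1 < j + 2 by omega) hu'
      have key : ∀ b c, F (p ++ [⟨.cross b, i⟩] ++ [⟨.cross c, j + 2⟩]) =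
          F (p ++ [⟨.cross c, j + 2⟩] ++ [⟨.cross b, i⟩]) := fun b c => by
        simpa [SliceKind.ins] using hF.apply hp (l := [⟨.cross b, i⟩, ⟨.cross c, j + 2⟩]) hl
          (.of_move (.exchange (.cross b) (.cross c) i j hij) hs)
      simp only [SliceKind.outs, SliceKind.ins] at e1 hu2 hu' ⊢
      have q1 : ∀ k, run [] (p ++ [⟨.cross k, i⟩]) = some u :=
        fun k => snoc (x := ⟨.cross k, i⟩) hu
      have q2 : ∀ k, run [] (p ++ [⟨.cross k, j + 2⟩]) = some u' :=
        fun k => snoc (x := ⟨.cross k, j + 2⟩) hu'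
      rw [resolveFrom_sing _ hp, resolveFrom_sing _ hp, resolveFrom_sing _ (q1 _),
        resolveFrom_sing _ (q1 _), resolveFrom_sing _ (q2 _), resolveFrom_sing _ (q2 _),
        e1, e2]
      simp only [resolveFrom, key]
      abel
    · subst hB
      have e2 : kindAt u' i = kindAt s i :=
        kindAt_dirStep_left (show i + 1 < j + 2 by omega) hu'
      have key : ∀ b, F (p ++ [⟨.cross b, i⟩] ++ [⟨C, j + 2⟩]) =
          F (p ++ [⟨C, j + 2⟩] ++ [⟨.cross b, i⟩]) := fun b => by
        simpa [SliceKind.ins] using hF.apply hp (l := [⟨.cross b, i⟩, ⟨C, j + 2⟩]) hl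
          (.of_move (.exchange (.cross b) C i j hij) hs)
      simp only [SliceKind.outs, SliceKind.ins] at hu' ⊢
      rw [resolveFrom_sing _ hp, resolveFrom_cons (l := ⟨C, _⟩) hC,
        resolveFrom_cons (l := ⟨C, _⟩) hC, resolveFrom_cons (l := ⟨C, _⟩) hC,
        resolveFrom_sing _ (snoc hu'), e2]
      simp only [resolveFrom, key]
    · subst hC
      have key : ∀ c, F (p ++ [⟨B, i⟩] ++ [⟨.cross c, j + B.outs⟩]) =
          F (p ++ [⟨.cross c, j + B.ins⟩] ++ [⟨B, i⟩]) := fun c => by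
        simpa using hF.apply hp (l := [⟨B, i⟩, ⟨.cross c, j + B.outs⟩]) hl
          (.of_move (.exchange B (.cross c) i j hij) hs)
      rw [resolveFrom_sing _ hp, resolveFrom_cons (l := ⟨B, _⟩) hB,
        resolveFrom_cons (l := ⟨B, _⟩) hB, resolveFrom_cons (l := ⟨B, _⟩) hB,
        resolveFrom_sing _ (snoc hu), e1]
      simp only [resolveFrom, key]
    · exact plain (by simpa using ⟨hB, hC⟩) (by simpa using ⟨hC, hB⟩)
  | zigzagLeft d i => exact plain (by simp) (by simp)
  | zigzagRight d i => exact plain (by simp) (by simp)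
  | slideCup d k i =>
    by_cases hk : k = .sing
    swap
    · exact plain (by simpa using hk) (by simpa using flip_ne_sing hk)
    subst hk
    obtain ⟨u, hu, hu2⟩ := exists_of_run_cons hl
    obtain ⟨u', hu', hu2'⟩ := exists_of_run_cons hr
    have e := kindAt_slideCup hl hu hu'
    have key : ∀ k, F (p ++ [⟨.cup d, i⟩] ++ [⟨.cross k, i + 1⟩]) =
        F (p ++ [⟨.cup d, i + 1⟩] ++ [⟨.cross k.flip, i⟩]) := fun k => by
      simpa using hF.apply hp (l := [⟨.cup d, i⟩, ⟨.cross k, i + 1⟩]) hl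
        (.of_move (.slideCup d k i) hs)
    rw [resolveFrom_cons (l := ⟨.cup d, i⟩) (by simp),
      resolveFrom_cons (l := ⟨.cup d, i + 1⟩) (by simp), CrossKind.flip,
      resolveFrom_sing _ (snoc hu), resolveFrom_sing _ (snoc hu'), e]
    simp only [resolveFrom, key]
  | slideCap k i =>
    by_cases hk : k = .sing
    swap
    · exact plain (by simpa using hk) (by simpa using flip_ne_sing hk)
    subst hk
    have e := kindAt_slideCap hl
    have key : ∀ k, F (p ++ [⟨.cross k, i + 1⟩] ++ [⟨.cap, i⟩]) =
        F (p ++ [⟨.cross k.flip, i⟩] ++ [⟨.cap, i + 1⟩]) := fun k => by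
      simpa using hF.apply hp (l := [⟨.cross k, i + 1⟩, ⟨.cap, i⟩]) hl
        (.of_move (.slideCap k i) hs)
    rw [CrossKind.flip, resolveFrom_sing _ hp, resolveFrom_sing _ hp, e]
    simp only [resolveFrom, key]
  | reidemeisterOneCup d k hk i => exact plain (by simpa using hk) (by simp)
  | reidemeisterOneCap k hk i => exact plain (by simpa using hk) (by simp)
  | reidemeisterTwo k hk i => exact plain (by simpa using ⟨hk, flip_ne_sing hk⟩) (by simp)
  | slideStrandRight k k' ht i =>
    by_cases hk : k = .sing
    swap
    · exact plain (by simpa using ⟨hk, ht⟩) (by simpa using ⟨ht, hk⟩)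
    subst hk
    obtain ⟨u, hu, hu2⟩ := exists_of_run_cons hr
    obtain ⟨u', hu', -⟩ := exists_of_run_cons hu2
    have e : kindAt u' (i + 1) = kindAt s i :=
      kindAt_slideStrandRight (k := k') (by simp [hu, hu'])
    have hpu : run [] (p ++ [⟨.cross k', i + 1⟩] ++ [⟨.cross k', i⟩]) = some u' := by
      simp [run_append, hp, hu, hu']
    have key : ∀ k, F (p ++ [⟨.cross k, i⟩] ++ [⟨.cross k', i + 1⟩] ++ [⟨.cross k', i⟩]) =
        F (p ++ [⟨.cross k', i + 1⟩] ++ [⟨.cross k', i⟩] ++ [⟨.cross k, i + 1⟩]) := fun k => by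
      simpa using hF.apply hp (l := [⟨.cross k, i⟩, ⟨.cross k', i + 1⟩, ⟨.cross k', i⟩]) hl
        (.of_move (.slideStrandRight k k' ht i) hs)
    have hc : ∀ i, (⟨.cross k', i⟩ : Slice).kind ≠ .cross .sing := fun i => by simpa using ht
    rw [resolveFrom_sing _ hp, resolveFrom_cons (hc _), resolveFrom_cons (hc _),
      resolveFrom_cons (hc _), resolveFrom_cons (hc _), resolveFrom_cons (hc _),
      resolveFrom_cons (hc _), resolveFrom_sing _ hpu, e]
    simp only [resolveFrom, key]
  | slideStrandLeft k k' ht i =>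
    by_cases hk : k = .sing
    swap
    · exact plain (by simpa using ⟨hk, ht⟩) (by simpa using ⟨ht, hk⟩)
    subst hk
    obtain ⟨u, hu, hu2⟩ := exists_of_run_cons hr
    obtain ⟨u', hu', -⟩ := exists_of_run_cons hu2
    have e : kindAt u' i = kindAt s (i + 1) :=
      kindAt_slideStrandLeft (k := k') (by simp [hu, hu'])
    have hpu : run [] (p ++ [⟨.cross k', i⟩] ++ [⟨.cross k', i + 1⟩]) = some u' := by
      simp [run_append, hp, hu, hu']
    have key : ∀ k, F (p ++ [⟨.cross k, i + 1⟩] ++ [⟨.cross k', i⟩] ++ [⟨.cross k', i + 1⟩]) =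
        F (p ++ [⟨.cross k', i⟩] ++ [⟨.cross k', i + 1⟩] ++ [⟨.cross k, i⟩]) := fun k => by
      simpa using hF.apply hp (l := [⟨.cross k, i + 1⟩, ⟨.cross k', i⟩, ⟨.cross k', i + 1⟩]) hl
        (.of_move (.slideStrandLeft k k' ht i) hs)
    have hc : ∀ i, (⟨.cross k', i⟩ : Slice).kind ≠ .cross .sing := fun i => by simpa using ht
    rw [resolveFrom_sing _ hp, resolveFrom_cons (hc _), resolveFrom_cons (hc _),
      resolveFrom_cons (hc _), resolveFrom_cons (hc _), resolveFrom_cons (hc _),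
      resolveFrom_cons (hc _), resolveFrom_sing _ hpu, e]
    simp only [resolveFrom, key]
  | twist k ht i =>
    obtain ⟨u, hu, hu2⟩ := exists_of_run_cons hr
    have e := kindAt_cross hu
    have key : ∀ k', F (p ++ [⟨.cross k', i⟩] ++ [⟨.cross k, i⟩]) =
        F (p ++ [⟨.cross k, i⟩] ++ [⟨.cross k', i⟩]) := fun k' => by
      simpa using hF.apply hp (l := [⟨.cross k', i⟩, ⟨.cross k, i⟩]) hl
        (IsoFrom.twist k' ht hs)
    have hc : ∀ i, (⟨.cross k, i⟩ : Slice).kind ≠ .cross .sing := fun i => by simpa using ht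
    rw [resolveFrom_sing _ hp, resolveFrom_cons (hc _), resolveFrom_cons (hc _),
      resolveFrom_cons (hc _), resolveFrom_sing _ (snoc hu), e]
    simp only [resolveFrom, key]

/-- The extension of a function that is invariant under all isotopies is invariant too. -/
theorem extendSing_eq_of_isotopic {v : SliceWord → A}
    (hv : ∀ x y : SliceWord, x.Isotopic y → v x = v y) {D E : SliceWord} (h : D.Isotopic E) :
    extendSing v D = extendSing v E := by
  have hv' : IsIsotopyInvariant [] v := fun x y hxy hx => hv x y (hxy.isotopic hx)
  induction h with
  | rel D E h =>
    obtain ⟨hD, hE, p, q, l, r, m, rfl, rfl⟩ := h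
    -- The part `q` goes into the function and `p` is resolved beforehand. All resolutions of `p`
    -- have the directions of `p`, so the bare move can be compared on each of them.
    simp only [extendSing, resolveFrom_append v [] (p ++ _) q]
    rw [resolveFrom_append, resolveFrom_append]
    refine resolveFrom_congr rfl fun x _ hx _ => ?_
    rw [List.nil_append] at hx
    have hD' : run [] (p ++ l ++ q) = some [] := hD
    rw [run_append, run_append] at hD'
    rcases hp : run [] p with _ | s
    · simp [hp] at hD'
    rcases hl : run s l with _ | t
    · simp [hp, hl] at hD'
    simp only [hp, hl, Option.bind_some] at hD'
    exact m.resolveFrom_eq (hv'.resolveFrom q hD') (hx.trans hp) hl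
  | refl => rfl
  | symm _ _ _ ih => exact ih.symm
  | trans _ _ _ _ _ ih ih' => exact ih.trans ih'

open Classical in
/-- The value of `v` at some diagram with the property `P`, if there is one. -/
noncomputable def valueAt (v : SliceWord → A) (P : SliceWord → Prop) : A :=
  if h : ∃ E, P E then v h.choose else 0

/-- Extend a knot invariant to all diagrams as a function that is invariant under isotopy. -/
noncomputable def saturate (v : SliceWord → A) (D : SliceWord) : A :=
  valueAt v fun E => E.IsKnot ∧ E.numSing = 0 ∧ D.Isotopic E

/-- The defining property sees `D` only through its isotopy class, so the same representative is
chosen for `D` and `E`, or the default 0 for both. -/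
theorem saturate_eq_of_isotopic (v : SliceWord → A) {D E : SliceWord} (h : D.Isotopic E) :
    saturate v D = saturate v E := by
  have : (fun K : SliceWord => K.IsKnot ∧ K.numSing = 0 ∧ D.Isotopic K) =
      fun K => K.IsKnot ∧ K.numSing = 0 ∧ E.Isotopic K := by
    funext K
    have : D.Isotopic K ↔ E.Isotopic K :=
      ⟨fun h' => .trans _ _ _ (.symm _ _ h) h', fun h' => .trans _ _ _ h h'⟩
    rw [this]
  rw [saturate, this, saturate]

theorem saturate_eq {v : SliceWord → A} (hv : IsKnotInvariant v) {D : SliceWord} (hD : D.IsKnot)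
    (h0 : D.numSing = 0) : saturate v D = v D := by
  have h : ∃ E : SliceWord, E.IsKnot ∧ E.numSing = 0 ∧ D.Isotopic E :=
    ⟨D, hD, h0, .refl _⟩
  rw [saturate, valueAt, dif_pos h]
  obtain ⟨h1, h2, h3⟩ := h.choose_spec
  exact (hv _ _ hD h1 h0 h2 h3).symm

theorem isKnot_congr {D E : SliceWord} (h1 : run [] D = run [] E)
    (h2 : D.components = E.components) : D.IsKnot ↔ E.IsKnot := by
  have h1' : D.dirs = E.dirs := h1
  simp [IsKnot, IsClosed, h1', h2]

/-- The extension of a knot invariant to singular knots is invariant under isotopy. -/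
theorem extendSing_invariant {v : SliceWord → A} (hv : IsKnotInvariant v) {D E : SliceWord}
    (hD : D.IsKnot) (hE : E.IsKnot) (h : D.Isotopic E) : extendSing v D = extendSing v E := by
  -- An isotopy is required to pass through closed diagrams only, and `v` is constrained only on
  -- knots. All resolutions of a knot are knots, so `v` may be replaced by `saturate v`, which is
  -- invariant along arbitrary isotopies.
  have key : ∀ {D : SliceWord}, D.IsKnot → extendSing v D = extendSing (saturate v) D :=
    fun hD => resolveFrom_congr rfl fun x hx hr hc =>
      (saturate_eq hv ((isKnot_congr hr hc).mpr hD) hx).symm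
  rw [key hD, key hE]
  exact extendSing_eq_of_isotopic (fun _ _ => saturate_eq_of_isotopic v) h

/-- Double points may be resolved in any order: resolving those of `p` first does not change the
directions at the chosen point, hence not its sign, and resolution is additive in the function. -/
theorem extendSing_skein (v : SliceWord → A) {p q : SliceWord} {s : List Bool} {i : ℕ}
    (hp : run [] p = some s) (hs : kindAt s i = .under) :
    extendSing v (p ++ ⟨.cross .sing, i⟩ :: q) =
      extendSing v (p ++ ⟨.cross .under, i⟩ :: q) - extendSing v (p ++ ⟨.cross .over, i⟩ :: q) := by
  simp only [extendSing, resolveFrom_append]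
  rw [← resolveFrom_sub]
  refine resolveFrom_congr rfl fun x _ hx _ => ?_
  rw [resolveFrom_sing i (hx.trans hp), hs]
  rfl

end Resolve

end SliceWord

/-! ### The extension vanishes on `braidReductions` -/

namespace SingularBraid

open SliceWord

theorem run_cups (m : ℕ) (s : List Bool) (a : List Bool) :
    run (a ++ s) ((List.range m).map fun i => ⟨.cup true, a.length + i⟩) =
      some (a ++ List.replicate m true ++ List.replicate m false ++ s) := by
  induction m with
  | zero => simp
  | succ m ih =>
    rw [List.range_succ, List.map_append, run_append, ih, Option.bind_some]
    simp only [List.map_cons, List.map_nil, run_cons, run_nil, List.append_assoc]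
    rw [dirStep_shift]
    have h := dirStep_shift (List.replicate m true) (List.replicate m false ++ s) (.cup true) 0
    rw [List.length_replicate, add_zero] at h
    rw [h]
    simp [dirStep, List.replicate_succ']
    rw [← List.cons_append, ← List.replicate_succ, List.replicate_succ']
    simp

theorem run_slices {m : ℕ} (w : SingularBraid m) (s : List Bool) :
    run (List.replicate m true ++ s) w.slices = some (List.replicate m true ++ s) := by
  induction w with
  | nil => rfl
  | cons l w ih =>
    obtain ⟨k, i, h⟩ := l
    obtain ⟨r, rfl⟩ := Nat.exists_eq_add_of_lt h
    have e : List.replicate (i + 1 + r + 1) true ++ s =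
        List.replicate i true ++ (true :: true :: (List.replicate r true ++ s)) := by
      rw [show i + 1 + r + 1 = i + (1 + 1 + r) by omega, List.replicate_add, List.replicate_add]
      simp [List.replicate_succ]
    simp only [slices, List.map_cons, run_cons] at ih ⊢
    have h := dirStep_shift (List.replicate i true) (true :: true :: (List.replicate r true ++ s))
      (.cross k) 0
    rw [List.length_replicate, add_zero] at h
    rw [e, h, ← e]
    simp only [dirStep, List.drop_zero, List.take_zero, List.nil_append, Option.map_some, ← e,
      Option.bind_some, ih]

theorem run_cups_slices {m : ℕ} (w : SingularBraid m) :
    run [] ((List.range m).map (fun i => ⟨.cup true, i⟩) ++ w.slices) =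
      some (List.replicate m true ++ List.replicate m false) := by
  have h := run_cups m [] []
  simp only [List.nil_append, List.length_nil, zero_add, List.append_nil] at h
  rw [run_append, h, Option.bind_some, run_slices]

theorem closure_eq {m : ℕ} (w : SingularBraid m) :
    w.closure = (List.range m).map (fun i => ⟨.cup true, i⟩) ++ w.slices ++
      (List.range m).reverse.map (fun i => ⟨.cap, i⟩) := rfl

/-- All strands of the braid point down, so the positive resolution is always the kind `under`. -/
theorem extendSing_closure {A : Type*} [AddCommGroup A] (v : SliceWord → A) {m : ℕ}
    (u w : SingularBraid m) (i : ℕ) (h : i + 1 < m) :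
    extendSing v (closure (u ++ ⟨.sing, i, h⟩ :: w)) =
      extendSing v (closure (u ++ ⟨.under, i, h⟩ :: w)) -
        extendSing v (closure (u ++ ⟨.over, i, h⟩ :: w)) := by
  have e : ∀ k, closure (u ++ ⟨k, i, h⟩ :: w) =
      ((List.range m).map (fun i => ⟨.cup true, i⟩) ++ u.slices) ++
        ⟨.cross k, i⟩ :: (w.slices ++ (List.range m).reverse.map (fun i => ⟨.cap, i⟩)) := fun k => by
    simp [closure_eq, slices]
  rw [e, e, e]
  refine extendSing_skein v (run_cups_slices u) ?_
  rw [kindAt, List.getElem?_append_left (by simpa using by omega),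
    List.getElem?_append_left (by simpa using h)]
  simp [h, show i < m by omega]

/-- The extension of an invariant of finite type vanishes on all relations. -/
theorem extendSing_of_mem_braidReductions {A : Type*} [AddCommGroup A] {v : SliceWord → A}
    {b n : ℕ} (hv : IsKnotInvariant v) (hn : IsFiniteType n v) {x : SliceWord →₀ ℤ}
    (hx : x ∈ braidReductions b n) :
    x.sum (fun D a => a • extendSing v D) = 0 := by
  rw [← Finsupp.linearCombination_apply]
  change x ∈ (Finsupp.linearCombination ℤ (extendSing v)).toAddMonoidHom.ker
  refine (AddSubgroup.closure_le _).mpr ?_ hx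
  rintro y ((⟨m, -, u, w, i, h, -, rfl⟩ | ⟨D, hD, E, hE, h, rfl⟩) | ⟨D, hD, h, rfl⟩)
  · simp [AddMonoidHom.mem_ker, Finsupp.linearCombination_single, extendSing_closure]
  · simp [AddMonoidHom.mem_ker, Finsupp.linearCombination_single,
      extendSing_invariant hv hD.1 hE.1 h]
  · simp [AddMonoidHom.mem_ker, Finsupp.linearCombination_single, hn D hD.1 h]

end SingularBraid

/-! ### Braidings of a chord diagram on three strands -/

/-- Words in the generators of the chord monoid on three strands, with labels. A generator is
given by the strand that it does not meet. -/
abbrev LabelledWord := List (ℕ × Fin 3)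

theorem List.split_unique {α : Type*} {x : α} {a b c d : List α} (ha : x ∉ a) (hc : x ∉ c)
    (h : a ++ x :: b = c ++ x :: d) : a = c ∧ b = d := by
  induction a generalizing c with
  | nil =>
    rcases c with _ | ⟨y, c⟩
    · simpa using h
    · rw [List.nil_append, List.cons_append, List.cons.injEq] at h
      exact absurd h.1 (List.ne_of_not_mem_cons hc)
  | cons y a ih =>
    rcases c with _ | ⟨z, c⟩
    · rw [List.nil_append, List.cons_append, List.cons.injEq] at h
      exact absurd h.1.symm (List.ne_of_not_mem_cons ha)
    · simp only [List.cons_append, List.cons.injEq, List.mem_cons, not_or] at h ha hc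
      have := ih ha.2 hc.2 h.2
      simp [h.1, this]

/-- Two cyclic rotations of a list in which `x` occurs twice that both begin with `x`. -/
theorem List.IsRotated.split_or {α : Type*} {x : α} {a b c d : List α} (ha : x ∉ a) (hb : x ∉ b)
    (hc : x ∉ c) (h : (x :: a ++ x :: b) ~r (x :: c ++ x :: d)) :
    (a = c ∧ b = d) ∨ (a = d ∧ b = c) := by
  obtain ⟨n, hn, h'⟩ := List.isRotated_iff_mod.mp h
  rw [List.rotate_eq_drop_append_take hn] at h'
  obtain ⟨s, t, hs, ht, e⟩ : ∃ s t, t = (x :: a ++ x :: b).take n ∧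
      s = (x :: a ++ x :: b).drop n ∧ t ++ s = x :: a ++ x :: b :=
    ⟨_, _, rfl, rfl, List.take_append_drop _ _⟩
  rw [← hs, ← ht] at h'
  rcases t with _ | ⟨y, t⟩
  · rw [List.nil_append] at e
    rw [List.append_nil, e, List.cons_append, List.cons_append, List.cons.injEq] at h'
    exact .inl (List.split_unique ha hc h'.2)
  rw [List.cons_append, List.cons_append, List.cons.injEq] at e
  obtain ⟨rfl, e⟩ := e
  rcases s with _ | ⟨z, s⟩
  · rw [List.append_nil] at e
    rw [List.nil_append, e, List.cons_append, List.cons.injEq] at h'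
    exact .inl (List.split_unique ha hc h'.2)
  rw [List.cons_append, List.cons_append, List.cons.injEq] at h'
  obtain ⟨rfl, h'⟩ := h'
  have hty : z ∉ t := by
    intro hz
    obtain ⟨t₁, t₂, rfl, ht₁⟩ := List.eq_append_cons_of_mem hz
    rw [List.append_assoc, List.cons_append] at e
    have := (List.split_unique ht₁ ha e).2
    exact hb (this ▸ by simp)
  obtain ⟨rfl, rfl⟩ := List.split_unique hty ha e
  exact .inr ((List.split_unique hb hc h').symm)

namespace LabelledWord

/-- The labels of the chords that meet the strand `i`. -/
def strand (u : LabelledWord) (i : Fin 3) : List ℕ := (u.filter fun x => x.2 ≠ i).map Prod.fst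

/-- The labels along the circle. -/
def name (u : LabelledWord) : List ℕ := u.strand 0 ++ u.strand 1 ++ u.strand 2

/-- The generators without their labels. -/
def gens (u : LabelledWord) : List (Fin 3) := u.map Prod.snd

/-- The labels in the order of the word. -/
def labels (u : LabelledWord) : List ℕ := u.map Prod.fst

/-- The effect of moving a word through the standard unknot braid. -/
def shift (u : LabelledWord) : LabelledWord := u.map fun x => (x.1, x.2 - 1)

theorem strand_append (u v : LabelledWord) (i : Fin 3) :
    strand (u ++ v) i = strand u i ++ strand v i := by
  simp [strand]

theorem strand_cons_of_ne {x : ℕ} {g i : Fin 3} (h : g ≠ i) (u : LabelledWord) :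
    strand ((x, g) :: u) i = x :: strand u i := by
  simp [strand, h]

theorem strand_cons_self (x : ℕ) (g : Fin 3) (u : LabelledWord) :
    strand ((x, g) :: u) g = strand u g := by
  simp [strand]

theorem strand_shift (u : LabelledWord) (i : Fin 3) : strand (shift u) i = strand u (i + 1) := by
  induction u with
  | nil => rfl
  | cons x u ih =>
    obtain ⟨x, g⟩ := x
    have h : shift ((x, g) :: u) = (x, g - 1) :: shift u := rfl
    by_cases hg : g = i + 1
    · subst hg
      rw [strand_cons_self, h, add_sub_cancel_right, strand_cons_self, ih]
    · rw [strand_cons_of_ne hg, h, strand_cons_of_ne (fun h => hg (by rw [← h, sub_add_cancel])), ih]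

theorem labels_shift (u : LabelledWord) : labels (shift u) = labels u := by
  simp [labels, shift]

theorem labels_append (u v : LabelledWord) : labels (u ++ v) = labels u ++ labels v := by
  simp [labels]

theorem strand_sublist (u : LabelledWord) (i : Fin 3) : (strand u i).Sublist (labels u) :=
  List.filter_sublist.map _

theorem mem_strand {u : LabelledWord} {i : Fin 3} {x : ℕ} :
    x ∈ strand u i ↔ ∃ g, g ≠ i ∧ (x, g) ∈ u := by
  simp [strand, and_comm]

theorem mem_labels {u : LabelledWord} {x : ℕ} : x ∈ labels u ↔ ∃ g, (x, g) ∈ u := by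
  simp [labels]

theorem mem_name {u : LabelledWord} {x : ℕ} : x ∈ name u ↔ x ∈ labels u := by
  simp only [name, List.mem_append, mem_strand, mem_labels]
  constructor
  · rintro ((⟨g, -, h⟩ | ⟨g, -, h⟩) | ⟨g, -, h⟩) <;> exact ⟨g, h⟩
  · rintro ⟨g, h⟩
    by_cases hg : g = 0
    · exact .inl (.inr ⟨g, by subst hg; decide, h⟩)
    · exact .inl (.inl ⟨g, hg, h⟩)

theorem gen_unique {u : LabelledWord} (hu : u.labels.Nodup) {x : ℕ} {g h : Fin 3}
    (hg : (x, g) ∈ u) (hh : (x, h) ∈ u) : g = h := by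
  have := List.inj_on_of_nodup_map hu hg hh rfl
  exact congrArg Prod.snd this

/-- A labelled word is determined by the labels along the strands. -/
theorem eq_of_strand_eq {u v : LabelledWord} (hu : u.labels.Nodup) (hv : v.labels.Nodup)
    (h : ∀ i, strand u i = strand v i) : u = v := by
  induction u generalizing v with
  | nil =>
    rcases v with _ | ⟨⟨y, k⟩, v⟩
    · rfl
    · have := h (k + 1)
      rw [strand_cons_of_ne (by clear * -; decide +revert)] at this
      simp [strand] at this
  | cons x u ih =>
    obtain ⟨x, g⟩ := x
    rcases v with _ | ⟨⟨y, k⟩, v⟩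
    · have := h (g + 1)
      rw [strand_cons_of_ne (by clear * -; decide +revert)] at this
      simp [strand] at this
    have hxu : x ∉ labels u := (List.nodup_cons.mp hu).1
    have hyv : y ∉ labels v := (List.nodup_cons.mp hv).1
    -- Each of the two first chords misses only one strand, so some strand meets both, and its first
    -- label identifies them.
    obtain ⟨i, hi, hi'⟩ : ∃ i : Fin 3, g ≠ i ∧ k ≠ i := by
      clear * -; decide +revert
    have hi := h i
    rw [strand_cons_of_ne ‹_›, strand_cons_of_ne hi', List.cons.injEq] at hi
    obtain ⟨rfl, -⟩ := hi
    -- Otherwise, on the strand missed by the first chord of the first word, the label `x` would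
    -- have to come from a later chord.
    have hgk : g = k := by
      by_contra hgk
      have := h g
      rw [strand_cons_self, strand_cons_of_ne (Ne.symm hgk)] at this
      exact hxu ((strand_sublist u g).subset (by rw [this]; simp))
    subst hgk
    congr 1
    refine ih (List.nodup_cons.mp hu).2 (List.nodup_cons.mp hv).2 fun j => ?_
    have hj := h j
    by_cases hgj : g = j
    · subst hgj
      simpa only [strand_cons_self] using hj
    · simpa only [strand_cons_of_ne hgj, List.cons.injEq, true_and] using hj

theorem eq_map_of_labels_eq {u : LabelledWord} {a : List ℕ} {k : Fin 3} (h : labels u = a)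
    (hk : ∀ x g, (x, g) ∈ u → g = k) : u = a.map fun x => (x, k) := by
  subst h
  rw [labels, List.map_map]
  conv_lhs => rw [← List.map_id u]
  refine List.map_congr_left fun x hx => ?_
  obtain ⟨x, g⟩ := x
  simp [hk x g hx]

theorem eq_append_of_labels_eq {u : LabelledWord} {a b : List ℕ} (h : labels u = a ++ b) :
    ∃ u₁ u₂, u = u₁ ++ u₂ ∧ labels u₁ = a ∧ labels u₂ = b :=
  List.map_eq_append_iff.mp h

/-- A word whose labels form four blocks with alternating generators. -/
theorem eq_four_blocks {u : LabelledWord} {a b c d : List ℕ} (h : labels u = a ++ b ++ (c ++ d))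
    (h2 : ∀ x g, (x, g) ∈ u → x ∈ a ++ c → g = 2) (h1 : ∀ x g, (x, g) ∈ u → x ∈ b ++ d → g = 1) :
    u = (a.map fun x => (x, 2)) ++ (b.map fun x => (x, 1)) ++
      ((c.map fun x => (x, 2)) ++ (d.map fun x => (x, 1))) := by
  obtain ⟨u₁, u₂, rfl, e1, e2⟩ := eq_append_of_labels_eq h
  obtain ⟨p, q, rfl, rfl, rfl⟩ := eq_append_of_labels_eq e1
  obtain ⟨r, s, rfl, rfl, rfl⟩ := eq_append_of_labels_eq e2
  have mem : ∀ {w : LabelledWord} {x g}, (x, g) ∈ w → x ∈ labels w :=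
    fun h => mem_labels.mpr ⟨_, h⟩
  rw [← eq_map_of_labels_eq (u := p) rfl fun x g hg => h2 x g (by simp [hg]) (by simp [mem hg]),
    ← eq_map_of_labels_eq (u := q) rfl fun x g hg => h1 x g (by simp [hg]) (by simp [mem hg]),
    ← eq_map_of_labels_eq (u := r) rfl fun x g hg => h2 x g (by simp [hg]) (by simp [mem hg]),
    ← eq_map_of_labels_eq (u := s) rfl fun x g hg => h1 x g (by simp [hg]) (by simp [mem hg])]

section Invariance

variable {H : Type*} {F : List (Fin 3) → H}

theorem apply_rotate (hrot : ∀ g W, F (g :: W) = F (W ++ [g - 1])) (p q : LabelledWord) :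
    F (gens (p ++ q)) = F (gens (q ++ shift p)) := by
  induction p generalizing q with
  | nil => simp [shift]
  | cons x p ih =>
    have h1 : gens (x :: p ++ q) = x.2 :: gens (p ++ q) := rfl
    have h2 : gens (p ++ q) ++ [x.2 - 1] = gens (p ++ (q ++ [(x.1, x.2 - 1)])) := by simp [gens]
    rw [h1, hrot, h2, ih]
    simp [shift]

theorem apply_shift (hrot : ∀ g W, F (g :: W) = F (W ++ [g - 1])) (p : LabelledWord) :
    F (gens p) = F (gens (shift p)) := by
  simpa using apply_rotate hrot p []

/-- With `p0` for the labels of `p` on strand 0, and so on, the name p0 q0 p1 q1 p2 q2 becomes q0 p1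
q1 p2 q2 p0: carrying `p` through the unknot braid moves only the block p0 around the circle. -/
theorem name_rotate (p q : LabelledWord) : name (p ++ q) ~r name (q ++ shift p) := by
  refine ⟨(strand p 0).length, ?_⟩
  have e : name (p ++ q) = strand p 0 ++
      (strand q 0 ++ (strand p 1 ++ strand q 1) ++ (strand p 2 ++ strand q 2)) := by
    simp [name, strand_append]
  rw [e, List.rotate_append_length_eq]
  simp [name, strand_append, strand_shift]

theorem name_shift (p : LabelledWord) : name p ~r name (shift p) := by
  simpa using name_rotate p []

/-- A word can be rotated so that it begins with a given chord, joining the first two strands. -/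
theorem exists_rotation (hrot : ∀ g W, F (g :: W) = F (W ++ [g - 1])) {u : LabelledWord}
    (hu : u.labels.Nodup) {x : ℕ} (hx : x ∈ labels u) :
    ∃ u', (labels ((x, 2) :: u')).Nodup ∧ name u ~r name ((x, 2) :: u') ∧
      F (gens u) = F (gens ((x, 2) :: u')) := by
  obtain ⟨g, hg⟩ := mem_labels.mp hx
  obtain ⟨p, q, rfl⟩ := List.append_of_mem hg
  obtain ⟨w, hw⟩ : ∃ w, w = q ++ shift p := ⟨_, rfl⟩
  have h1 : F (gens (p ++ (x, g) :: q)) = F (gens ((x, g) :: w)) := by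
    rw [apply_rotate hrot, hw]; rfl
  have h2 : name (p ++ (x, g) :: q) ~r name ((x, g) :: w) := by
    rw [hw]; exact name_rotate p ((x, g) :: q)
  have h3 : (labels ((x, g) :: w)).Nodup := by
    have : (labels ((x, g) :: w)).Perm (labels (p ++ (x, g) :: q)) := by
      rw [hw, ← List.cons_append, labels_append, labels_append, labels_shift]
      exact List.perm_append_comm
    exact this.nodup_iff.mpr hu
  have hs : ∀ g, shift ((x, g) :: w) = (x, g - 1) :: shift w := fun _ => rfl
  fin_cases g
  · refine ⟨shift w, ?_, h2.trans (name_shift _), h1.trans (apply_shift hrot _)⟩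
    have := labels_shift ((x, 0) :: w)
    rw [hs] at this
    exact this ▸ h3
  · refine ⟨shift (shift w), ?_, h2.trans ((name_shift _).trans (name_shift _)),
      h1.trans ((apply_shift hrot _).trans (apply_shift hrot _))⟩
    have := (labels_shift (shift ((x, 1) :: w))).trans (labels_shift _)
    rw [hs] at this
    exact this ▸ h3
  · exact ⟨w, h3, h2, h1⟩

/-- If the chord `x` separates the circle in opposite ways in two braidings of a diagram, then they
are related by a flype. -/
theorem apply_eq_of_opposite
    (hflype : ∀ a b c d, F (.replicate a 2 ++ .replicate b 1 ++ .replicate c 2 ++ .replicate d 1) =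
      F (.replicate a 2 ++ .replicate c 1 ++ .replicate b 2 ++ .replicate d 1))
    {x : ℕ} {u v : LabelledWord} (hu : u.labels.Nodup) (hv : v.labels.Nodup)
    (h1 : strand u 0 = strand v 1 ++ strand v 2) (h2 : strand v 0 = strand u 1 ++ strand u 2) :
    F (gens ((x, 2) :: u)) = F (gens ((x, 2) :: v)) := by
  -- A chord missing strand 0 would have its label on both strands 1 and 2, hence twice on strand 0
  -- of the other word.
  have key : ∀ {u v : LabelledWord}, u.labels.Nodup → v.labels.Nodup →
      strand v 0 = strand u 1 ++ strand u 2 → (∀ x, (x, 0) ∉ u) := by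
    intro u v hu hv h x hx
    have hn : (strand u 1 ++ strand u 2).Nodup := h ▸ hv.sublist (strand_sublist v 0)
    exact (List.nodup_append.mp hn).2.2 x (mem_strand.mpr ⟨0, by decide, hx⟩) x
      (mem_strand.mpr ⟨0, by decide, hx⟩) rfl
  have hu0 := key hu hv h2
  have hv0 := key hv hu h1
  have hlab : ∀ {w : LabelledWord}, (∀ x, (x, 0) ∉ w) → strand w 0 = labels w := by
    intro w hw
    rw [strand, List.filter_eq_self.mpr, labels]
    rintro ⟨x, g⟩ hx
    simp only [ne_eq, decide_eq_true_eq]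
    rintro rfl
    exact hw x hx
  rw [hlab hu0] at h1
  rw [hlab hv0] at h2
  have htwo : ∀ {w : LabelledWord}, w.labels.Nodup → (∀ x, (x, 0) ∉ w) → ∀ x g, (x, g) ∈ w →
      (x ∈ strand w 1 → g = 2) ∧ (x ∈ strand w 2 → g = 1) := by
    intro w hw hw0 x g hg
    constructor <;> intro h <;> obtain ⟨k, hk, hk'⟩ := mem_strand.mp h <;>
      obtain rfl := gen_unique hw hg hk' <;> have : g ≠ 0 := (fun h0 => hw0 x (h0 ▸ hg)) <;> omega
  -- Cutting `v` where strand 1 of `u` ends divides the labels into four blocks, by their strand (1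
  -- or 2) in `u` and in `v`. In `u` they appear in the order a, b, c, d with missing strands 2, 1,
  -- 2, 1; in `v` in the order a, c, b, d with the same missing strands.
  obtain ⟨v₁, v₂, rfl, l1, l2⟩ := eq_append_of_labels_eq h2
  obtain ⟨a, ha⟩ : ∃ a, a = strand v₁ 1 := ⟨_, rfl⟩
  obtain ⟨b, hb⟩ : ∃ b, b = strand v₂ 1 := ⟨_, rfl⟩
  obtain ⟨c, hc⟩ : ∃ c, c = strand v₁ 2 := ⟨_, rfl⟩
  obtain ⟨d, hd⟩ : ∃ d, d = strand v₂ 2 := ⟨_, rfl⟩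
  have sub : ∀ {w : LabelledWord} {i x}, x ∈ strand w i → x ∈ labels w :=
    fun h => (strand_sublist _ _).subset h
  simp only [strand_append, ← ha, ← hb, ← hc, ← hd] at h1
  have eu := eq_four_blocks h1
    (fun x g hg hx => (htwo hu hu0 x g hg).1 (l1 ▸ (List.mem_append.mp hx).elim
      (fun h => sub (ha ▸ h)) (fun h => sub (hc ▸ h))))
    (fun x g hg hx => (htwo hu hu0 x g hg).2 (l2 ▸ (List.mem_append.mp hx).elim
      (fun h => sub (hb ▸ h)) (fun h => sub (hd ▸ h))))
  have m1 : labels v₁ = a ++ c := by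
    rw [l1, eu]; simp [strand, List.filter_append, List.filter_map, Function.comp_def]
  have m2 : labels v₂ = b ++ d := by
    rw [l2, eu]; simp [strand, List.filter_append, List.filter_map, Function.comp_def]
  have ev := eq_four_blocks (u := v₁ ++ v₂) (a := a) (b := c) (c := b) (d := d)
    (by rw [labels_append, m1, m2])
    (fun x g hg hx => (htwo hv hv0 x g hg).1 (by rw [strand_append, ← ha, ← hb]; exact hx))
    (fun x g hg hx => (htwo hv hv0 x g hg).2 (by rw [strand_append, ← hc, ← hd]; exact hx))
  rw [eu, ev]
  have := hflype (a.length + 1) b.length c.length d.length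
  simpa [gens, Function.comp_def, List.map_const', List.replicate_succ] using this

/-- Both words are rotated to begin with `x`. Two further shifts turn its missing strand 1 into 2 in
the first word, and since the names agree as lists, this puts opposite arcs of `x` on the first
strand. -/
theorem apply_eq_of_opposite_gens (hrot : ∀ g W, F (g :: W) = F (W ++ [g - 1]))
    (hflype : ∀ a b c d, F (.replicate a 2 ++ .replicate b 1 ++ .replicate c 2 ++ .replicate d 1) =
      F (.replicate a 2 ++ .replicate c 1 ++ .replicate b 2 ++ .replicate d 1))
    {x : ℕ} {p q p' q' : LabelledWord} (hu : (labels (p ++ (x, 1) :: q)).Nodup)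
    (hv : (labels (p' ++ (x, 2) :: q')).Nodup)
    (h : name (p ++ (x, 1) :: q) = name (p' ++ (x, 2) :: q')) :
    F (gens (p ++ (x, 1) :: q)) = F (gens (p' ++ (x, 2) :: q')) := by
  have hp : ∀ {p q : LabelledWord} {g}, (labels (p ++ (x, g) :: q)).Nodup →
      (labels (q ++ shift p)).Nodup ∧ ∀ i, x ∉ strand p i ∧ x ∉ strand q i := by
    intro p q g h
    have e : labels (p ++ (x, g) :: q) = labels p ++ x :: labels q := by simp [labels]
    rw [e, List.nodup_middle, List.nodup_cons, List.mem_append] at h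
    refine ⟨?_, fun i => ⟨fun h' => h.1 (.inl ((strand_sublist p i).subset h')),
      fun h' => h.1 (.inr ((strand_sublist q i).subset h'))⟩⟩
    rw [labels_append, labels_shift, (List.perm_append_comm).nodup_iff]
    exact h.2
  obtain ⟨hu', hxu⟩ := hp hu
  obtain ⟨hv', hxv⟩ := hp hv
  have e1 : name (p ++ (x, 1) :: q) = strand p 0 ++ x :: ((strand q 0 ++ (strand p 1 ++ strand q 1) ++
      strand p 2) ++ x :: strand q 2) := by
    simp [name, strand_append, strand_cons_self, strand_cons_of_ne]
  have e2 : name (p' ++ (x, 2) :: q') = strand p' 0 ++ x :: ((strand q' 0 ++ strand p' 1) ++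
      x :: (strand q' 1 ++ (strand p' 2 ++ strand q' 2))) := by
    simp [name, strand_append, strand_cons_self, strand_cons_of_ne]
  rw [e1, e2] at h
  obtain ⟨h0, h⟩ := List.split_unique (hxu 0).1 (hxv 0).1 h
  obtain ⟨h1, h2⟩ := List.split_unique (by simp [hxu]) (by simp [hxv]) h
  rw [apply_rotate hrot, apply_rotate hrot p', List.cons_append, List.cons_append,
    apply_shift hrot, apply_shift hrot (shift _)]
  refine apply_eq_of_opposite hflype (x := x) (u := shift (shift (q ++ shift p)))
    (v := q' ++ shift p') ?_ hv' ?_ ?_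
  · rwa [labels_shift, labels_shift]
  · simp only [strand_shift, strand_append]
    change strand q 2 ++ strand p 0 = _
    rw [h2, h0]
    simp [strand_shift, strand_append]
  · simp only [strand_shift, strand_append]
    change strand q' 0 ++ strand p' 1 = _
    rw [← h1]
    simp

/-- Braidings of one chord diagram on three strands are related by rotations and flypes. -/
theorem apply_eq_of_name_isRotated (hrot : ∀ g W, F (g :: W) = F (W ++ [g - 1]))
    (hflype : ∀ a b c d, F (.replicate a 2 ++ .replicate b 1 ++ .replicate c 2 ++ .replicate d 1) =
      F (.replicate a 2 ++ .replicate c 1 ++ .replicate b 2 ++ .replicate d 1))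
    {u v : LabelledWord} (hu : u.labels.Nodup) (hv : v.labels.Nodup) (h : name u ~r name v) :
    F (gens u) = F (gens v) := by
  rcases u with _ | ⟨⟨x, g⟩, u₀⟩
  · have hn : name v = [] := by simpa [name, strand] using h.symm
    rcases v with _ | ⟨⟨x, g⟩, v⟩
    · rfl
    · have : x ∈ name ((x, g) :: v) := mem_name.mpr (by simp [labels])
      rw [hn] at this
      simp at this
  have hxu : x ∈ labels ((x, g) :: u₀) := by simp [labels]
  have hxv : x ∈ labels v := mem_name.mp (h.mem_iff.mp (mem_name.mpr hxu))
  generalize ((x, g) :: u₀ : LabelledWord) = u at *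
  obtain ⟨u', hu', hnu, eu⟩ := exists_rotation hrot hu hxu
  obtain ⟨v', hv', hnv, ev⟩ := exists_rotation hrot hv hxv
  rw [eu, ev]
  have hr := hnu.symm.trans (h.trans hnv)
  have en : ∀ w, name ((x, 2) :: w) = x :: strand w 0 ++ x :: (strand w 1 ++ strand w 2) := by
    intro w
    simp [name, strand_cons_self, strand_cons_of_ne]
  have hx : ∀ {w}, (labels ((x, 2) :: w)).Nodup → ∀ i, x ∉ strand w i := fun h i hi =>
    (List.nodup_cons.mp h).1 ((strand_sublist _ i).subset hi)
  have tail : ∀ {w}, (labels ((x, 2) :: w)).Nodup → (labels w).Nodup := fun h =>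
    (List.nodup_cons.mp h).2
  rw [en, en] at hr
  -- The two occurrences of `x` cut the circle into two arcs; a rotation either matches the first
  -- arcs or exchanges the arcs.
  rcases hr.split_or (hx hu' 0) (by simp [hx hu']) (hx hv' 0) with ⟨h0, h12⟩ | ⟨h1, h2⟩
  swap
  · exact apply_eq_of_opposite hflype (tail hu') (tail hv') h1 h2.symm
  clear eu ev hnu hnv hr hu hv hxu hxv h
  -- Here the first strands agree, and `a` is the stretch of the second arc lying on strand 2 of `u`
  -- but on strand 1 of `v`.
  have main : ∀ {u v : LabelledWord} {a : List ℕ}, (labels ((x, 2) :: u)).Nodup →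
      (labels ((x, 2) :: v)).Nodup → strand u 0 = strand v 0 → strand v 1 = strand u 1 ++ a →
      strand u 2 = a ++ strand v 2 →
      F (gens ((x, 2) :: u)) = F (gens ((x, 2) :: v)) := by
    intro u v a hu hv h0 h1 h2
    rcases a with _ | ⟨y, a⟩
    · rw [eq_of_strand_eq (tail hu) (tail hv)]
      intro i
      fin_cases i
      · exact h0
      · simpa using h1.symm
      · simpa using h2
    -- Labels do not repeat on a strand, so the chord of `y` misses strand 1 in `u` and strand 2 in
    -- `v`. Used in place of `x`, it is in opposite position in the two words.
    · obtain ⟨k, hk, hyu⟩ := mem_strand.mp (show y ∈ strand u 2 by simp [h2])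
      obtain ⟨l, hl, hyv⟩ := mem_strand.mp (show y ∈ strand v 1 by simp [h1])
      have hk1 : k = 1 := by
        by_contra hk1
        have hy := mem_strand.mpr ⟨k, hk1, hyu⟩
        have hn := (tail hv).sublist (strand_sublist v 1)
        rw [h1] at hn
        exact (List.nodup_append.mp hn).2.2 y hy y (by simp) rfl
      have hl2 : l = 2 := by
        by_contra hl2
        have hy := mem_strand.mpr ⟨l, hl2, hyv⟩
        have hn := (tail hu).sublist (strand_sublist u 2)
        rw [h2] at hn
        exact (List.nodup_append.mp hn).2.2 y (by simp) y hy rfl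
      subst hk1 hl2
      have hname : name ((x, 2) :: u) = name ((x, 2) :: v) := by
        rw [en, en, h0, h1, h2]; simp
      obtain ⟨p, q, e⟩ := List.append_of_mem (List.mem_cons_of_mem (x, (2 : Fin 3)) hyu)
      obtain ⟨p', q', e'⟩ := List.append_of_mem (List.mem_cons_of_mem (x, (2 : Fin 3)) hyv)
      rw [e] at hname hu ⊢
      rw [e'] at hname hv ⊢
      exact apply_eq_of_opposite_gens hrot hflype hu hv hname
  rcases List.append_eq_append_iff.mp h12 with ⟨a, h1, h2⟩ | ⟨a, h1, h2⟩
  · exact main hu' hv' h0 h1 h2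
  · exact (main hv' hu' h0.symm h1 h2).symm

end Invariance

end LabelledWord

/-! ### Singular 3-braids modulo crossing changes -/

/-- The relations between the crossings `s` and the double points `t` of singular 3-braids that
hold modulo crossing changes. The index is `true` for the strands in the positions 1 and 2. -/
structure FlatBraidRelations {Q : Type*} [Monoid Q] (s t : Bool → Q) : Prop where
  mul_self (i : Bool) : s i * s i = 1
  braid (i : Bool) : s i * s (!i) * s i = s (!i) * s i * s (!i)
  slide (i : Bool) : t i * s (!i) * s i = s (!i) * s i * t (!i)
  comm (i : Bool) : s i * t i = t i * s i

namespace FlatBraidRelations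

/-- The chord that does not meet the given strand. -/
def chord {Q : Type*} [Monoid Q] (s t : Bool → Q) : Fin 3 → Q :=
  ![t true * s true, s true * (t false * s false) * s true, t false * s false]

/-- The transposition of the strands at a crossing. -/
def transposition (i : Bool) : Equiv.Perm (Fin 3) := bif i then .swap 1 2 else .swap 0 1

/-- The permutation of a word in crossings and double points. -/
def permutation (w : List (Bool × Bool)) : Equiv.Perm (Fin 3) :=
  (w.map fun l => transposition l.2).prod

/-- The crossing or double point of a letter. -/
def letter {Q : Type*} (s t : Bool → Q) (l : Bool × Bool) : Q := bif l.1 then t l.2 else s l.2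

/-- The element of a word in crossings and double points. -/
def eval {Q : Type*} [Monoid Q] (s t : Bool → Q) (w : List (Bool × Bool)) : Q :=
  (w.map (letter s t)).prod

variable {Q : Type*} [Monoid Q] {s t : Bool → Q}

theorem cancel (h : FlatBraidRelations s t) (i : Bool) (x : Q) : s i * (s i * x) = x := by
  rw [← mul_assoc, h.mul_self, one_mul]

/-- The chords are conjugates of t_i s_i by crossings, and the symmetric group acts on them by
permuting the missing strand. Only the passage between chords 0 and 1 uses the braid and slide
relations. -/
theorem mul_chord (h : FlatBraidRelations s t) (i : Bool) (g : Fin 3) :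
    s i * chord s t g = chord s t (transposition i g) * s i := by
  have e2 : s false * chord s t 2 = chord s t 2 * s false := by
    simp [chord, ← mul_assoc, h.comm]
  have e0 : s true * chord s t 0 = chord s t 0 * s true := by
    simp [chord, ← mul_assoc, h.comm]
  have e3 : s true * chord s t 2 = chord s t 1 * s true := by
    simp [chord, mul_assoc, h.mul_self]
  have e4 : s true * chord s t 1 = chord s t 2 * s true := by
    simp [chord, mul_assoc, h.cancel]
  have e5 : s false * chord s t 0 = chord s t 1 * s false := by
    have h1 := h.braid false
    have h2 := h.slide false
    simp only [Bool.not_false] at h1 h2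
    simp only [chord, Matrix.cons_val_zero, Matrix.cons_val_one]
    calc s false * (t true * s true)
        = s true * (s true * s false * t true) * s true := by simp [mul_assoc, h.cancel]
      _ = s true * (t false * (s true * s false * s true)) := by rw [← h2]; simp [mul_assoc]
      _ = _ := by rw [← h1]; simp [mul_assoc]
  have e6 : s false * chord s t 1 = chord s t 0 * s false := by
    have : s false * (s false * chord s t 0) * s false =
        s false * (chord s t 1 * s false) * s false := by rw [e5]
    simpa [h.cancel, mul_assoc, h.mul_self] using this.symm
  have p : transposition false 0 = 1 ∧ transposition false 1 = 0 ∧ transposition false 2 = 2 ∧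
    transposition true 0 = 0 ∧ transposition true 1 = 2 ∧ transposition true 2 = 1 := by decide
  obtain ⟨p1, p2, p3, p4, p5, p6⟩ := p
  cases i <;> fin_cases g <;> simp only [Fin.zero_eta, Fin.mk_one, Fin.reduceFinMk]
  · rw [p1, e5]
  · rw [p2, e6]
  · rw [p3, e2]
  · rw [p4, e0]
  · rw [p5, e4]
  · rw [p6, e3]

/-- The element of a word in the chords. -/
def chords (s t : Bool → Q) (W : List (Fin 3)) : Q := (W.map (chord s t)).prod

theorem chords_append (V W : List (Fin 3)) :
    chords s t (V ++ W) = chords s t V * chords s t W := by simp [chords]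

theorem mul_chords (h : FlatBraidRelations s t) (i : Bool) (W : List (Fin 3)) :
    s i * chords s t W = chords s t (W.map (transposition i)) * s i := by
  induction W with
  | nil => simp [chords]
  | cons g W ih =>
    simp only [chords, List.map_cons, List.prod_cons] at ih ⊢
    rw [← mul_assoc, h.mul_chord, mul_assoc, ih, mul_assoc]

/-- The six reduced words of the symmetric group on three letters are closed under left
multiplication by crossings. The permutation is carried along to identify the normal form later. -/
theorem mul_word (h : FlatBraidRelations s t) (i : Bool) (p : List (Bool × Bool))
    (hp : p ∈ [[], [(false, false)], [(false, true)], [(false, false), (false, true)],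
      [(false, true), (false, false)], [(false, false), (false, true), (false, false)]]) :
    ∃ q ∈ [[], [(false, false)], [(false, true)], [(false, false), (false, true)],
      [(false, true), (false, false)], [(false, false), (false, true), (false, false)]],
      s i * eval s t p = eval s t q ∧ transposition i * permutation p = permutation q := by
  have h1 := h.braid true
  have h0 := h.braid false
  simp only [Bool.not_true, Bool.not_false, mul_assoc] at h0 h1
  have c1 := h.cancel true
  have c0 := h.cancel false
  have m1 := h.mul_self true
  have m0 := h.mul_self false
  simp only [List.mem_cons, List.not_mem_nil, or_false] at hp
  rcases hp with rfl | rfl | rfl | rfl | rfl | rfl <;> cases i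
  · exact ⟨[(false, false)], by simp, by simp [eval, letter], by decide⟩
  · exact ⟨[(false, true)], by simp, by simp [eval, letter], by decide⟩
  · exact ⟨[], by simp, by simp [eval, letter, m0], by decide⟩
  · exact ⟨[(false, true), (false, false)], by simp, by simp [eval, letter], by decide⟩
  · exact ⟨[(false, false), (false, true)], by simp, by simp [eval, letter], by decide⟩
  · exact ⟨[], by simp, by simp [eval, letter, m1], by decide⟩
  · exact ⟨[(false, true)], by simp, by simp [eval, letter, c0], by decide⟩
  · exact ⟨[(false, false), (false, true), (false, false)], by simp,
      by simp [eval, letter, h1], by decide⟩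
  · exact ⟨[(false, false), (false, true), (false, false)], by simp,
      by simp [eval, letter], by decide⟩
  · exact ⟨[(false, false)], by simp, by simp [eval, letter, c1], by decide⟩
  · exact ⟨[(false, true), (false, false)], by simp, by simp [eval, letter, c0], by decide⟩
  · exact ⟨[(false, false), (false, true)], by simp, by simp [eval, letter, h0, c1], by decide⟩

/-- Every word is a word in the chords followed by a permutation braid. -/
theorem exists_chords (h : FlatBraidRelations s t) (w : List (Bool × Bool)) :
    ∃ W : List (Fin 3), W.length = w.countP (fun l => l.1) ∧
    ∃ p ∈ [[], [(false, false)], [(false, true)], [(false, false), (false, true)],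
      [(false, true), (false, false)], [(false, false), (false, true), (false, false)]],
      eval s t w = chords s t W * eval s t p ∧ permutation w = permutation p := by
  induction w with
  | nil => exact ⟨[], rfl, [], by simp, by simp [chords, eval], rfl⟩
  | cons l w ih =>
    obtain ⟨W, hW, p, hp, h1, h2⟩ := ih
    obtain ⟨q, hq, h3, h4⟩ := h.mul_word l.2 p hp
    have hs : s l.2 * eval s t w =
        chords s t (W.map (transposition l.2)) * eval s t q := by
      rw [h1, ← mul_assoc, h.mul_chords, mul_assoc, h3]
    have hperm : permutation (l :: w) = permutation q := by
      rw [← h4, ← h2]; rfl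
    obtain ⟨k, i⟩ := l
    cases k
    · exact ⟨_, by simpa using hW, q, hq, hs, hperm⟩
    -- A double point is a chord times a crossing, so it adds one chord and then acts as a crossing.
    · have ht : ∃ g, t i = chord s t g * s i := by
        cases i
        · exact ⟨2, by simp [chord, mul_assoc, h.mul_self]⟩
        · exact ⟨0, by simp [chord, mul_assoc, h.mul_self]⟩
      obtain ⟨g, hg⟩ := ht
      refine ⟨g :: W.map (transposition i), by simpa using hW, q, hq, ?_, hperm⟩
      change t i * eval s t w = _
      rw [hg, mul_assoc, hs]
      simp [chords, mul_assoc]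

/-- A central function takes the same value on a word whose permutation has no fixed points and
on a word in the chords followed by the standard unknot braid. -/
theorem exists_apply_eq {H : Type*} {f : Q → H} (h : FlatBraidRelations s t)
    (hf : ∀ x y, f (x * y) = f (y * x)) (w : List (Bool × Bool))
    (hw : ∀ i, permutation w i ≠ i) :
    ∃ W : List (Fin 3), W.length = w.countP (fun l => l.1) ∧
      f (eval s t w) = f (chords s t W * (s true * s false)) := by
  obtain ⟨W, hW, p, hp, h1, h2⟩ := h.exists_chords w
  rw [h2] at hw
  simp only [List.mem_cons, List.not_mem_nil, or_false] at hp
  rcases hp with rfl | rfl | rfl | rfl | rfl | rfl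
  · exact absurd hw (by decide)
  · exact absurd hw (by decide)
  · exact absurd hw (by decide)
  -- For the other 3-cycle, the last crossing is carried around the closure and back through the
  -- chords, which permutes their strands.
  · refine ⟨W.map (transposition true), by simpa using hW, ?_⟩
    calc f (eval s t w) = f (chords s t W * s false * s true) := by
          rw [h1]; simp [eval, letter, mul_assoc]
      _ = f (s true * chords s t W * s false) := by rw [hf, mul_assoc]
      _ = _ := by rw [h.mul_chords, mul_assoc]
  · exact ⟨W, hW, by rw [h1]; simp [eval, letter]⟩
  · exact absurd hw (by decide)

/-- By centrality the first chord is carried around to the end and then moved back past s₁ and s₀,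
whose joint effect on strands is `g ↦ g - 1`. -/
theorem apply_cons {H : Type*} {f : Q → H} (h : FlatBraidRelations s t)
    (hf : ∀ x y, f (x * y) = f (y * x)) (g : Fin 3) (W : List (Fin 3)) :
    f (chords s t (g :: W) * (s true * s false)) =
      f (chords s t (W ++ [g - 1]) * (s true * s false)) := by
  have e : transposition true (transposition false g) = g - 1 := by revert g; decide
  rw [chords_append, ← e]
  simp only [chords, List.map_cons, List.map_nil, List.prod_cons, List.prod_nil, mul_one]
  rw [mul_assoc, hf, mul_assoc, mul_assoc, mul_assoc, h.mul_chord, ← mul_assoc (s true),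
    h.mul_chord, mul_assoc]

/-- The chord missing strand 1 is a conjugate of both x and y. This reduces both sides to the form
of a braid flype, with rows of twists x^(d+a), y^b and x^c s₀ at alternating positions. -/
theorem apply_flype {H : Type*} {f : Q → H} (h : FlatBraidRelations s t)
    (hf : ∀ x y, f (x * y) = f (y * x))
    (hflype : ∀ u v w : List (Bool × Bool), (∀ l ∈ u, l.2 = false) → (∀ l ∈ v, l.2 = true) →
      (∀ l ∈ w, l.2 = false) →
      f (eval s t u * eval s t v * eval s t w * s true) =
        f (eval s t u * s true * eval s t w * eval s t v)) (a b c d : ℕ) :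
    f (chords s t (.replicate a 2 ++ .replicate b 1 ++ .replicate c 2 ++ .replicate d 1) *
        (s true * s false)) =
      f (chords s t (.replicate a 2 ++ .replicate c 1 ++ .replicate b 2 ++ .replicate d 1) *
        (s true * s false)) := by
  set x := t false * s false with hx
  set y := t true * s true with hy
  have h12 : ∀ k : ℕ, chords s t (.replicate k 2) = x ^ k := fun k => by
    simp [chords, chord, hx]
  have h13 : ∀ k : ℕ, chords s t (.replicate k 1) = s true * x ^ k * s true := fun k => by
    rw [chords, ← mul_one (List.prod _), ← h.mul_self true, ← mul_assoc]
    have := h.mul_chords true (.replicate k 2)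
    simp only [List.map_replicate, show transposition true 2 = 1 by decide, h12] at this
    rw [this]
    rfl
  have h23 : ∀ k : ℕ, s false * y ^ k * s false = s true * x ^ k * s true := fun k => by
    rw [← h13]
    have := h.mul_chords false (.replicate k 0)
    simp only [List.map_replicate, show transposition false 0 = 1 by decide] at this
    rw [show y ^ k = chords s t (.replicate k 0) by simp [chords, chord, hy], this, mul_assoc,
      h.mul_self, mul_one]
  have hc : ∀ k : ℕ, s false * x ^ k = x ^ k * s false := fun k => by
    have := h.mul_chords false (.replicate k 2)
    simpa only [List.map_replicate, show transposition false 2 = 2 by decide, h12] using this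
  have c0 := h.cancel false
  have c1 := h.cancel true
  have m0 := h.mul_self false
  have m1 := h.mul_self true
  -- The block of exponent `d` travels around the closure to join the block of exponent `a`; the s₁
  -- s₀ at the end supplies the crossings of the flype.
  have normal : ∀ a b c d : ℕ,
      f (chords s t (.replicate a 2 ++ .replicate b 1 ++ .replicate c 2 ++ .replicate d 1) *
        (s true * s false)) = f (x ^ (d + a) * y ^ b * (x ^ c * s false) * s true) := by
    intro a b c d
    simp only [chords_append, h12, h13]
    calc f (x ^ a * (s true * x ^ b * s true) * x ^ c * (s true * x ^ d * s true) *
          (s true * s false))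
        = f (x ^ a * (s true * x ^ b * s true) * x ^ c * s true * (x ^ d * s false)) := by
          simp [mul_assoc, c1]
      _ = f (x ^ d * s false * (x ^ a * (s false * y ^ b * s false) * x ^ c * s true)) := by
          rw [hf, h23]
      _ = f (x ^ d * (s false * x ^ a) * s false * y ^ b * (s false * x ^ c) * s true) := by
          simp [mul_assoc]
      _ = _ := by
          rw [hc, hc, pow_add]; simp [mul_assoc, c0]
  rw [normal, normal]
  have ev : ∀ (i : Bool) (k : ℕ), ∃ u : List (Bool × Bool), (∀ l ∈ u, l.2 = i) ∧
      eval s t u = (t i * s i) ^ k := fun i k => by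
    induction k with
    | zero => exact ⟨[], by simp, by simp [eval]⟩
    | succ k ih =>
      obtain ⟨u, hu, h1⟩ := ih
      refine ⟨(true, i) :: (false, i) :: u, by simpa using hu, ?_⟩
      rw [pow_succ', ← h1]
      simp [eval, letter, mul_assoc]
  obtain ⟨u, hu, eu⟩ := ev false (d + a)
  obtain ⟨v, hv, e1⟩ := ev true b
  obtain ⟨w, hw, ew⟩ := ev false c
  have hw' : eval s t (w ++ [(false, false)]) = x ^ c * s false := by
    rw [← ew]; simp [eval, letter]
  have key := hflype u v (w ++ [(false, false)]) hu hv (by simpa [or_imp, forall_and] using hw)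
  rw [eu, e1, hw'] at key
  rw [key]
  calc f (x ^ (d + a) * s true * (x ^ c * s false) * y ^ b)
      = f (x ^ (d + a) * s true * x ^ c * (s false * y ^ b * s false) * s false) := by
        simp [mul_assoc, m0]
    _ = f (x ^ (d + a) * (s true * x ^ c * s true) * x ^ b * s true * s false) := by
        rw [h23]; simp [mul_assoc]
    _ = f (s false * (x ^ (d + a) * (s false * y ^ c * s false) * x ^ b * s true)) := by
        rw [h23, hf]
    _ = f (s false * x ^ (d + a) * s false * y ^ c * (s false * x ^ b) * s true) := by
        simp [mul_assoc]
    _ = _ := by rw [hc, hc]; simp [mul_assoc, m0]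

/-- The value of a central function that is invariant under flypes depends only on the chord
diagram. -/
theorem apply_eq_of_name_isRotated {H : Type*} {f : Q → H} (h : FlatBraidRelations s t)
    (hf : ∀ x y, f (x * y) = f (y * x))
    (hflype : ∀ u v w : List (Bool × Bool), (∀ l ∈ u, l.2 = false) → (∀ l ∈ v, l.2 = true) →
      (∀ l ∈ w, l.2 = false) →
      f (eval s t u * eval s t v * eval s t w * s true) =
        f (eval s t u * s true * eval s t w * eval s t v)) {u v : LabelledWord}
    (hu : u.labels.Nodup) (hv : v.labels.Nodup) (hn : u.name ~r v.name) :
    f (chords s t u.gens * (s true * s false)) = f (chords s t v.gens * (s true * s false)) :=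
  LabelledWord.apply_eq_of_name_isRotated (F := fun W => f (chords s t W * (s true * s false)))
    (h.apply_cons hf) (h.apply_flype hf hflype) hu hv hn

end FlatBraidRelations

/-! ### The syntactic congruence -/

/-- The largest congruence on a free monoid that is compatible with a function. -/
def syntacticCon {α H : Type*} (F : List α → H) : Con (FreeMonoid α) where
  r x y := ∀ u v : List α, F (u ++ x.toList ++ v) = F (u ++ y.toList ++ v)
  iseqv := ⟨fun _ _ _ => rfl, fun h u v => (h u v).symm, fun h h' u v => (h u v).trans (h' u v)⟩
  mul' {w x y z} h h' u v := by
    have h1 := h u (y.toList ++ v)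
    have h2 := h' (u ++ x.toList) v
    simp only [FreeMonoid.toList_mul, List.append_assoc] at h1 h2 ⊢
    rw [h1, h2]

namespace syntacticCon

variable {α H : Type*} (F : List α → H)

/-- The class of a word. -/
def mk (w : List α) : (syntacticCon F).Quotient := (FreeMonoid.ofList w : FreeMonoid α)

theorem mk_append (v w : List α) : mk F (v ++ w) = mk F v * mk F w := rfl

/-- The function on classes of words. -/
def value (q : (syntacticCon F).Quotient) : H :=
  Con.liftOn q (fun w => F w.toList) fun x y h => by simpa using h [] []

theorem value_mk (w : List α) : value F (mk F w) = F w := rfl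

theorem exists_mk (q : (syntacticCon F).Quotient) : ∃ w, q = mk F w :=
  Con.induction_on q fun w => ⟨w.toList, rfl⟩

theorem mk_eq {x y : List α} (h : ∀ u v, F (u ++ x ++ v) = F (u ++ y ++ v)) : mk F x = mk F y :=
  (Con.eq _).mpr h

end syntacticCon

/-! ### Invariants of closed 3-braids under crossing changes -/

namespace SingularBraid

open SliceWord FlatBraidRelations

/-- The permutation of the strands. -/
def permutation (w : SingularBraid 3) : Equiv.Perm (Fin 3) :=
  (w.map fun l => transposition (l.idx == 1)).prod

/-- After the three maxima the pieces are named 0, 1, 2, 2, 1, 0 and the next free name is 3. Braid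
slices permute only the left three names. -/
theorem foldl_sweepStep_slices (w : SingularBraid 3) (p : Equiv.Perm (Fin 3)) :
    w.slices.foldl sweepStep ⟨[(p 0 : ℕ), p 1, p 2, 2, 1, 0], 3, 0⟩ =
      ⟨[((p * w.permutation) 0 : ℕ), (p * w.permutation) 1, (p * w.permutation) 2, 2, 1, 0], 3, 0⟩ := by
  induction w generalizing p with
  | nil => rfl
  | cons l w ih =>
    obtain ⟨k, i, h⟩ := l
    have hw : permutation (⟨k, i, h⟩ :: w) = transposition (i == 1) * permutation w := rfl
    have hs : slices (⟨k, i, h⟩ :: w) = ⟨.cross k, i⟩ :: slices w := rfl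
    have := ih (p * transposition (i == 1))
    rw [hw, hs, List.foldl_cons, ← mul_assoc, ← this]
    congr 1
    have hi : i = 0 ∨ i = 1 := by omega
    rcases hi with rfl | rfl <;> simp [sweepStep, transposition, Equiv.swap_apply_def]

/-- The components are the cycles of the permutation, and the fixed-point-free permutations of three
strands are the 3-cycles. -/
theorem isKnot_closure_iff (w : SingularBraid 3) :
    w.closure.IsKnot ↔ ∀ i, w.permutation i ≠ i := by
  have h : w.closure.components = ([⟨.cap, 2⟩, ⟨.cap, 1⟩, ⟨.cap, 0⟩].foldl sweepStep
      ⟨[((w.permutation) 0 : ℕ), (w.permutation) 1, (w.permutation) 2, 2, 1, 0], 3, 0⟩).done := by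
    have := foldl_sweepStep_slices w 1
    rw [one_mul] at this
    rw [components, closure_three, List.foldl_append, List.foldl_append, ← this]
    rfl
  rw [IsKnot, and_iff_right (isClosed_closure_three w), h]
  generalize w.permutation = p
  revert p
  decide

theorem numSing_closure {m : ℕ} (w : SingularBraid m) :
    w.closure.numSing = w.countP fun l => l.kind = .sing := by
  simp [numSing, closure, List.countP_append, List.countP_map, Function.comp_def]

/-- The word without the signs of the crossings. -/
def flatten (w : SingularBraid 3) : List (Bool × Bool) :=
  w.map fun l => (l.kind = .sing, l.idx == 1)

/-- The word with positive crossings. -/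
def positive (w : List (Bool × Bool)) : SingularBraid 3 :=
  w.map fun l => ⟨bif l.1 then .sing else .under, bif l.2 then 1 else 0, by cases l.2 <;> decide⟩

theorem positive_append (v w : List (Bool × Bool)) :
    positive (v ++ w) = positive v ++ positive w := List.map_append

theorem permutation_positive (w : List (Bool × Bool)) :
    (positive w).permutation = FlatBraidRelations.permutation w := by
  rw [permutation, positive, List.map_map, FlatBraidRelations.permutation]
  congr 2
  funext ⟨k, i⟩
  cases i <;> rfl

theorem permutation_flatten (w : SingularBraid 3) :
    FlatBraidRelations.permutation (flatten w) = w.permutation := by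
  rw [permutation, flatten, FlatBraidRelations.permutation, List.map_map]
  rfl

theorem countP_positive (w : List (Bool × Bool)) :
    ((positive w).countP fun l => l.kind = .sing) = w.countP fun l => l.1 := by
  rw [positive, List.countP_map]
  congr 1
  funext ⟨k, i⟩
  cases k <;> rfl

theorem countP_flatten (w : SingularBraid 3) :
    ((flatten w).countP fun l => l.1) = w.countP fun l => l.kind = .sing := by
  rw [flatten, List.countP_map]
  rfl

/-- A function on knots with `k` double points that are closed 3-braids, invariant under isotopies
and crossing changes between such knots. -/
structure IsFlatInvariant {H : Type*} (k : ℕ) (Φ : SliceWord → H) : Prop where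
  change (u v : SingularBraid 3) (i : ℕ) (h : i + 1 < 3) :
    (closure (u ++ ⟨.under, i, h⟩ :: v)).IsKnot → (closure (u ++ ⟨.under, i, h⟩ :: v)).numSing = k →
      Φ (closure (u ++ ⟨.under, i, h⟩ :: v)) = Φ (closure (u ++ ⟨.over, i, h⟩ :: v))
  isotopic (v w : SingularBraid 3) : v.closure.IsKnot → w.closure.IsKnot → v.closure.numSing = k →
    w.closure.numSing = k → v.closure.Isotopic w.closure → Φ v.closure = Φ w.closure

/-- The value of an invariant on the closure of a word in crossings and double points, if it is a
knot with `k` double points. -/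
def flatValue {H : Type*} (k : ℕ) (Φ : SliceWord → H) (w : List (Bool × Bool)) : Option H :=
  if (∀ i, FlatBraidRelations.permutation w i ≠ i) ∧ (w.countP fun l => l.1) = k then
    some (Φ (positive w).closure) else none

namespace IsFlatInvariant

variable {H : Type*} {k : ℕ} {Φ : SliceWord → H}

theorem apply_flatten (hΦ : IsFlatInvariant k Φ) (w : SingularBraid 3) (hw : w.closure.IsKnot)
    (hk : w.closure.numSing = k) : Φ w.closure = Φ (positive (flatten w)).closure := by
  -- The crossings are made positive one at a time, with the part already treated collected in the
  -- prefix `v`.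
  suffices h : ∀ v w : SingularBraid 3, (closure (v ++ w)).IsKnot →
      (closure (v ++ w)).numSing = k → Φ (closure (v ++ w)) =
        Φ (closure (v ++ positive (flatten w))) from h [] w hw hk
  clear hw hk w
  intro v w hw hk
  induction w generalizing v with
  | nil => rfl
  | cons l w ih =>
    have hl : Φ (closure (v ++ l :: w)) =
        Φ (closure (v ++ positive (flatten [l]) ++ w)) ∧
        (closure (v ++ positive (flatten [l]) ++ w)).IsKnot ∧
        (closure (v ++ positive (flatten [l]) ++ w)).numSing = k := by
      obtain ⟨c, i, h⟩ := l
      rw [isKnot_closure_iff, numSing_closure] at *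
      have hi : i = 0 ∨ i = 1 := by omega
      have hp : permutation (v ++ ⟨.under, i, h⟩ :: w) = permutation (v ++ ⟨c, i, h⟩ :: w) := by
        simp [permutation]
      have e : positive (flatten [⟨c, i, h⟩]) =
          [⟨if c = .sing then .sing else .under, i, h⟩] := by
        rcases hi with rfl | rfl <;> cases c <;> rfl
      rw [e, List.append_assoc, List.singleton_append]
      cases c
      · have hk' : (List.countP (fun l => decide (l.kind = CrossKind.sing))
            (v ++ ⟨.under, i, h⟩ :: w)) = k := by
          rw [← hk]; simp [List.countP_append]
        exact ⟨(hΦ.change v w i h ((isKnot_closure_iff _).mpr (hp ▸ hw))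
          ((numSing_closure _).trans hk')).symm, hp ▸ hw, hk'⟩
      · exact ⟨rfl, hw, hk⟩
      · exact ⟨rfl, hw, hk⟩
    rw [hl.1, ih _ hl.2.1 hl.2.2, List.append_assoc]
    rfl

theorem flatValue_flatten (hΦ : IsFlatInvariant k Φ) (w : SingularBraid 3) (hw : w.closure.IsKnot)
    (hk : w.closure.numSing = k) : flatValue k Φ (flatten w) = some (Φ w.closure) := by
  rw [flatValue, if_pos, hΦ.apply_flatten w hw hk]
  rw [permutation_flatten, countP_flatten, ← numSing_closure, ← isKnot_closure_iff]
  exact ⟨hw, hk⟩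

theorem flatValue_congr (hΦ : IsFlatInvariant k Φ) {x y : List (Bool × Bool)}
    (hp : (∀ i, FlatBraidRelations.permutation x i ≠ i) ↔
      ∀ i, FlatBraidRelations.permutation y i ≠ i)
    (hc : (x.countP fun l => l.1) = y.countP fun l => l.1)
    (h : (positive x).closure.Isotopic (positive y).closure) :
    flatValue k Φ x = flatValue k Φ y := by
  by_cases hy : (∀ i, FlatBraidRelations.permutation y i ≠ i) ∧ (y.countP fun l => l.1) = k
  · rw [flatValue, flatValue, if_pos hy, if_pos ⟨hp.mpr hy.1, hc.trans hy.2⟩]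
    rw [hΦ.isotopic _ _ _ _ _ _ h]
    · rw [isKnot_closure_iff, permutation_positive, hp]; exact hy.1
    · rw [isKnot_closure_iff, permutation_positive]; exact hy.1
    · rw [numSing_closure, countP_positive, hc]; exact hy.2
    · rw [numSing_closure, countP_positive]; exact hy.2
  · rw [flatValue, flatValue, if_neg hy, if_neg fun hx => hy ⟨hp.mp hx.1, hc.symm.trans hx.2⟩]

/-- Equal permutations and equal numbers of double points ensure that in every context both words
give admissible knots or neither does; in the latter case both values are `none`. Thus relations
hold in the syntactic monoid. -/
theorem flatValue_context (hΦ : IsFlatInvariant k Φ) {x y : List (Bool × Bool)}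
    (hp : FlatBraidRelations.permutation x = FlatBraidRelations.permutation y)
    (hc : (x.countP fun l => l.1) = y.countP fun l => l.1)
    (h : IsoFrom [true, true, true, false, false, false] (positive x).slices (positive y).slices)
    (u v : List (Bool × Bool)) :
    flatValue k Φ (u ++ x ++ v) = flatValue k Φ (u ++ y ++ v) := by
  refine hΦ.flatValue_congr ?_ (by simp [List.countP_append, hc]) ?_
  · have : FlatBraidRelations.permutation (u ++ x ++ v) =
        FlatBraidRelations.permutation (u ++ y ++ v) := by
      simp only [FlatBraidRelations.permutation, List.map_append, List.prod_append] at hp ⊢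
      rw [hp]
    rw [this]
  · rw [positive_append, positive_append, positive_append, positive_append]
    exact isotopic_of_isoFrom _ _ _ _ h

/-- After a change of the second crossing the two crossings have opposite signs and cancel by the
second Reidemeister move. -/
theorem flatValue_cancel (hΦ : IsFlatInvariant k Φ) (i : Bool) (u v : List (Bool × Bool)) :
    flatValue k Φ (u ++ [(false, i), (false, i)] ++ v) = flatValue k Φ (u ++ [] ++ v) := by
  have hi : (bif i then 1 else 0) + 1 < 3 := by cases i <;> decide
  set w := positive u ++ ⟨.under, bif i then 1 else 0, hi⟩ ::
    ⟨.over, bif i then 1 else 0, hi⟩ :: positive v with hw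
  have hfw : flatten w = u ++ [(false, i), (false, i)] ++ v := by
    have : ∀ u, flatten (positive u) = u := fun u => by
      rw [flatten, positive, List.map_map]
      convert List.map_id u using 2
      funext ⟨a, b⟩
      cases a <;> cases b <;> rfl
    rw [hw, flatten, List.map_append]
    simp only [List.map_cons]
    rw [← flatten, ← flatten, this, this]
    cases i <;> simp
  have hperm : FlatBraidRelations.permutation (u ++ [(false, i), (false, i)] ++ v) =
      FlatBraidRelations.permutation (u ++ [] ++ v) := by
    simp only [FlatBraidRelations.permutation, List.map_append, List.prod_append]
    cases i <;> simp [transposition]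
  have hcount : ((u ++ [(false, i), (false, i)] ++ v).countP fun l => l.1) =
      (u ++ [] ++ v).countP fun l : Bool × Bool => l.1 := by
    simp [List.countP_append]
  by_cases h : (∀ j, FlatBraidRelations.permutation (u ++ [] ++ v) j ≠ j) ∧
      ((u ++ [] ++ v).countP fun l : Bool × Bool => l.1) = k
  · have h1 : w.closure.IsKnot := by
      rw [isKnot_closure_iff, ← permutation_flatten, hfw, hperm]; exact h.1
    have h2 : w.closure.numSing = k := by
      rw [numSing_closure, ← countP_flatten, hfw, hcount]; exact h.2
    rw [← hfw, hΦ.flatValue_flatten w h1 h2, flatValue, if_pos h]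
    congr 1
    refine hΦ.isotopic _ _ h1 ?_ h2 ?_ ?_
    · rw [isKnot_closure_iff, permutation_positive]; exact h.1
    · rw [numSing_closure, countP_positive]; exact h.2
    · have := isotopic_of_isoFrom (positive u) (positive v)
        [⟨.under, bif i then 1 else 0, hi⟩, ⟨.over, bif i then 1 else 0, hi⟩] []
        (IsoFrom.of_move (.reidemeisterTwo .under (by decide) _) (by cases i <;> rfl))
      rw [List.append_nil, positive_append]
      simpa [hw] using this
  · rw [flatValue, flatValue, if_neg h, if_neg (by rwa [hperm, hcount])]

theorem flatValue_append_comm (hΦ : IsFlatInvariant k Φ) (x y : List (Bool × Bool)) :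
    flatValue k Φ (x ++ y) = flatValue k Φ (y ++ x) := by
  induction x generalizing y with
  | nil => simp
  | cons l x ih =>
    rw [List.cons_append, ← List.singleton_append (x := l) (l := x), ← List.append_assoc, ← ih,
      ← List.append_assoc]
    refine hΦ.flatValue_congr ?_ ?_ ?_
    · have h1 : FlatBraidRelations.permutation (l :: (x ++ y)) =
          transposition l.2 * FlatBraidRelations.permutation (x ++ y) := rfl
      have h2 : FlatBraidRelations.permutation (x ++ y ++ [l]) =
          FlatBraidRelations.permutation (x ++ y) * transposition l.2 := by
        simp [FlatBraidRelations.permutation, mul_assoc]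
      rw [h1, h2]
      generalize FlatBraidRelations.permutation (x ++ y) = p
      generalize transposition l.2 = q
      revert p q
      decide
    · simp [List.countP_append, List.countP_cons]; omega
    · rw [positive_append (x ++ y)]
      exact isotopic_rotate _ _

theorem flatValue_flype (hΦ : IsFlatInvariant k Φ) (u v w : List (Bool × Bool))
    (hu : ∀ l ∈ u, l.2 = false) (hv : ∀ l ∈ v, l.2 = true) (hw : ∀ l ∈ w, l.2 = false) :
    flatValue k Φ (u ++ v ++ w ++ [(false, true)]) =
      flatValue k Φ (u ++ [(false, true)] ++ w ++ v) := by
  -- A row at one position permutes trivially or by its transposition, which leaves eight cases for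
  -- comparing the knot conditions of the two sides.
  have hperm : ∀ (i : Bool) (u : List (Bool × Bool)), (∀ l ∈ u, l.2 = i) →
      FlatBraidRelations.permutation u = 1 ∨ FlatBraidRelations.permutation u = transposition i := by
    intro i u hu
    induction u with
    | nil => exact .inl rfl
    | cons l u ih =>
      have e : FlatBraidRelations.permutation (l :: u) =
          transposition l.2 * FlatBraidRelations.permutation u := rfl
      rw [e, hu l (by simp)]
      rcases ih fun l hl => hu l (by simp [hl]) with h | h <;> rw [h]
      · simp
      · left; cases i <;> simp [transposition]
  have htw : ∀ (i : Bool) (u : List (Bool × Bool)), (∀ l ∈ u, l.2 = i) →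
      slices (positive u) =
        twists (bif i then 1 else 0) (u.map fun l => bif l.1 then .sing else .under) := by
    intro i u hu
    simp only [slices, positive, twists, List.map_map]
    refine List.map_congr_left fun l hl => ?_
    simp [hu l hl]
  refine hΦ.flatValue_congr ?_ ?_ ?_
  · have e1 : FlatBraidRelations.permutation (u ++ v ++ w ++ [(false, true)]) =
        FlatBraidRelations.permutation u * FlatBraidRelations.permutation v *
          FlatBraidRelations.permutation w * transposition true := by
      simp [FlatBraidRelations.permutation, mul_assoc]
    have e2 : FlatBraidRelations.permutation (u ++ [(false, true)] ++ w ++ v) =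
        FlatBraidRelations.permutation u * transposition true *
          FlatBraidRelations.permutation w * FlatBraidRelations.permutation v := by
      simp [FlatBraidRelations.permutation, mul_assoc]
    rw [e1, e2]
    rcases hperm _ u hu with h | h <;> rcases hperm _ v hv with h' | h' <;>
      rcases hperm _ w hw with h'' | h'' <;> rw [h, h', h''] <;> decide
  · simp [List.countP_append]; omega
  · have := (isoFrom_flype (u.map fun l => bif l.1 then .sing else .under)
      (v.map fun l => bif l.1 then .sing else .under)
      (w.map fun l => bif l.1 then .sing else .under) (t := .over) (by decide))
    simp only [closure_three, positive_append, slices_append, htw _ u hu, htw _ v hv, htw _ w hw]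
    refine IsoFrom.isotopic (by simpa [slices, positive, CrossKind.flip] using this) ?_
    have := isClosed_closure_three (positive (u ++ v ++ w ++ [(false, true)]))
    simpa only [closure_three, positive_append, slices_append, htw _ u hu, htw _ v hv, htw _ w hw]
      using this

/-- The crossings and double points in the monoid of an invariant. -/
def generator (k : ℕ) (Φ : SliceWord → H) (sing i : Bool) :
    (syntacticCon (flatValue k Φ)).Quotient := syntacticCon.mk _ [(sing, i)]

theorem eval_generator (w : List (Bool × Bool)) :
    eval (generator k Φ false) (generator k Φ true) w = syntacticCon.mk _ w := by
  induction w with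
  | nil => rfl
  | cons l w ih =>
    rw [← List.singleton_append, syntacticCon.mk_append, ← ih]
    obtain ⟨a, i⟩ := l
    cases a <;> rfl

theorem flatBraidRelations (hΦ : IsFlatInvariant k Φ) :
    FlatBraidRelations (generator k Φ false) (generator k Φ true) where
  mul_self i := syntacticCon.mk_eq _ (hΦ.flatValue_cancel i)
  braid i := by
    refine syntacticCon.mk_eq _ (x := [_, _, _]) (y := [_, _, _]) (hΦ.flatValue_context ?_ ?_ ?_)
    · cases i <;> decide
    · rfl
    · cases i
      · exact .of_move (.slideStrandRight .under .under (by decide) 0) rfl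
      · exact .of_move (.slideStrandLeft .under .under (by decide) 0) rfl
  slide i := by
    refine syntacticCon.mk_eq _ (x := [_, _, _]) (y := [_, _, _]) (hΦ.flatValue_context ?_ ?_ ?_)
    · cases i <;> decide
    · rfl
    · cases i
      · exact .of_move (.slideStrandRight .sing .under (by decide) 0) rfl
      · exact .of_move (.slideStrandLeft .sing .under (by decide) 0) rfl
  comm i := by
    refine syntacticCon.mk_eq _ (x := [_, _]) (y := [_, _]) (hΦ.flatValue_context ?_ ?_ ?_)
    · rfl
    · rfl
    · cases i
      · exact .symm (.of_move (.twist .under (by decide) 0) rfl)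
      · exact .symm (.of_move (.twist .under (by decide) 1) rfl)

theorem value_mul_comm (hΦ : IsFlatInvariant k Φ) (x y : (syntacticCon (flatValue k Φ)).Quotient) :
    syntacticCon.value _ (x * y) = syntacticCon.value _ (y * x) := by
  obtain ⟨x, rfl⟩ := syntacticCon.exists_mk _ x
  obtain ⟨y, rfl⟩ := syntacticCon.exists_mk _ y
  exact hΦ.flatValue_append_comm x y

theorem value_flype (hΦ : IsFlatInvariant k Φ) (u v w : List (Bool × Bool))
    (hu : ∀ l ∈ u, l.2 = false) (hv : ∀ l ∈ v, l.2 = true) (hw : ∀ l ∈ w, l.2 = false) :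
    let s := generator k Φ false
    let t := generator k Φ true
    syntacticCon.value _ (eval s t u * eval s t v * eval s t w * s true) =
      syntacticCon.value _ (eval s t u * s true * eval s t w * eval s t v) := by
  intro s t
  simp only [s, t, eval_generator]
  exact hΦ.flatValue_flype u v w hu hv hw

/-- The flattened standard braid of a chord. -/
def chordLetters : Fin 3 → List (Bool × Bool) :=
  ![[(true, true), (false, true)], [(false, true), (true, false), (false, false), (false, true)],
    [(true, false), (false, false)]]

/-- The flattened standard braid of a word in the chords. -/
def chordBraid (W : List (Fin 3)) : List (Bool × Bool) :=
  W.flatMap chordLetters ++ [(false, true), (false, false)]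

theorem value_chords (W : List (Fin 3)) :
    syntacticCon.value (flatValue k Φ) (chords (generator k Φ false) (generator k Φ true) W *
      (generator k Φ false true * generator k Φ false false)) = flatValue k Φ (chordBraid W) := by
  rw [← syntacticCon.value_mk (flatValue k Φ), chordBraid, syntacticCon.mk_append]
  congr 2
  induction W with
  | nil => rfl
  | cons g W ih =>
    rw [List.flatMap_cons, syntacticCon.mk_append, ← ih]
    change chord _ _ g * _ = _
    congr 1
    fin_cases g <;> rfl

/-- The normal form of the flat braid calculus applies to the value function on the syntactic
monoid, since conjugation invariance makes that function central. -/
theorem exists_flatValue_eq (hΦ : IsFlatInvariant k Φ) (w : SingularBraid 3)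
    (hw : w.closure.IsKnot) (hk : w.closure.numSing = k) :
    ∃ W : List (Fin 3), W.length = k ∧ some (Φ w.closure) = flatValue k Φ (chordBraid W) := by
  obtain ⟨W, hW, h⟩ := hΦ.flatBraidRelations.exists_apply_eq hΦ.value_mul_comm (flatten w)
    (by rw [permutation_flatten, ← isKnot_closure_iff]; exact hw)
  refine ⟨W, ?_, ?_⟩
  · rw [hW, countP_flatten, ← numSing_closure, hk]
  · rw [value_chords, eval_generator, syntacticCon.value_mk, hΦ.flatValue_flatten w hw hk] at h
    exact h

theorem flatValue_eq_of_isRotated (hΦ : IsFlatInvariant k Φ) {u v : LabelledWord}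
    (hu : u.labels.Nodup) (hv : v.labels.Nodup) (hn : u.name ~r v.name) :
    flatValue k Φ (chordBraid u.gens) = flatValue k Φ (chordBraid v.gens) := by
  rw [← value_chords, ← value_chords]
  exact hΦ.flatBraidRelations.apply_eq_of_name_isRotated hΦ.value_mul_comm hΦ.value_flype hu hv hn

end IsFlatInvariant

end SingularBraid

/-! ### Chord words, standard knots and stabilization to three strands -/

open SliceWord FlatBraidRelations SingularBraid

/-- The strand that a chord does not meet. -/
def ChordGen.missing (g : ChordGen 3) : Fin 3 :=
  if g.left = 0 then (if g.right = 1 then 2 else 1) else 0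

theorem ChordGen.missing_ne_iff (g : ChordGen 3) (i : Fin 3) : g.missing ≠ i ↔ g.meets i = true := by
  obtain ⟨l, r, h⟩ := g
  revert l r i
  simp only [ChordGen.missing, ChordGen.meets]
  decide

/-- The chord that does not meet the given strand. -/
def ChordGen.ofMissing : Fin 3 → ChordGen 3 :=
  ![⟨1, 2, by decide⟩, ⟨0, 2, by decide⟩, ⟨0, 1, by decide⟩]

theorem ChordGen.missing_ofMissing (i : Fin 3) : (ChordGen.ofMissing i).missing = i := by
  fin_cases i <;> rfl

theorem ChordGen.eq_ofMissing (g : ChordGen 3) : g = ofMissing g.missing := by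
  obtain ⟨l, r, h⟩ := g
  fin_cases l <;> fin_cases r <;> first | rfl | exact absurd h (by decide)

namespace ChordWord

/-- The word with labels. -/
def labelled (W : ChordWord 3) (f : ℕ → ℕ) : LabelledWord :=
  W.zipIdx.map fun x => (f x.2, x.1.missing)

theorem gens_labelled (W : ChordWord 3) (f : ℕ → ℕ) :
    (W.labelled f).gens = W.map ChordGen.missing := by
  have : W.map ChordGen.missing = (W.zipIdx.map Prod.fst).map ChordGen.missing := by
    rw [List.zipIdx_map_fst]
  rw [this, labelled, LabelledWord.gens, List.map_map, List.map_map]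
  rfl

theorem nodup_labels_labelled (W : ChordWord 3) {f : ℕ → ℕ} (hf : f.Injective) :
    (W.labelled f).labels.Nodup := by
  have : (W.labelled f).labels = (W.zipIdx.map Prod.snd).map f := by
    rw [labelled, LabelledWord.labels, List.map_map, List.map_map]
    rfl
  rw [this, List.zipIdx_map_snd]
  exact (List.nodup_range' (h := by decide)).map hf

theorem filter_range_any {α : Type*} (W : List α) (p : α → Bool) :
    (List.range W.length).filter (fun k => W[k]?.any p) =
      (W.zipIdx.filter fun x => p x.1).map Prod.snd := by
  induction W using List.reverseRecOn with
  | nil => rfl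
  | append_singleton W g ih =>
    rw [List.length_append, List.length_singleton, List.range_succ, List.filter_append,
      List.zipIdx_append, List.filter_append, List.map_append, ← ih]
    congr 1
    · refine List.filter_congr fun k hk => ?_
      rw [List.getElem?_append_left (List.mem_range.mp hk)]
    · by_cases h : p g <;> simp [h]

theorem strand_labelled (W : ChordWord 3) (f : ℕ → ℕ) (i : Fin 3) :
    (W.labelled f).strand i = (W.readStrand i).map f := by
  rw [readStrand, filter_range_any, labelled, LabelledWord.strand, List.filter_map, List.map_map,
    List.map_map]
  congr 1
  refine List.filter_congr fun x _ => ?_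
  have := x.1.missing_ne_iff i
  by_cases h : x.1.missing = i <;> simp_all

theorem name_labelled (W : ChordWord 3) (f : ℕ → ℕ) :
    (W.labelled f).name = W.readName.map f := by
  simp [LabelledWord.name, strand_labelled, readName, List.finRange_succ]

/-- The relabelling in the equality of diagrams is absorbed into the labels of `V`, so that only a
rotation of the circle remains. -/
theorem exists_name_isRotated {V W : ChordWord 3} (h : V.diagram = W.diagram) :
    ∃ f : ℕ → ℕ, f.Injective ∧ (V.labelled f).name ~r (W.labelled id).name := by
  obtain ⟨k, f, e⟩ := Quotient.exact h
  refine ⟨f, f.injective, k, ?_⟩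
  have e' : W.readName = (V.readName.rotate k).map f := e
  rw [name_labelled, name_labelled, List.map_id, e', List.map_rotate]

theorem flatten_singularBraid (g : ChordGen 3) :
    flatten g.singularBraid = IsFlatInvariant.chordLetters g.missing := by
  rw [g.eq_ofMissing, ChordGen.missing_ofMissing]
  generalize g.missing = i
  fin_cases i <;> rfl

/-- Flattening forgets signs, so the conjugating crossings of both signs, and those of the unknot
braid, become the self-inverse letters of the chord calculus. -/
theorem flatten_standardBraid (W : ChordWord 3) :
    flatten (W.flatMap ChordGen.singularBraid ++ standardUnknotBraid 3) =
      IsFlatInvariant.chordBraid (W.map ChordGen.missing) := by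
  rw [IsFlatInvariant.chordBraid, flatten, List.map_append]
  congr 1
  rw [List.map_flatMap, List.flatMap_map]
  congr 1
  funext g
  exact flatten_singularBraid g

theorem isKnot_standardKnot (W : ChordWord 3) : W.standardKnot.IsKnot := by
  rw [standardKnot, isKnot_closure_iff, ← permutation_flatten, flatten_standardBraid]
  have h : ∀ L : List (Fin 3), FlatBraidRelations.permutation (IsFlatInvariant.chordBraid L) =
      transposition true * transposition false := by
    intro L
    induction L with
    | nil => decide
    | cons g L ih =>
      have : FlatBraidRelations.permutation (IsFlatInvariant.chordBraid (g :: L)) =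
          FlatBraidRelations.permutation (IsFlatInvariant.chordLetters g) *
            FlatBraidRelations.permutation (IsFlatInvariant.chordBraid L) := by
        simp [FlatBraidRelations.permutation, IsFlatInvariant.chordBraid]
      have hg : ∀ g, FlatBraidRelations.permutation (IsFlatInvariant.chordLetters g) = 1 := by
        decide
      rw [this, ih, hg, one_mul]
  rw [h]
  decide

theorem numSing_standardKnot (W : ChordWord 3) : W.standardKnot.numSing = W.length := by
  rw [standardKnot, numSing_closure, ← countP_flatten, flatten_standardBraid]
  induction W with
  | nil => rfl
  | cons g W ih =>
    have : ∀ i, ((IsFlatInvariant.chordLetters i).countP fun l => l.1) = 1 := by decide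
    simp only [IsFlatInvariant.chordBraid, List.map_cons, List.flatMap_cons, List.append_assoc] at ih ⊢
    rw [List.countP_append, ih, this, List.length_cons, add_comm]

theorem numChords_diagram (W : ChordWord 3) : W.diagram.numChords = W.length := by
  have h : ∀ u : LabelledWord, u.name.length = 2 * u.length := by
    intro u
    induction u with
    | nil => rfl
    | cons x u ih =>
      obtain ⟨x, g⟩ := x
      simp only [LabelledWord.name, LabelledWord.strand, List.length_append] at ih ⊢
      fin_cases g <;> simp at ih ⊢ <;> omega
  have := h (W.labelled id)
  rw [name_labelled, List.map_id] at this
  change W.readName.length / 2 = _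
  rw [this]
  simp [labelled]

theorem readStrand_replicate {m : ℕ} (g : ChordGen m) (k : ℕ) (i : Fin m) :
    readStrand (List.replicate k g) i = if g.meets i then List.range k else [] := by
  rw [readStrand, List.length_replicate]
  split_ifs with h
  · rw [List.filter_eq_self]
    intro a ha
    simp [List.mem_range.mp ha, h]
  · rw [List.filter_eq_nil_iff]
    intro a ha
    simp [List.mem_range.mp ha, h]

theorem diagram_eq_of_readName_eq {m k : ℕ} {V : ChordWord m} {W : ChordWord k}
    (h : V.readName = W.readName) : V.diagram = W.diagram :=
  congrArg (Quotient.mk chordNameSetoid) (Subtype.ext h)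

/-- A word on at most three strands has the same diagram and the same standard knot as a word on
three strands. -/
theorem exists_three {m : ℕ} (h1 : 1 ≤ m) (h3 : m ≤ 3) (V : ChordWord m) :
    V.standardKnot.IsKnot ∧ ∃ W : ChordWord 3, W.diagram = V.diagram ∧
      W.standardKnot.Isotopic V.standardKnot := by
  have two : ∀ k : ℕ, standardKnot (List.replicate k (⟨0, 1, by decide⟩ : ChordGen 2)) =
      [⟨.cup true, 0⟩, ⟨.cup true, 1⟩] ++ twists 0 (List.replicate k [.sing, .under]).flatten ++
        twists 0 [.over] ++ [⟨.cap, 1⟩, ⟨.cap, 0⟩] := by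
    intro k
    rw [standardKnot, closure_eq, slices_append]
    have : slices ((List.replicate k (⟨0, 1, by decide⟩ : ChordGen 2)).flatMap
        ChordGen.singularBraid) = twists 0 (List.replicate k [.sing, .under]).flatten := by
      induction k with
      | zero => rfl
      | succ k ih =>
        rw [List.replicate_succ, List.flatMap_cons, slices_append, ih]
        rfl
    rw [this, ← List.append_assoc]
    rfl
  have three : ∀ k : ℕ, standardKnot (List.replicate k (⟨0, 1, by decide⟩ : ChordGen 3)) =
      [⟨.cup true, 0⟩, ⟨.cup true, 1⟩, ⟨.cup true, 2⟩] ++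
        twists 0 (List.replicate k [.sing, .under]).flatten ++ [⟨.cross .over, 1⟩] ++
        twists 0 [.over] ++ [⟨.cap, 2⟩, ⟨.cap, 1⟩, ⟨.cap, 0⟩] := by
    intro k
    rw [standardKnot, closure_three, slices_append]
    have : slices ((List.replicate k (⟨0, 1, by decide⟩ : ChordGen 3)).flatMap
        ChordGen.singularBraid) = twists 0 (List.replicate k [.sing, .under]).flatten := by
      induction k with
      | zero => rfl
      | succ k ih =>
        rw [List.replicate_succ, List.flatMap_cons, slices_append, ih]
        rfl
    rw [this]
    simp only [List.append_assoc]
    rfl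
  have iso : ∀ k : ℕ, IsoFrom []
      (standardKnot (List.replicate k (⟨0, 1, by decide⟩ : ChordGen 3)))
      (standardKnot (List.replicate k (⟨0, 1, by decide⟩ : ChordGen 2))) := by
    intro k
    rw [two, three]
    exact isoFrom_destabilize_three _ _ (by decide)
  -- On one strand there are no chords, and on two strands only powers of a single chord. In both
  -- cases the extra crossings of the larger unknot braid are removed by destabilization.
  have hm : m = 1 ∨ m = 2 ∨ m = 3 := by omega
  rcases hm with rfl | rfl | rfl
  · have hV : V = [] := by
      rcases V with _ | ⟨⟨l, r, h⟩, V⟩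
      · rfl
      · exact absurd h (by revert l r; decide)
    subst hV
    refine ⟨⟨rfl, rfl⟩, [], rfl, ?_⟩
    refine .trans _ _ _ ((iso 0).isotopic (isKnot_standardKnot _).1) ?_
    have h : IsoFrom [] (standardKnot (m := 2) []) (standardKnot (m := 1) []) :=
      isoFrom_destabilize_two (t := .over) (by decide)
    exact h.isotopic rfl
  · obtain ⟨k, rfl⟩ : ∃ k, V = List.replicate k ⟨0, 1, by decide⟩ := by
      refine ⟨V.length, List.eq_replicate_of_mem ?_⟩
      rintro ⟨l, r, h⟩ -
      fin_cases l <;> fin_cases r <;> first | rfl | exact absurd h (by decide)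
    refine ⟨⟨?_, ?_⟩, List.replicate k ⟨0, 1, by decide⟩, ?_, ?_⟩
    · exact (iso k).run_eq.symm.trans (isKnot_standardKnot _).1
    · have h : ∀ (k a b c d : ℕ), (twists 0 (List.replicate k [.sing, .under]).flatten).foldl
          sweepStep ⟨[a, b, c, d], 2, 0⟩ = ⟨[a, b, c, d], 2, 0⟩ := by
        intro k a b c d
        induction k with
        | zero => rfl
        | succ k ih => rw [List.replicate_succ]; exact ih
      rw [two, components, List.foldl_append, List.foldl_append, List.foldl_append]
      have e : List.foldl sweepStep ⟨[], 0, 0⟩ [⟨.cup true, 0⟩, ⟨.cup true, 1⟩] =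
        ⟨[0, 1, 1, 0], 2, 0⟩ := rfl
      rw [e, h]
      rfl
    · refine diagram_eq_of_readName_eq ?_
      simp [readName, readStrand_replicate, List.finRange_succ, ChordGen.meets]
    · exact (iso k).isotopic (isKnot_standardKnot _).1
  · exact ⟨isKnot_standardKnot V, V, rfl, .refl _⟩

end ChordWord

namespace SingularBraid.IsFlatInvariant

variable {H : Type*} {k : ℕ} {Φ : SliceWord → H}

theorem flatValue_chordBraid (hΦ : IsFlatInvariant k Φ) (W : ChordWord 3) (hW : W.length = k) :
    flatValue k Φ (chordBraid (W.map ChordGen.missing)) = some (Φ W.standardKnot) := by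
  rw [← ChordWord.flatten_standardBraid]
  exact hΦ.flatValue_flatten _ W.isKnot_standardKnot (W.numSing_standardKnot.trans hW)

/-- The value on a standard knot depends only on the chord diagram. -/
theorem apply_standardKnot_eq (hΦ : IsFlatInvariant k Φ) {V W : ChordWord 3} (hV : V.length = k)
    (h : V.diagram = W.diagram) : Φ V.standardKnot = Φ W.standardKnot := by
  have hW : W.length = k := by
    rw [← ChordWord.numChords_diagram, ← h, ChordWord.numChords_diagram, hV]
  obtain ⟨f, hf, hn⟩ := ChordWord.exists_name_isRotated h
  have := hΦ.flatValue_eq_of_isRotated (V.nodup_labels_labelled hf)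
    (W.nodup_labels_labelled Function.injective_id) hn
  rw [ChordWord.gens_labelled, ChordWord.gens_labelled, hΦ.flatValue_chordBraid V hV,
    hΦ.flatValue_chordBraid W hW] at this
  exact Option.some.inj this

/-- Every value is the value of a standard knot. -/
theorem exists_apply_eq_standardKnot (hΦ : IsFlatInvariant k Φ) (w : SingularBraid 3)
    (hw : w.closure.IsKnot) (hk : w.closure.numSing = k) :
    ∃ W : ChordWord 3, W.length = k ∧ Φ w.closure = Φ W.standardKnot := by
  obtain ⟨L, hL, h⟩ := hΦ.exists_flatValue_eq w hw hk
  refine ⟨L.map ChordGen.ofMissing, by simpa using hL, Option.some.inj ?_⟩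
  rw [← hΦ.flatValue_chordBraid _ (by simpa using hL), h, List.map_map]
  congr 2
  rw [show ChordGen.missing ∘ ChordGen.ofMissing = id from funext ChordGen.missing_ofMissing,
    List.map_id]

end SingularBraid.IsFlatInvariant

/-! ### Descending induction and the theorem -/

/-- The class of a diagram modulo crossing changes and isotopies between closed braids. -/
noncomputable def braidClass (b n : ℕ) (D : SliceWord) : (SliceWord →₀ ℤ) ⧸ braidReductions b n :=
  QuotientAddGroup.mk (Finsupp.single D 1)

theorem braidClass_eq_of_isotopic {b n : ℕ} {D E : SliceWord} (hD : D ∈ closedBraidKnots b)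
    (hE : E ∈ closedBraidKnots b) (h : D.Isotopic E) : braidClass b n D = braidClass b n E :=
  (QuotientAddGroup.eq_iff_sub_mem).mpr
    (AddSubgroup.subset_closure (.inl (.inr ⟨D, hD, E, hE, h, rfl⟩)))

theorem braidClass_eq_zero {b n : ℕ} {D : SliceWord} (hD : D ∈ closedBraidKnots b)
    (h : n < D.numSing) : braidClass b n D = 0 :=
  (QuotientAddGroup.eq_zero_iff _).mpr (AddSubgroup.subset_closure (.inr ⟨D, hD, h, rfl⟩))

theorem braidClass_skein {b n m : ℕ} (hm : m ≤ b) (u w : SingularBraid m) (i : ℕ) (h : i + 1 < m)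
    (hK : (closure (u ++ ⟨.sing, i, h⟩ :: w)).IsKnot) :
    braidClass b n (closure (u ++ ⟨.under, i, h⟩ :: w)) -
      braidClass b n (closure (u ++ ⟨.over, i, h⟩ :: w)) =
        braidClass b n (closure (u ++ ⟨.sing, i, h⟩ :: w)) := by
  have : braidClass b n (closure (u ++ ⟨.sing, i, h⟩ :: w)) -
      braidClass b n (closure (u ++ ⟨.under, i, h⟩ :: w)) +
      braidClass b n (closure (u ++ ⟨.over, i, h⟩ :: w)) = 0 :=
    (QuotientAddGroup.eq_zero_iff _).mpr
      (AddSubgroup.subset_closure (.inl (.inl ⟨m, hm, u, w, i, h, hK, rfl⟩)))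
  rw [← sub_eq_zero, ← neg_eq_zero, ← this]
  abel

/-- The classes of the standard knots of the chord diagrams with at least `k` and at most `n`
chords. -/
noncomputable def standardSpan (table : ChordDiagram → Braiding) (n k : ℕ) :
    Submodule ℤ ((SliceWord →₀ ℤ) ⧸ braidReductions 3 n) :=
  Submodule.span ℤ ((fun D => braidClass 3 n (table D).word.standardKnot) ''
    {D | D.braidIndex ≤ 3 ∧ k ≤ D.numChords ∧ D.numChords ≤ n})

/-- A crossing change alters the class by the class of a closed 3-braid knot with one more double
point, which lies in `S`. -/
theorem isFlatInvariant_mkQ {n k : ℕ} (S : Submodule ℤ ((SliceWord →₀ ℤ) ⧸ braidReductions 3 n))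
    (h : ∀ w : SingularBraid 3, w.closure.IsKnot → w.closure.numSing = k + 1 →
      braidClass 3 n w.closure ∈ S) :
    IsFlatInvariant k fun D => S.mkQ (braidClass 3 n D) where
  change u v i hi hK hk := by
    rw [Submodule.mkQ_apply, Submodule.mkQ_apply, Submodule.Quotient.eq]
    rw [isKnot_closure_iff] at hK
    have hs : (closure (u ++ ⟨.sing, i, hi⟩ :: v)).IsKnot := by
      rw [isKnot_closure_iff]
      simpa [SingularBraid.permutation] using hK
    rw [braidClass_skein (le_refl 3) u v i hi hs]
    refine h _ hs ?_
    rw [← hk, numSing_closure, numSing_closure, List.countP_append, List.countP_append,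
      List.countP_cons, List.countP_cons]
    simp [add_assoc]
  isotopic v w hv hw _ _ h := by
    rw [braidClass_eq_of_isotopic ⟨hv, 3, le_rfl, v, rfl⟩ ⟨hw, 3, le_rfl, w, rfl⟩ h]

/-- The class of a closed 3-braid is a combination of the classes of standard knots. -/
theorem braidClass_mem_standardSpan {table : ChordDiagram → Braiding}
    (htable : ∀ D : ChordDiagram, D.braidIndex ≤ 3 →
      (table D).strands ≤ 3 ∧ (table D).word.diagram = D)
    (n d : ℕ) : ∀ (k : ℕ) (w : SingularBraid 3), n < k + d → w.closure.IsKnot →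
      w.closure.numSing = k → braidClass 3 n w.closure ∈ standardSpan table n k := by
  -- The variable `d` exceeds the number of double points still available up to order `n`; when it
  -- is 0, the knot has more than `n` of them.
  induction d with
  | zero =>
    intro k w hk hw hs
    rw [braidClass_eq_zero ⟨hw, 3, le_rfl, w, rfl⟩ (hs ▸ hk)]
    exact zero_mem _
  | succ d ih =>
    intro k w hk hw hs
    by_cases hn : n < k
    · rw [braidClass_eq_zero ⟨hw, 3, le_rfl, w, rfl⟩ (hs ▸ hn)]
      exact zero_mem _
    -- Modulo the standard knots with at least `k + 1` chords, crossings can be changed freely.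
    have hΦ := isFlatInvariant_mkQ (k := k) (standardSpan table n (k + 1))
      fun w => ih (k + 1) w (by omega)
    obtain ⟨W, hW, h⟩ := hΦ.exists_apply_eq_standardKnot w hw hs
    have hb : W.diagram.braidIndex ≤ 3 :=
      iInf₂_le (f := fun (B : Braiding) (_ : B.word.diagram = W.diagram) => (B.strands : ℕ∞))
        ⟨3, by decide, W⟩ rfl
    obtain ⟨h3, hd⟩ := htable _ hb
    obtain ⟨hK, V, hV, hiso⟩ := ChordWord.exists_three (table W.diagram).pos h3
      (table W.diagram).word
    have hWV := hΦ.apply_standardKnot_eq hW (hd.symm.trans hV.symm)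
    have hVt : braidClass 3 n V.standardKnot =
        braidClass 3 n (table W.diagram).word.standardKnot :=
      braidClass_eq_of_isotopic ⟨V.isKnot_standardKnot, 3, le_rfl, _, rfl⟩ ⟨hK, _, h3, _, rfl⟩ hiso
    simp only [hVt] at hWV
    rw [hWV] at h
    -- The given knot and the chosen standard knot of the same `k`-chord diagram differ by a
    -- combination of standard knots with more chords.
    have hsub := (Submodule.Quotient.eq _).mp h
    have hle : standardSpan table n (k + 1) ≤ standardSpan table n k :=
      Submodule.span_mono (Set.image_mono fun D hD => ⟨hD.1, by have := hD.2.1; omega, hD.2.2⟩)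
    refine (Submodule.sub_mem_iff_left _ ?_).mp (hle hsub)
    refine Submodule.subset_span ⟨W.diagram, ⟨hb, ?_, ?_⟩, rfl⟩ <;>
      rw [ChordWord.numChords_diagram] <;> omega

theorem extendSing_eq_apply {A : Type*} [AddCommGroup A] (v : SliceWord → A) {D : SliceWord}
    (h : D.numSing = 0) : extendSing v D = v D := by
  refine resolveFrom_eq_apply v [] D fun x hx => ?_
  simpa using (List.countP_eq_zero.mp h) x hx

theorem theorem4p4
    (table : ChordDiagram → Braiding)
    (htable : ∀ D : ChordDiagram, D.braidIndex ≤ 3 →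
      (table D).strands ≤ 3 ∧ (table D).word.diagram = D)
    (n : ℕ) (β : SingularBraid 3) (hβ : β.IsNonsingular) (hK : β.closure.IsKnot) :
    ∃ c : ChordDiagram →₀ ℤ,
      (∀ D ∈ c.support, D.numChords ≤ n ∧ D.braidIndex ≤ 3) ∧
      Finsupp.single β.closure 1 -
          c.sum (fun D a => a • Finsupp.single (table D).word.standardKnot 1) ∈
        braidReductions 3 n ∧
      ∀ (A : Type*) [AddCommGroup A] (v : SliceWord → A),
        IsKnotInvariant v → IsFiniteType n v →
          v β.closure =
            c.sum (fun D a => a • extendSing v (table D).word.standardKnot) := by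
  have hs : β.closure.numSing = 0 := by
    rw [numSing_closure, List.countP_eq_zero]
    exact fun l hl => by simpa using hβ l hl
  -- For a nonsingular braid `k = 0`, and `d = n + 1` is the least value with `n < k + d`.
  have hmem := braidClass_mem_standardSpan htable n (n + 1) 0 β (by omega) hK hs
  obtain ⟨c, hc, hsum⟩ := (Finsupp.mem_span_image_iff_linearCombination ℤ).mp hmem
  have hred : Finsupp.single β.closure 1 -
      c.sum (fun D a => a • Finsupp.single (table D).word.standardKnot 1) ∈
        braidReductions 3 n := by
    refine (QuotientAddGroup.eq_iff_sub_mem).mp (hsum.symm.trans ?_)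
    rw [Finsupp.linearCombination_apply, ← QuotientAddGroup.mk'_apply, map_finsuppSum]
    rfl
  refine ⟨c, fun D hD => ⟨((Finsupp.mem_supported _ _).mp hc hD).2.2,
    ((Finsupp.mem_supported _ _).mp hc hD).1⟩, hred, fun A _ v hv hn => ?_⟩
  -- The coefficients were fixed before the invariant: applying its extension to the reduction gives
  -- the formula, with plain `v` on the nonsingular closure.
  have h0 := extendSing_of_mem_braidReductions hv hn hred
  rw [← Finsupp.linearCombination_apply, map_sub, map_finsuppSum, sub_eq_zero] at h0
  simpa [Finsupp.linearCombination_single, extendSing_eq_apply v hs] using h0
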